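/- Let $d,n\ge 1$ be integers, $1\le p<\infty$ and $-n<\alpha<p-n$. Write $\mathbb R^d$ also for $\mathbb R^d\times\{0\}^n\subset\mathbb R^{d+n}$, let $\mu_\alpha$ be the measure on $\mathbb R^{d+n}$ with density $\min(1,\operatorname{dist}(x,\mathbb R^d))^{\alpha}$ with respect to Lebesgue measure, and put $s=1-(\alpha+n)/p\in(0,1)$. All functions are complex-valued. **Spaces.** Let $\mathcal D_{d,k}$ be the set of dyadic cubes $Q=2^{-k}((0,1]^d+m)$, $m\in\mathbb Z^d$, $k\in\mathbb Z$, with edge length $\ell(Q)=2^{-k}$; write $Q\sim Q'$ if $\frac12\le \ell(Q)/\ell(Q')\le 2$ and $\overline Q\cap\overline{Q'}\neq\emptyset$, and $f_Q$ for the Lebesgue mean of $f$ over $Q$. $B^s_{p,p}(\mathbb R^d)$ is the space of $f\in L^1_{\rm loc}(\mathbb R^d)$ with $$\|f\|_{B^s_{p,p}}=\|f\|_{L^p(\mathbb R^d)}+\Big(\sum_{k=0}^\infty 2^{ksp}\sum_{Q\in\mathcal D_{d,k}}|Q|\sum_{Q'\sim Q}|f_Q-f_{Q'}|^p\Big)^{1/p}<\infty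 .$$ $W^{1,p}(\mathbb R^{d+n},\mu_\alpha)$ is the space of $f\in L^1_{\rm loc}(\mathbb R^{d+n})$ whose distributional gradient $\nabla f$ on $\mathbb R^{d+n}$ is in $L^1_{\rm loc}(\mathbb R^{d+n})$ and for which $\|f\|_{W^{1,p}}=\|f\|_{L^p(\mu_\alpha)}+\|\nabla f\|_{L^p(\mu_\alpha)}<\infty$. **Whitney extension.** For $Q\in\mathcal D_{d,k}$ let $\mathcal A_Q$ be the set of $P\in\mathcal D_{d+n,k}$ with $P\subset (Q\times[-2^{-k+1},2^{-k+1}]^n)\setminus(Q\times(-2^{-k},2^{-k})^n)$, and let $\mathcal D^0_d=\bigcup_{k\ge0}\mathcal D_{d,k}$. Let $(\psi_P)$, $P\in\bigcup_{Q\in\mathcal D^0_d}\mathcal A_Q$, be any family of smooth functions $\psi_P:\mathbb R^{d+n}\to[0,1]$ such that, with constants $C,c>0$ independent of $P$, $\psi_P$ is $C/\ell(P)$-Lipschitz, $\psi_P\ge c$ on $P$, $\operatorname{supp}\psi_P$ is contained in the $\ell(P)/4$-neighborhood of $P$, and $\sum_{Q\in\mathcal D^0_d}\sum_{P\in\mathcal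 A_Q}\psi_P=1$ on $\bigcup_{Q\in\mathcal D^0_d}\bigcup_{P\in\mathcal A_Q}P$. For $f\in L^1_{\rm loc}(\mathbb R^d)$ put, on all of $\mathbb R^{d+n}$, $$\mathcal Ef(x)=\sum_{Q\in\mathcal D^0_d}\sum_{P\in\mathcal A_Q}f_Q\,\psi_P(x).$$ **Theorem.** The pair $\big(B^{1-(\alpha+n)/p}_{p,p}(\mathbb R^d),\,W^{1,p}(\mathbb R^{d+n},\mu_\alpha)\big)$ is a Whitney trace-extension pair, that is: 1. $\mathcal E$ maps $B^s_{p,p}(\mathbb R^d)$ boundedly into $W^{1,p}(\mathbb R^{d+n},\mu_\alpha)$; 2. for every $f\in W^{1,p}(\mathbb R^{d+n},\mu_\alpha)$ the trace $$\mathcal Rf(x)=\lim_{r\to0}\frac1{\mu_\alpha(B((x,0),r))}\int_{B((x,0),r)}f\,d\mu_\alpha$$ exists for almost every $x\in\mathbb R^d$ and $\mathcal Rf\in L^1_{\rm loc}(\mathbb R^d)$; 3. $\mathcal R$ maps $W^{1,p}(\mathbb R^{d+n},\mu_\alpha)$ boundedly into $B^s_{p,p}(\mathbb R^d)$; 4.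 $\mathcal R(\mathcal Ef)=f$ almost everywhere for every $f\in B^s_{p,p}(\mathbb R^d)$. -/

import Mathlib

open MeasureTheory Set Filter Topology
open scoped ENNReal NNReal ContDiff

noncomputable section

/-! ## Dyadic cubes -/

/-- The dyadic semi-open cube `2^{-k} ((0,1]^ι + m)` of `ℝ^ι`, given by its level `k ∈ ℤ` and its
corner `m ∈ ℤ^ι`. For nonempty `ι` different data give different cubes. -/
@[ext]
structure DyadicCube (ι : Type) where
  level : ℤ
  corner : ι → ℤ

namespace DyadicCube

variable {ι : Type}

/-- The edge length `ℓ(Q) = 2^{-k}`. -/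
def edge (Q : DyadicCube ι) : ℝ := (2 : ℝ) ^ (-Q.level)

/-- The points of the cube. -/
def toSet (Q : DyadicCube ι) : Set (EuclideanSpace ℝ ι) :=
  {x | ∀ i, Q.edge * (Q.corner i : ℝ) < x i ∧ x i ≤ Q.edge * ((Q.corner i : ℝ) + 1)}

/-- The relation `Q ∼ Q'`: comparable edge lengths and intersecting closures. -/
def Neighbor (Q Q' : DyadicCube ι) : Prop :=
  1 / 2 ≤ Q.edge / Q'.edge ∧ Q.edge / Q'.edge ≤ 2 ∧
    (closure Q.toSet ∩ closure Q'.toSet).Nonempty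

end DyadicCube

/-! ## Besov spaces through dyadic averages -/

/-- The Besov norm of `B^s_{p,q}(ℝ^ι, μ)`, for finite exponents `p` and `q`, with values in
`[0,∞]`. -/
def besovNorm {ι : Type} [Fintype ι] (s p q : ℝ) (μ : Measure (EuclideanSpace ℝ ι))
    (f : EuclideanSpace ℝ ι → ℂ) : ℝ≥0∞ :=
  eLpNorm f (ENNReal.ofReal p) μ +
    (∑' k : ℕ, ENNReal.ofReal ((2 : ℝ) ^ ((k : ℝ) * s * q)) *
      (∑' m : ι → ℤ, μ (DyadicCube.toSet ⟨(k : ℤ), m⟩) *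
        ∑' Q' : {Q' : DyadicCube ι // DyadicCube.Neighbor ⟨(k : ℤ), m⟩ Q'},
          ‖(⨍ x in DyadicCube.toSet ⟨(k : ℤ), m⟩, f x ∂μ) - ⨍ x in Q'.1.toSet, f x ∂μ‖ₑ ^ p)
        ^ (q / p)) ^ (1 / q)

/-- The Besov space `B^s_{p,q}(ℝ^ι, μ)`: the locally integrable functions of finite norm. -/
def besovSpace {ι : Type} [Fintype ι] (s p q : ℝ) (μ : Measure (EuclideanSpace ℝ ι)) :
    Set (EuclideanSpace ℝ ι → ℂ) :=
  {f | LocallyIntegrable f volume ∧ besovNorm s p q μ f < ⊤}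

/-! ## First-order weighted Sobolev spaces -/

/-- `G` is locally integrable and is the distributional gradient of `f` on the whole of `ℝ^ι`. -/
def IsWeakGradient {ι : Type} [Fintype ι] [DecidableEq ι]
    (f : EuclideanSpace ℝ ι → ℂ) (G : EuclideanSpace ℝ ι → EuclideanSpace ℂ ι) : Prop :=
  LocallyIntegrable G volume ∧
    ∀ (i : ι) (φ : EuclideanSpace ℝ ι → ℝ), ContDiff ℝ ∞ φ → HasCompactSupport φ →
      ∫ x, (fderiv ℝ φ x (EuclideanSpace.single i 1)) • f x = -∫ x, φ x • G x i

/-- The norm `‖f‖_{L^p(μ)} + ‖∇f‖_{L^p(μ)}`, with value `∞` if `f` has no locally integrable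
distributional gradient. The gradient is unique up to Lebesgue null sets, so that for `μ`
absolutely continuous with respect to Lebesgue measure (the case of interest) the infimum is over
one value only. -/
def sobolevNorm {ι : Type} [Fintype ι] [DecidableEq ι] (p : ℝ)
    (μ : Measure (EuclideanSpace ℝ ι)) (f : EuclideanSpace ℝ ι → ℂ) : ℝ≥0∞ :=
  ⨅ (G : EuclideanSpace ℝ ι → EuclideanSpace ℂ ι) (_ : IsWeakGradient f G),
    eLpNorm f (ENNReal.ofReal p) μ + eLpNorm G (ENNReal.ofReal p) μ

/-- The weighted Sobolev space `W^{1,p}(ℝ^ι, μ)`. -/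
def sobolevSpace {ι : Type} [Fintype ι] [DecidableEq ι] (p : ℝ)
    (μ : Measure (EuclideanSpace ℝ ι)) : Set (EuclideanSpace ℝ ι → ℂ) :=
  {f | LocallyIntegrable f volume ∧ sobolevNorm p μ f < ⊤}

/-! ## The space `ℝ^{d+n}`, the subspace `ℝ^d × {0}^n` and the measures `μ_α` -/

/-- `ℝ^d`. -/
abbrev Base (d : ℕ) : Type := EuclideanSpace ℝ (Fin d)

/-- `ℝ^{d+n} = ℝ^d × ℝ^n` with its Euclidean norm; the coordinates `Sum.inl i` are those of `ℝ^d`,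
the coordinates `Sum.inr j` those of `ℝ^n`. -/
abbrev Ambient (d n : ℕ) : Type := EuclideanSpace ℝ (Fin d ⊕ Fin n)

/-- The point `(x, 0)` of `ℝ^{d+n}`. -/
def embedBase {d : ℕ} (n : ℕ) (x : Base d) : Ambient d n :=
  WithLp.toLp 2 (Sum.elim (fun i => x i) (fun _ => 0))

/-- The measure `μ_α` on `ℝ^{d+n}` with density `min(1, dist(x, ℝ^d × {0}^n))^α`. -/
def weightedMeasure (d n : ℕ) (α : ℝ) : Measure (Ambient d n) :=
  volume.withDensity fun x =>
    ENNReal.ofReal ((min 1 (Metric.infDist x (range (embedBase (d := d) n)))) ^ α)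

/-! ## The Whitney extension -/

/-- `Q × S` as a subset of `ℝ^{d+n}`, for `Q ⊆ ℝ^d` and `S ⊆ ℝ^n`. -/
def prodSet {d n : ℕ} (Q : Set (Base d)) (S : Set (Fin n → ℝ)) : Set (Ambient d n) :=
  {x | WithLp.toLp 2 (fun i => x (Sum.inl i)) ∈ Q ∧ (fun j => x (Sum.inr j)) ∈ S}

/-- The collection `A_Q` of the cubes `P` of `ℝ^{d+n}` of the same size as `Q` with
`P ⊆ (Q × [-2ℓ(Q), 2ℓ(Q)]^n) \ (Q × (-ℓ(Q), ℓ(Q))^n)`. -/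
def whitneyCubes {d : ℕ} (n : ℕ) (Q : DyadicCube (Fin d)) : Set (DyadicCube (Fin d ⊕ Fin n)) :=
  {P | P.level = Q.level ∧
    P.toSet ⊆ prodSet Q.toSet (univ.pi fun _ => Icc (-(2 * Q.edge)) (2 * Q.edge)) \
      prodSet Q.toSet (univ.pi fun _ => Ioo (-Q.edge) Q.edge)}

/-- The dyadic cubes of `ℝ^d` of edge length at most `1`. -/
abbrev UnitDyadicCube (d : ℕ) : Type := {Q : DyadicCube (Fin d) // 0 ≤ Q.level}

/-- `ψ` is a family of bump functions subordinate to the Whitney cubes `P ∈ A_Q`, `ℓ(Q) ≤ 1`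
(its values at other cubes play no role). -/
structure IsWhitneyBumpFamily (d n : ℕ)
    (ψ : DyadicCube (Fin d ⊕ Fin n) → Ambient d n → ℝ) : Prop where
  smooth : ∀ Q : UnitDyadicCube d, ∀ P ∈ whitneyCubes n Q.1, ContDiff ℝ ∞ (ψ P)
  mem_Icc : ∀ Q : UnitDyadicCube d, ∀ P ∈ whitneyCubes n Q.1, ∀ x, ψ P x ∈ Icc (0 : ℝ) 1
  lipschitz : ∃ C : ℝ, ∀ Q : UnitDyadicCube d, ∀ P ∈ whitneyCubes n Q.1, ∀ x y,
    |ψ P x - ψ P y| ≤ C / P.edge * dist x y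
  lower_bound : ∃ c : ℝ, 0 < c ∧ ∀ Q : UnitDyadicCube d, ∀ P ∈ whitneyCubes n Q.1,
    ∀ x ∈ P.toSet, c ≤ ψ P x
  support_subset : ∀ Q : UnitDyadicCube d, ∀ P ∈ whitneyCubes n Q.1,
    tsupport (ψ P) ⊆ Metric.thickening (P.edge / 4) P.toSet
  sum_eq_one : ∀ Q₀ : UnitDyadicCube d, ∀ P₀ ∈ whitneyCubes n Q₀.1, ∀ x ∈ P₀.toSet,
    ∑' Q : UnitDyadicCube d, ∑' P : whitneyCubes n Q.1, ψ P.1 x = 1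

/-- The Whitney extension `∑_Q ∑_{P ∈ A_Q} (⨍_Q f) ψ_P` of `f`, with `Q` running through the
dyadic cubes of edge length at most `1`. At every point only finitely many terms are nonzero. -/
def whitneyExtension {d n : ℕ} (ψ : DyadicCube (Fin d ⊕ Fin n) → Ambient d n → ℝ)
    (f : Base d → ℂ) : Ambient d n → ℂ :=
  fun x => ∑' Q : UnitDyadicCube d, ∑' P : whitneyCubes n Q.1,
    (⨍ y in Q.1.toSet, f y) * ((ψ P.1 x : ℝ) : ℂ)

/-! ## Traces and Whitney trace-extension pairs -/

/-- The averages of `f` over the balls `B((x,0),r)` with respect to `μ` are defined for small `r`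
and tend to `l` as `r → 0`. -/
def HasTraceAt {d n : ℕ} (μ : Measure (Ambient d n)) (f : Ambient d n → ℂ) (x : Base d)
    (l : ℂ) : Prop :=
  (∀ᶠ r in 𝓝[>] (0 : ℝ), IntegrableOn f (Metric.ball (embedBase n x) r) μ) ∧
    Tendsto (fun r : ℝ => ⨍ y in Metric.ball (embedBase n x) r, f y ∂μ) (𝓝[>] 0) (𝓝 l)

/-- The trace function `x ↦ lim_{r → 0} ⨍_{B((x,0),r)} f dμ` (meaningful where the limit
exists). -/
def traceFun {d n : ℕ} (μ : Measure (Ambient d n)) (f : Ambient d n → ℂ) : Base d → ℂ :=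
  fun x => limUnder (𝓝[>] (0 : ℝ)) fun r => ⨍ y in Metric.ball (embedBase n x) r, f y ∂μ

/-- `(X, Y)` is a Whitney trace-extension pair, where `X` is a space of functions on `ℝ^d` with
quasinorm `normX` and `Y` a space of functions on `(ℝ^{d+n}, μ)` with quasinorm `normY`. The
extension and the trace are linear, so that continuity is boundedness. -/
structure IsWhitneyTraceExtensionPair {d n : ℕ}
    (ψ : DyadicCube (Fin d ⊕ Fin n) → Ambient d n → ℝ) (μ : Measure (Ambient d n))
    (X : Set (Base d → ℂ)) (normX : (Base d → ℂ) → ℝ≥0∞)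
    (Y : Set (Ambient d n → ℂ)) (normY : (Ambient d n → ℂ) → ℝ≥0∞) : Prop where
  extension_mem : ∀ f ∈ X, whitneyExtension ψ f ∈ Y
  extension_bounded : ∃ C : ℝ≥0, ∀ f ∈ X, normY (whitneyExtension ψ f) ≤ C * normX f
  trace_exists : ∀ f ∈ Y, ∀ᵐ x : Base d, ∃ l : ℂ, HasTraceAt μ f x l
  trace_locallyIntegrable : ∀ f ∈ Y, LocallyIntegrable (traceFun μ f) volume
  trace_mem : ∀ f ∈ Y, traceFun μ f ∈ X
  trace_bounded : ∃ C : ℝ≥0, ∀ f ∈ Y, normX (traceFun μ f) ≤ C * normY f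
  trace_extension : ∀ f ∈ X, traceFun μ (whitneyExtension ψ f) =ᵐ[volume] f

end

/-!
Points of `ℝ^{d+n}` are written `(x, y)`; a function on the subspace `ℝ^d` is a function of `x`.

**Traces.** The tool is the Poincaré inequality on convex sets (`lintegral_lintegral_sub_le`), used
on the boxes `Q × {|y| < ℓ(Q) / 2}`. These boxes touch the subspace, so that the inequality works
on both sides of it and needs only a gradient in `L^1_loc`. Two averages of `f` over such boxes of
comparable size and position differ by at most a multiple of
`2^{k(d - s/2)} ∫ |∇f| min(1, |y|)^{1 - n - s/2}`, where `ℓ(Q) = 2^{-k}` and the integral is over a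
slightly larger box (`enorm_average_box_sub_le`). The integrand does not depend on the scale, so the
averages over the boxes above a point telescope into a geometric series and converge almost
everywhere to a function `T` (`ae_exists_tendsto_boxAverage`). Jensen's inequality for the measure
`min(1, |y|)^{-n + s/2} dX`, which is finite on bounded sets, turns the `p`-th power of the integral
into `∫ |∇f|^p min(1, |y|)^{α + s/2}` (`two_rpow_mul_singIntegral_rpow_le`). The additional power
`s/2` of the weight pays for the summation over all scales (`tsum_localEnergy_le`). This
gives the bounds of the Besov seminorm (`tsum_besov_limit_le`) and of the `L^p` norm
(`eLpNorm_limit_boxAverage_le`) of `T`. The Poincaré inequality also shows that `f(x, y)` is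
close to `T(x)` on thin slabs (`lintegral_slab_sub_limit_le`); with Lebesgue's differentiation
theorem for `T` it follows that `T` is the limit of the averages over balls with respect to `μ_α`
(`ae_hasTraceAt_limit`).

**Extensions.** At the heights `2^{-k} ≤ |y| < 2 · 2^{-k}`, in the maximum norm, the extension is a
finite sum over the neighbors of the cube of level `k` that contains `x` (`tsum_eq_patch`). For
`k ≥ 0` the bump functions add up to `1` there, so a constant may be subtracted from the
coefficients: the gradient is at most a multiple of `2^k` times the differences of the
averages over neighboring cubes. The layer contributes the factor `2^{-k(α + n)}`, and
`2^{kp} 2^{-k(α + n)} = 2^{ksp}` is the factor in the Besov norm (`energy_extensionGradient_le`).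
The last layer, where the extension is cut off, is controlled by the `L^p` norm of `f`. For the
`L^p` norm of the extension the factors `2^{-k(α + n)}` are summable because `α > -n`.

The extension is smooth away from the subspace, and the pointwise gradient has to be identified as
the distributional gradient across it. The boundary terms in the integration by parts with a cutoff
vanish for directions parallel to the subspace; for the other directions `f(x)`, which has no
derivative in these directions, is subtracted first, and the difference is small near
the subspace (`lintegral_slab_whitneyExtension_sub_le`, `isWeakGradient_whitneyExtension`).

**The trace of the extension.** Both `f(x)` and the trace of the extension are close to
the extension on thin slabs, hence equal almost everywhere (`limit_boxAverage_whitneyExtension`).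
-/


noncomputable section

/-! ### The product structure of the ambient space -/

/-- The `ℝ^d`-component of a point of `ℝ^{d+n}`. -/
def hor {d n : ℕ} (X : Ambient d n) : Base d := WithLp.toLp 2 fun i => X (Sum.inl i)

/-- The `ℝ^n`-component of a point of `ℝ^{d+n}`. -/
def ver {d n : ℕ} (X : Ambient d n) : EuclideanSpace ℝ (Fin n) :=
  WithLp.toLp 2 fun j => X (Sum.inr j)

/-- The point `(x, y)` of `ℝ^{d+n}`. -/
def joinPt {d n : ℕ} (x : Base d) (y : EuclideanSpace ℝ (Fin n)) : Ambient d n :=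
  WithLp.toLp 2 (Sum.elim (fun i => x i) fun j => y j)

section Product

variable {d n : ℕ}

@[simp] lemma hor_apply (X : Ambient d n) (i : Fin d) : hor X i = X (Sum.inl i) := rfl
@[simp] lemma ver_apply (X : Ambient d n) (j : Fin n) : ver X j = X (Sum.inr j) := rfl
@[simp] lemma hor_join (x : Base d) (y : EuclideanSpace ℝ (Fin n)) : hor (joinPt x y) = x := rfl
@[simp] lemma ver_join (x : Base d) (y : EuclideanSpace ℝ (Fin n)) : ver (joinPt x y) = y := rfl
@[simp] lemma join_hor_ver (X : Ambient d n) : joinPt (hor X) (ver X) = X := by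
  ext i; rcases i with i | i <;> rfl

lemma embedBase_eq_join (x : Base d) : embedBase n x = joinPt x 0 := rfl

lemma norm_sq_eq (X : Ambient d n) : ‖X‖ ^ 2 = ‖hor X‖ ^ 2 + ‖ver X‖ ^ 2 := by
  simp [EuclideanSpace.norm_sq_eq]

lemma hor_sub (X Y : Ambient d n) : hor (X - Y) = hor X - hor Y := rfl
lemma ver_sub (X Y : Ambient d n) : ver (X - Y) = ver X - ver Y := rfl

lemma norm_hor_le (X : Ambient d n) : ‖hor X‖ ≤ ‖X‖ := by
  have := norm_sq_eq X
  nlinarith [norm_nonneg X, norm_nonneg (hor X), sq_nonneg ‖ver X‖]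

lemma norm_ver_le (X : Ambient d n) : ‖ver X‖ ≤ ‖X‖ := by
  have := norm_sq_eq X
  nlinarith [norm_nonneg X, norm_nonneg (ver X), sq_nonneg ‖hor X‖]

lemma norm_le_hor_add_ver (X : Ambient d n) : ‖X‖ ≤ ‖hor X‖ + ‖ver X‖ := by
  have := norm_sq_eq X
  nlinarith [norm_nonneg X, norm_nonneg (ver X), norm_nonneg (hor X)]

lemma continuous_hor : Continuous (hor : Ambient d n → Base d) := by
  unfold hor; fun_prop

lemma continuous_ver : Continuous (ver : Ambient d n → EuclideanSpace ℝ (Fin n)) := by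
  unfold ver; fun_prop

lemma continuous_join :
    Continuous fun q : Base d × EuclideanSpace ℝ (Fin n) => joinPt q.1 q.2 := by
  unfold joinPt
  apply (PiLp.continuous_toLp 2 _).comp
  refine continuous_pi fun i => ?_
  rcases i with i | i <;> simp <;> fun_prop

lemma measurable_hor : Measurable (hor : Ambient d n → Base d) := continuous_hor.measurable
lemma measurable_ver : Measurable (ver : Ambient d n → EuclideanSpace ℝ (Fin n)) :=
  continuous_ver.measurable
lemma measurable_join :
    Measurable fun q : Base d × EuclideanSpace ℝ (Fin n) => joinPt q.1 q.2 :=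
  continuous_join.measurable

/-- Lebesgue measure on `ℝ^{d+n}` is the product of the Lebesgue measures. -/
lemma measurePreserving_join :
    MeasurePreserving (fun q : Base d × EuclideanSpace ℝ (Fin n) => joinPt q.1 q.2) volume
      volume := by
  have h1 := (PiLp.volume_preserving_ofLp (Fin d)).prod (PiLp.volume_preserving_ofLp (Fin n))
  have h2 := volume_measurePreserving_sumPiEquivProdPi_symm (fun _ : Fin d ⊕ Fin n => ℝ)
  have h3 := PiLp.volume_preserving_toLp (Fin d ⊕ Fin n)
  convert! h3.comp (h2.comp h1) using 1

/-- The map `(x, y) ↦ joinPt x y` as a measurable equivalence. -/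
def joinEquiv : Base d × EuclideanSpace ℝ (Fin n) ≃ᵐ Ambient d n where
  toFun q := joinPt q.1 q.2
  invFun X := (hor X, ver X)
  left_inv q := by simp
  right_inv X := by simp
  measurable_toFun := measurable_join
  measurable_invFun := measurable_hor.prodMk measurable_ver

lemma lintegral_eq_lintegral_join (h : Ambient d n → ℝ≥0∞) :
    ∫⁻ X, h X = ∫⁻ q : Base d × EuclideanSpace ℝ (Fin n), h (joinPt q.1 q.2) :=
  (measurePreserving_join.lintegral_comp_emb joinEquiv.measurableEmbedding h).symm

/-- Tonelli's theorem in `ℝ^{d+n}`. -/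
lemma lintegral_eq_lintegral_lintegral (h : Ambient d n → ℝ≥0∞) (hh : AEMeasurable h) :
    ∫⁻ X, h X = ∫⁻ x : Base d, ∫⁻ y : EuclideanSpace ℝ (Fin n), h (joinPt x y) := by
  rw [lintegral_eq_lintegral_join, Measure.volume_eq_prod, lintegral_prod]
  exact hh.comp_quasiMeasurePreserving measurePreserving_join.quasiMeasurePreserving

lemma infDist_range_embedBase (X : Ambient d n) :
    Metric.infDist X (range (embedBase (d := d) n)) = ‖ver X‖ := by
  apply le_antisymm
  · refine (Metric.infDist_le_dist_of_mem (mem_range_self (hor X))).trans ?_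
    rw [dist_eq_norm]
    refine (norm_le_hor_add_ver _).trans ?_
    simp [hor_sub, ver_sub, embedBase_eq_join]
  · refine (Metric.le_infDist (range_nonempty _)).2 ?_
    rintro _ ⟨x, rfl⟩
    rw [dist_eq_norm]
    simpa [ver_sub, embedBase_eq_join] using norm_ver_le (X - embedBase n x)

/-- The set `S × {‖y‖ < r}`. -/
def slab (S : Set (Base d)) (r : ℝ) : Set (Ambient d n) := {X | hor X ∈ S ∧ ‖ver X‖ < r}

lemma measurableSet_slab {S : Set (Base d)} (hS : MeasurableSet S) (r : ℝ) :
    MeasurableSet (slab S r : Set (Ambient d n)) :=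
  (measurable_hor hS).inter (measurableSet_lt measurable_ver.norm measurable_const)

lemma slab_mono {S S' : Set (Base d)} {r r' : ℝ} (h : S ⊆ S') (hr : r ≤ r') :
    (slab S r : Set (Ambient d n)) ⊆ slab S' r' := fun _ hX => ⟨h hX.1, hX.2.trans_le hr⟩

lemma lintegral_slab {S : Set (Base d)} (hS : MeasurableSet S) (r : ℝ) (h : Ambient d n → ℝ≥0∞)
    (hh : AEMeasurable h) :
    ∫⁻ X in slab S r, h X = ∫⁻ x in S, ∫⁻ y in Metric.ball (0 : EuclideanSpace ℝ (Fin n)) r,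
      h (joinPt x y) := by
  rw [← lintegral_indicator (measurableSet_slab hS r), lintegral_eq_lintegral_lintegral,
    ← lintegral_indicator hS]
  · congr 1 with x
    by_cases hx : x ∈ S
    · rw [indicator_of_mem hx, ← lintegral_indicator Metric.isOpen_ball.measurableSet]
      congr 1 with y
      by_cases hy : ‖y‖ < r <;> simp [slab, hx, hy, indicator]
    · simp [slab, hx, indicator]
  · exact hh.indicator (measurableSet_slab hS r)

lemma volume_slab {S : Set (Base d)} (hS : MeasurableSet S) (r : ℝ) :
    volume (slab S r : Set (Ambient d n)) =
      volume S * volume (Metric.ball (0 : EuclideanSpace ℝ (Fin n)) r) := by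
  rw [← setLIntegral_one, lintegral_slab hS r _ aemeasurable_const]
  simp [mul_comm]

/-! ### The weight -/

/-- The weight `min(1, |y|)` at the point `(x, y)`; its power `α` is the density of `μ_α`. -/
def wt (X : Ambient d n) : ℝ≥0∞ := min 1 ‖ver X‖ₑ

lemma measurable_wt : Measurable (wt : Ambient d n → ℝ≥0∞) :=
  measurable_const.min measurable_ver.enorm

lemma wt_le_one (X : Ambient d n) : wt X ≤ 1 := min_le_left _ _

lemma wt_ne_top (X : Ambient d n) : wt X ≠ ⊤ := ((wt_le_one X).trans_lt ENNReal.one_lt_top).ne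

lemma wt_ne_zero {X : Ambient d n} (h : ver X ≠ 0) : wt X ≠ 0 := by
  simp [wt, h]

lemma quasiMeasurePreserving_hor :
    Measure.QuasiMeasurePreserving (hor : Ambient d n → Base d) volume volume :=
  Measure.quasiMeasurePreserving_fst.comp
    (MeasurePreserving.symm joinEquiv measurePreserving_join).quasiMeasurePreserving

lemma quasiMeasurePreserving_ver :
    Measure.QuasiMeasurePreserving (ver : Ambient d n → EuclideanSpace ℝ (Fin n)) volume volume :=
  Measure.quasiMeasurePreserving_snd.comp
    (MeasurePreserving.symm joinEquiv measurePreserving_join).quasiMeasurePreserving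

lemma ae_ver_ne_zero (hn : 1 ≤ n) : ∀ᵐ X : Ambient d n, ver X ≠ 0 := by
  have : Nonempty (Fin n) := ⟨⟨0, hn⟩⟩
  exact quasiMeasurePreserving_ver.ae (measure_eq_zero_iff_ae_notMem.1
    (measure_singleton (0 : EuclideanSpace ℝ (Fin n))))

lemma lintegral_weightedMeasure (hn : 1 ≤ n) (α : ℝ) (h : Ambient d n → ℝ≥0∞) :
    ∫⁻ X, h X ∂(weightedMeasure d n α) = ∫⁻ X, wt X ^ α * h X := by
  rw [weightedMeasure, lintegral_withDensity_eq_lintegral_mul_non_measurable₀]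
  · refine lintegral_congr_ae ?_
    filter_upwards [ae_ver_ne_zero (d := d) hn] with X hX
    simp only [Pi.mul_apply]
    congr 1
    rw [infDist_range_embedBase, wt, ← ENNReal.ofReal_rpow_of_pos (by positivity),
      ENNReal.ofReal_min, ENNReal.ofReal_one, ofReal_norm]
  · simp_rw [infDist_range_embedBase]
    exact ((measurable_const.min measurable_ver.norm).pow_const α).ennreal_ofReal.aemeasurable
  · exact ae_of_all _ fun _ => ENNReal.ofReal_lt_top

lemma weightedMeasure_absolutelyContinuous (α : ℝ) : weightedMeasure d n α ≪ volume :=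
  withDensity_absolutelyContinuous _ _

/-- The power `‖y‖^b` is integrable near the origin of `ℝ^n` for `b > -n`. -/
lemma lintegral_ball_one_rpow_lt_top (hn : 1 ≤ n) {b : ℝ} (hb : -(n : ℝ) < b) :
    ∫⁻ y in Metric.ball (0 : EuclideanSpace ℝ (Fin n)) 1, ‖y‖ₑ ^ b < ⊤ := by
  have : Nonempty (Fin n) := ⟨⟨0, hn⟩⟩
  have h1 : IntegrableOn (fun y : EuclideanSpace ℝ (Fin n) => ‖y‖ ^ b) (Metric.ball 0 1) := by
    refine integrableOn_ball_of_norm_le_rpow (C := 1) (α := -b) (by simpa using hn)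
      (by simp; linarith) ?_ (measurable_norm.pow_const b).aestronglyMeasurable
    refine ae_of_all _ fun y => ?_
    rw [neg_neg, one_mul, Real.norm_of_nonneg (by positivity)]
  refine lt_of_le_of_lt (le_of_eq ?_) h1.2
  have h0 : ∀ᵐ y : EuclideanSpace ℝ (Fin n), y ≠ 0 :=
    measure_eq_zero_iff_ae_notMem.1 (measure_singleton (0 : EuclideanSpace ℝ (Fin n)))
  refine lintegral_congr_ae (ae_restrict_of_ae ?_)
  filter_upwards [h0] with y hy
  have : 0 < ‖y‖ := norm_pos_iff.2 hy
  rw [Real.enorm_of_nonneg (by positivity), ← ENNReal.ofReal_rpow_of_pos this, ofReal_norm]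

lemma lintegral_ball_rpow (b : ℝ) {t : ℝ} (ht : 0 < t) :
    ∫⁻ y in Metric.ball (0 : EuclideanSpace ℝ (Fin n)) t, ‖y‖ₑ ^ b =
      ENNReal.ofReal t ^ (b + n) *
        ∫⁻ y in Metric.ball (0 : EuclideanSpace ℝ (Fin n)) 1, ‖y‖ₑ ^ b := by
  have h := Measure.map_addHaar_smul (volume : Measure (EuclideanSpace ℝ (Fin n))) ht.ne'
  have h1 : ∫⁻ y in Metric.ball (0 : EuclideanSpace ℝ (Fin n)) t, ‖y‖ₑ ^ b
      ∂(Measure.map (t • ·) volume) = ENNReal.ofReal t ^ b *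
        ∫⁻ y in Metric.ball (0 : EuclideanSpace ℝ (Fin n)) 1, ‖y‖ₑ ^ b := by
    rw [setLIntegral_map Metric.isOpen_ball.measurableSet (by fun_prop) (by fun_prop),
      ← lintegral_const_mul _ (by fun_prop)]
    have : (fun y : EuclideanSpace ℝ (Fin n) => t • y) ⁻¹' Metric.ball 0 t = Metric.ball 0 1 := by
      ext y
      simp [norm_smul, abs_of_pos ht, ht]
    rw [this]
    refine setLIntegral_congr_fun Metric.isOpen_ball.measurableSet fun y _ => ?_
    have ht' : ‖t‖ₑ ≠ 0 := by simp [ht.ne']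
    simp only [enorm_smul]
    rw [ENNReal.mul_rpow_of_ne_top (by simp) (by simp), Real.enorm_eq_ofReal ht.le]
  rw [h, Measure.restrict_smul, lintegral_smul_measure, finrank_euclideanSpace_fin,
    abs_of_pos (by positivity), ENNReal.ofReal_inv_of_pos (by positivity),
    ENNReal.ofReal_pow ht.le, smul_eq_mul] at h1
  have h0 : ENNReal.ofReal t ≠ 0 := by simpa using ht
  rw [ENNReal.rpow_add _ _ h0 (by simp), ENNReal.rpow_natCast, mul_right_comm, ← h1, mul_right_comm,
    ENNReal.inv_mul_cancel (by simp [h0]) (by simp), one_mul]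

/-- Jensen's inequality for powers. -/
lemma rpow_lintegral_le {Ω : Type*} [MeasurableSpace Ω] (ν : Measure Ω) {p : ℝ} (hp : 1 ≤ p)
    {f : Ω → ℝ≥0∞} (hf : AEMeasurable f ν) :
    (∫⁻ x, f x ∂ν) ^ p ≤ ν univ ^ (p - 1) * ∫⁻ x, f x ^ p ∂ν := by
  rcases eq_or_lt_of_le hp with rfl | hp
  · simp
  have hpq : p.HolderConjugate (p / (p - 1)) := .conjExponent hp
  have h := ENNReal.lintegral_mul_le_Lp_mul_Lq ν hpq hf (aemeasurable_const (b := 1))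
  simp only [Pi.mul_apply, mul_one, ENNReal.one_rpow, lintegral_const, one_mul] at h
  refine (ENNReal.rpow_le_rpow h (by linarith)).trans ?_
  rw [ENNReal.mul_rpow_of_nonneg _ _ (by linarith), ← ENNReal.rpow_mul, ← ENNReal.rpow_mul,
    mul_comm]
  have e1 : 1 / p * p = 1 := by field_simp
  have e2 : 1 / (p / (p - 1)) * p = p - 1 := by
    have : p - 1 ≠ 0 := by linarith
    field_simp
  rw [e1, e2, ENNReal.rpow_one]

/-- Jensen's inequality with respect to the measure of density `wt ^ (-c)`. -/
lemma rpow_setLIntegral_le_wt (hn : 1 ≤ n) {p : ℝ} (hp : 1 ≤ p) (c : ℝ) (A : Set (Ambient d n))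
    {h : Ambient d n → ℝ≥0∞} (hh : AEMeasurable h) :
    (∫⁻ X in A, h X) ^ p ≤ (∫⁻ X in A, wt X ^ (-c)) ^ (p - 1) *
      ∫⁻ X in A, wt X ^ (c * (p - 1)) * h X ^ p := by
  have hm : Measurable fun X : Ambient d n => wt X ^ (-c) := measurable_wt.pow_const _
  have hm' : AEMeasurable (fun X : Ambient d n => wt X ^ c * h X) (volume.restrict A) :=
    ((measurable_wt.pow_const _).aemeasurable.mul hh).restrict
  have h1 := rpow_lintegral_le ((volume.restrict A).withDensity fun X => wt X ^ (-c)) hp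
    (f := fun X => wt X ^ c * h X) (hm'.mono_ac (withDensity_absolutelyContinuous _ _))
  have h0 := ae_restrict_of_ae (s := A) (ae_ver_ne_zero (d := d) hn)
  have hfin : ∀ᵐ X ∂(volume.restrict A), wt X ^ (-c) < ⊤ := by
    filter_upwards [h0] with X hX
    exact (ENNReal.rpow_ne_top_of_ne_zero (wt_ne_zero hX) (wt_ne_top X)).lt_top
  rw [lintegral_withDensity_eq_lintegral_mul_non_measurable₀ _ hm.aemeasurable hfin,
    lintegral_withDensity_eq_lintegral_mul_non_measurable₀ _ hm.aemeasurable hfin,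
    withDensity_apply _ MeasurableSet.univ, setLIntegral_univ] at h1
  convert! h1 using 2
  · refine lintegral_congr_ae ?_
    filter_upwards [h0] with X hX
    simp only [Pi.mul_apply]
    rw [← mul_assoc, ← ENNReal.rpow_add _ _ (wt_ne_zero hX) (wt_ne_top X)]
    simp
  · refine lintegral_congr_ae ?_
    filter_upwards [h0] with X hX
    simp only [Pi.mul_apply]
    rw [ENNReal.mul_rpow_of_nonneg _ _ (by linarith), ← mul_assoc, ← ENNReal.rpow_mul,
      ← ENNReal.rpow_add _ _ (wt_ne_zero hX) (wt_ne_top X)]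
    congr 2; ring

lemma lintegral_slab_wt_rpow {S : Set (Base d)} (hS : MeasurableSet S) (b : ℝ)
    {t : ℝ} (ht : 0 < t) (ht1 : t ≤ 1) :
    ∫⁻ X in (slab S t : Set (Ambient d n)), wt X ^ b = volume S * (ENNReal.ofReal t ^ (b + n) *
      ∫⁻ y in Metric.ball (0 : EuclideanSpace ℝ (Fin n)) 1, ‖y‖ₑ ^ b) := by
  rw [lintegral_slab hS _ _ (measurable_wt.pow_const _).aemeasurable, ← lintegral_ball_rpow b ht,
    mul_comm, ← setLIntegral_const]
  refine setLIntegral_congr_fun hS fun x _ => ?_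
  refine setLIntegral_congr_fun Metric.isOpen_ball.measurableSet fun y hy => ?_
  have : ‖y‖ₑ ≤ 1 := by
    rw [← ofReal_norm, ← ENNReal.ofReal_one]
    exact ENNReal.ofReal_le_ofReal ((mem_ball_zero_iff.1 hy).le.trans ht1)
  simp [wt, this]

end Product

/-! ### Dyadic cubes -/

namespace DyadicCube

section

variable {ι : Type}

lemma edge_pos (Q : DyadicCube ι) : 0 < Q.edge := by unfold edge; positivity

/-- The dyadic cube of level `k` that contains `x`. -/
def containing (k : ℤ) (x : EuclideanSpace ℝ ι) : DyadicCube ι :=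
  ⟨k, fun i => ⌈(2 : ℝ) ^ k * x i⌉ - 1⟩

@[simp] lemma level_containing (k : ℤ) (x : EuclideanSpace ℝ ι) : (containing k x).level = k := rfl

lemma mem_toSet_iff {Q : DyadicCube ι} {x : EuclideanSpace ℝ ι} :
    x ∈ Q.toSet ↔ containing Q.level x = Q := by
  have h2 : (0 : ℝ) < 2 ^ Q.level := by positivity
  simp only [toSet, mem_ofPred_eq, DyadicCube.ext_iff, containing, funext_iff, true_and, edge,
    zpow_neg]
  refine forall_congr' fun i => ?_
  rw [sub_eq_iff_eq_add, Int.ceil_eq_iff, inv_mul_lt_iff₀ h2, le_inv_mul_iff₀ h2]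
  simp

lemma mem_toSet_containing (k : ℤ) (x : EuclideanSpace ℝ ι) : x ∈ (containing k x).toSet :=
  mem_toSet_iff.2 rfl

lemma toSet_containing_subset {j k : ℤ} (h : k ≤ j) (x : EuclideanSpace ℝ ι) :
    (containing j x).toSet ⊆ (containing k x).toSet := by
  intro z hz
  obtain ⟨i, rfl⟩ := Int.le.dest h
  rw [mem_toSet_iff] at hz ⊢
  simp only [containing, DyadicCube.ext_iff, funext_iff, true_and, sub_left_inj] at hz ⊢
  intro a
  have key : ∀ (y : EuclideanSpace ℝ ι) (N : ℤ), ⌈(2 : ℝ) ^ k * y a⌉ ≤ N ↔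
      ⌈(2 : ℝ) ^ (k + i) * y a⌉ ≤ 2 ^ i * N := by
    intro y N
    rw [Int.ceil_le, Int.ceil_le, zpow_add₀ two_ne_zero, zpow_natCast]
    push_cast
    rw [mul_comm ((2 : ℝ) ^ k) (2 ^ i), mul_assoc, mul_le_mul_iff_right₀ (by positivity)]
  refine le_antisymm ?_ ?_
  · rw [key, hz a, ← key]
  · rw [key, ← hz a, ← key]

lemma edge_eq_of_level_add_one {Q Q' : DyadicCube ι} (h : Q'.level = Q.level + 1) :
    Q.edge = 2 * Q'.edge := by
  simp only [edge, h, zpow_neg, zpow_add₀ (two_ne_zero (α := ℝ)), zpow_one]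
  field_simp

lemma edge_eq_of_level_eq {Q Q' : DyadicCube ι} (h : Q'.level = Q.level) : Q'.edge = Q.edge := by
  simp [edge, h]

lemma Neighbor.level_eq {Q Q' : DyadicCube ι} (h : Neighbor Q Q') :
    Q'.level = Q.level - 1 ∨ Q'.level = Q.level ∨ Q'.level = Q.level + 1 := by
  obtain ⟨h1, h2, -⟩ := h
  have e : Q.edge / Q'.edge = 2 ^ (Q'.level - Q.level) := by
    rw [edge, edge, ← zpow_sub₀ two_ne_zero]; congr 1; ring
  rw [e] at h1 h2
  have h1' : (2 : ℝ) ^ (-1 : ℤ) ≤ 2 ^ (Q'.level - Q.level) := by simpa using h1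
  have h2' : (2 : ℝ) ^ (Q'.level - Q.level) ≤ 2 ^ (1 : ℤ) := by simpa using h2
  rw [zpow_le_zpow_iff_right₀ one_lt_two] at h1' h2'
  omega

lemma toSet_eq (Q : DyadicCube ι) : Q.toSet = WithLp.ofLp ⁻¹' (univ.pi fun i =>
    Ioc (Q.edge * (Q.corner i : ℝ)) (Q.edge * ((Q.corner i : ℝ) + 1))) := by
  ext x; simp [toSet]

lemma measurable_containing_corner (k : ℤ) :
    Measurable fun x : EuclideanSpace ℝ ι => (containing k x).corner := by
  refine measurable_pi_lambda _ fun i => ?_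
  simp only [containing]
  fun_prop

lemma iUnion_toSet (k : ℤ) : ⋃ m : ι → ℤ, (⟨k, m⟩ : DyadicCube ι).toSet = univ := by
  refine eq_univ_of_forall fun x => mem_iUnion.2 ⟨(containing k x).corner, ?_⟩
  exact mem_toSet_containing k x

lemma pairwise_disjoint_toSet (k : ℤ) :
    Pairwise fun m m' : ι → ℤ => Disjoint (⟨k, m⟩ : DyadicCube ι).toSet
      (⟨k, m'⟩ : DyadicCube ι).toSet := by
  intro m m' hne
  refine Set.disjoint_left.2 fun x h1 h2 => hne ?_
  rw [mem_toSet_iff] at h1 h2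
  have := h1.symm.trans h2
  simpa using this

lemma neighbor_containing_succ (k : ℤ) (x : EuclideanSpace ℝ ι) :
    Neighbor (containing k x) (containing (k + 1) x) := by
  have he := edge_eq_of_level_add_one (Q := containing k x) (Q' := containing (k + 1) x) rfl
  have hp := (containing (k + 1) x).edge_pos
  refine ⟨?_, ?_, x, subset_closure (mem_toSet_containing k x),
    subset_closure (mem_toSet_containing _ x)⟩
  · rw [he]; field_simp; norm_num
  · rw [he]; field_simp; norm_num

lemma closure_toSet (Q : DyadicCube ι) : closure Q.toSet = {x | ∀ i,
    Q.edge * (Q.corner i : ℝ) ≤ x i ∧ x i ≤ Q.edge * ((Q.corner i : ℝ) + 1)} := by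
  have h : closure (WithLp.ofLp ⁻¹' (univ.pi fun i =>
      Ioc (Q.edge * (Q.corner i : ℝ)) (Q.edge * ((Q.corner i : ℝ) + 1)))) =
      (WithLp.ofLp : EuclideanSpace ℝ ι → ι → ℝ) ⁻¹' closure (univ.pi fun i =>
      Ioc (Q.edge * (Q.corner i : ℝ)) (Q.edge * ((Q.corner i : ℝ) + 1))) :=
    ((PiLp.homeomorph 2 fun _ : ι => ℝ).preimage_closure _).symm
  rw [toSet_eq, h, closure_pi_set]
  ext x
  simp only [mem_preimage, Set.mem_pi, mem_univ, true_imp_iff, mem_ofPred_eq]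
  refine forall_congr' fun i => ?_
  rw [closure_Ioc, mem_Icc]
  have := Q.edge_pos
  nlinarith

/-- A point of a neighbor of `Q` lies in a cube of the same level as `Q` that is at most two steps
away from `Q`. -/
lemma Neighbor.corner_containing {Q Q' : DyadicCube ι} (h : Neighbor Q Q')
    {x : EuclideanSpace ℝ ι} (hx : x ∈ Q'.toSet) (i : ι) :
    (containing Q.level x).corner i - Q.corner i ∈ Finset.Icc (-2 : ℤ) 2 := by
  have hl := h.level_eq
  obtain ⟨z, hz, hz'⟩ := h.2.2
  rw [closure_toSet] at hz hz'
  obtain ⟨h1, h2⟩ := hz i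
  obtain ⟨h3, h4⟩ := hz' i
  obtain ⟨h5, h6⟩ := hx i
  obtain ⟨h7, h8⟩ := mem_toSet_containing Q.level x i
  have hc : (containing Q.level x).edge = Q.edge := edge_eq_of_level_eq rfl
  rw [hc] at h7 h8
  have hp := Q.edge_pos
  have hp' := Q'.edge_pos
  set c := (containing Q.level x).corner i
  rw [Finset.mem_Icc]
  have he : Q'.edge ≤ 2 * Q.edge := by
    have := h.1
    rw [le_div_iff₀ hp'] at this
    linarith
  have i1 : (c : ℝ) < Q.corner i + 3 := by
    refine lt_of_mul_lt_mul_left (a := Q.edge) ?_ hp.le; linarith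
  have i2 : (Q.corner i : ℝ) < c + 3 := by
    refine lt_of_mul_lt_mul_left (a := Q.edge) ?_ hp.le; linarith
  norm_cast at i1 i2
  omega

/-- If a point of `Q` has distance less than `3 ℓ(Q') / 8` from `Q'` in each coordinate, and the
levels differ by at most one, then `Q` and `Q'` are neighbors. -/
lemma neighbor_of_near {Q Q' : DyadicCube ι}
    (hl : Q'.level = Q.level - 1 ∨ Q'.level = Q.level ∨ Q'.level = Q.level + 1)
    {x : EuclideanSpace ℝ ι} (hx : x ∈ Q.toSet)
    (hx' : ∀ i, Q'.edge * (Q'.corner i : ℝ) - 3 * Q'.edge / 8 < x i ∧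
      x i < Q'.edge * ((Q'.corner i : ℝ) + 1) + 3 * Q'.edge / 8) : Neighbor Q Q' := by
  have hp := Q.edge_pos
  have hp' := Q'.edge_pos
  -- In units of the smaller edge the corners are integers and the margin is less than `1`, so that
  -- it does not weaken the inequalities between the corners.
  have key : ∀ i, Q.edge * (Q.corner i : ℝ) ≤ Q'.edge * ((Q'.corner i : ℝ) + 1) ∧
      Q'.edge * (Q'.corner i : ℝ) ≤ Q.edge * ((Q.corner i : ℝ) + 1) := by
    intro i
    obtain ⟨h1, h2⟩ := hx i
    obtain ⟨h3, h4⟩ := hx' i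
    rcases hl with hl | hl | hl
    · have he := edge_eq_of_level_add_one (Q := Q') (Q' := Q) (by omega)
      rw [he] at h3 h4 ⊢
      have i1 : (4 * Q.corner i : ℝ) < 8 * (Q'.corner i + 1) + 3 := by
        refine lt_of_mul_lt_mul_left (a := Q.edge) ?_ hp.le; linarith
      have i2 : (8 * Q'.corner i - 3 : ℝ) < 4 * (Q.corner i + 1) := by
        refine lt_of_mul_lt_mul_left (a := Q.edge) ?_ hp.le; linarith
      norm_cast at i1 i2
      have j1 : Q.corner i ≤ 2 * (Q'.corner i + 1) := by omega
      have j2 : 2 * Q'.corner i ≤ Q.corner i + 1 := by omega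
      have j1' : (Q.corner i : ℝ) ≤ 2 * (Q'.corner i + 1) := by exact_mod_cast j1
      have j2' : (2 * Q'.corner i : ℝ) ≤ Q.corner i + 1 := by exact_mod_cast j2
      constructor <;> nlinarith
    · have he := edge_eq_of_level_eq hl
      rw [he] at h3 h4 ⊢
      have i1 : (8 * Q.corner i : ℝ) < 8 * (Q'.corner i + 1) + 3 := by
        refine lt_of_mul_lt_mul_left (a := Q.edge) ?_ hp.le; linarith
      have i2 : (8 * Q'.corner i - 3 : ℝ) < 8 * (Q.corner i + 1) := by
        refine lt_of_mul_lt_mul_left (a := Q.edge) ?_ hp.le; linarith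
      norm_cast at i1 i2
      have j1 : Q.corner i ≤ Q'.corner i + 1 := by omega
      have j2 : Q'.corner i ≤ Q.corner i + 1 := by omega
      have j1' : (Q.corner i : ℝ) ≤ Q'.corner i + 1 := by exact_mod_cast j1
      have j2' : (Q'.corner i : ℝ) ≤ Q.corner i + 1 := by exact_mod_cast j2
      constructor <;> nlinarith
    · have he := edge_eq_of_level_add_one hl
      rw [he] at h1 h2 ⊢
      have i1 : (16 * Q.corner i : ℝ) < 8 * (Q'.corner i + 1) + 3 := by
        refine lt_of_mul_lt_mul_left (a := Q'.edge) ?_ hp'.le; linarith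
      have i2 : (8 * Q'.corner i - 3 : ℝ) < 16 * (Q.corner i + 1) := by
        refine lt_of_mul_lt_mul_left (a := Q'.edge) ?_ hp'.le; linarith
      norm_cast at i1 i2
      have j1 : 2 * Q.corner i ≤ Q'.corner i + 1 := by omega
      have j2 : Q'.corner i ≤ 2 * (Q.corner i + 1) := by omega
      have j1' : (2 * Q.corner i : ℝ) ≤ Q'.corner i + 1 := by exact_mod_cast j1
      have j2' : (Q'.corner i : ℝ) ≤ 2 * (Q.corner i + 1) := by exact_mod_cast j2
      constructor <;> nlinarith
  have hr : 1 / 2 ≤ Q.edge / Q'.edge ∧ Q.edge / Q'.edge ≤ 2 := by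
    rw [le_div_iff₀ hp', div_le_iff₀ hp']
    rcases hl with hl | hl | hl
    · have he := edge_eq_of_level_add_one (Q := Q') (Q' := Q) (by omega)
      constructor <;> linarith
    · have he := edge_eq_of_level_eq hl
      constructor <;> linarith
    · have he := edge_eq_of_level_add_one hl
      constructor <;> linarith
  refine ⟨hr.1, hr.2, WithLp.toLp 2 fun i =>
    max (Q.edge * (Q.corner i : ℝ)) (Q'.edge * (Q'.corner i : ℝ)), ?_, ?_⟩
  · rw [closure_toSet]
    exact fun i => ⟨le_max_left _ _, max_le (by nlinarith) (key i).2⟩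
  · rw [closure_toSet]
    exact fun i => ⟨le_max_right _ _, max_le (key i).1 (by nlinarith)⟩

end

section

variable {ι : Type} [Fintype ι]

lemma measurableSet_toSet (Q : DyadicCube ι) : MeasurableSet Q.toSet := by
  rw [toSet_eq]
  exact (MeasurableSet.univ_pi fun i => measurableSet_Ioc).preimage (by fun_prop)

lemma volume_toSet (Q : DyadicCube ι) :
    volume Q.toSet = (2 : ℝ≥0∞) ^ (-(Q.level : ℝ) * Fintype.card ι) := by
  rw [toSet_eq, (PiLp.volume_preserving_ofLp ι).measure_preimage
    (MeasurableSet.univ_pi fun i => measurableSet_Ioc).nullMeasurableSet, Real.volume_pi_Ioc]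
  have : ∀ a : ℝ, Q.edge * (a + 1) - Q.edge * a = Q.edge := fun a => by ring
  simp only [this, Finset.prod_const, Finset.card_univ]
  rw [ENNReal.rpow_mul, ENNReal.rpow_natCast, edge, ← Real.rpow_intCast,
    ← ENNReal.ofReal_rpow_of_pos two_pos]
  simp

lemma volume_toSet_ne_zero (Q : DyadicCube ι) : volume Q.toSet ≠ 0 := by
  rw [volume_toSet]; simp [ENNReal.rpow_eq_zero_iff]

lemma volume_toSet_ne_top (Q : DyadicCube ι) : volume Q.toSet ≠ ⊤ := by
  rw [volume_toSet]; simp [ENNReal.rpow_eq_top_iff]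

/-- An integral is the sum of the integrals over the (preimages of the) cubes of a given level. -/
lemma lintegral_eq_tsum_preimage {Ω : Type*} [MeasurableSpace Ω] (ν : Measure Ω)
    {π : Ω → EuclideanSpace ℝ ι} (hπ : Measurable π) (k : ℤ) (g : Ω → ℝ≥0∞) :
    ∫⁻ x, g x ∂ν = ∑' m : ι → ℤ, ∫⁻ x in π ⁻¹' (⟨k, m⟩ : DyadicCube ι).toSet, g x ∂ν := by
  rw [← lintegral_iUnion (fun m => hπ (measurableSet_toSet _)), ← preimage_iUnion, iUnion_toSet]
  · simp
  · exact fun m m' h => (pairwise_disjoint_toSet k h).preimage π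

lemma lintegral_eq_tsum (ν : Measure (EuclideanSpace ℝ ι)) (k : ℤ)
    (g : EuclideanSpace ℝ ι → ℝ≥0∞) :
    ∫⁻ x, g x ∂ν = ∑' m : ι → ℤ, ∫⁻ x in (⟨k, m⟩ : DyadicCube ι).toSet, g x ∂ν :=
  lintegral_eq_tsum_preimage ν measurable_id k g

/-- A finite family that contains all neighbors of `Q`. -/
def nearby (Q : DyadicCube ι) : Finset (DyadicCube ι) := by
  classical
  exact (Finset.Icc (-1 : ℤ) 1 ×ˢ Fintype.piFinset fun _ : ι => Finset.Icc (-2 : ℤ) 2).image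
    fun a => ⟨Q.level + a.1, fun i => (if a.1 = -1 then Q.corner i / 2 else
      if a.1 = 0 then Q.corner i else 2 * Q.corner i) + a.2 i⟩

/-- The bound for the number of neighbors of a dyadic cube. -/
def neighborBound (ι : Type) [Fintype ι] : ℕ := 3 * 5 ^ Fintype.card ι

lemma card_nearby_le (Q : DyadicCube ι) : Q.nearby.card ≤ neighborBound ι := by
  classical
  refine Finset.card_image_le.trans ?_
  simp [neighborBound, Finset.card_product]

lemma Neighbor.mem_nearby {Q Q' : DyadicCube ι} (h : Neighbor Q Q') : Q' ∈ Q.nearby := by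
  classical
  have hl := h.level_eq
  obtain ⟨x, hx, hx'⟩ := h.2.2
  rw [closure_toSet] at hx hx'
  rw [nearby, Finset.mem_image]
  refine ⟨(Q'.level - Q.level, fun i => Q'.corner i - (if Q'.level - Q.level = -1 then
    Q.corner i / 2 else if Q'.level - Q.level = 0 then Q.corner i else 2 * Q.corner i)), ?_, ?_⟩
  · simp only [Finset.mem_product, Finset.mem_Icc, Fintype.mem_piFinset]
    refine ⟨by omega, fun i => ?_⟩
    obtain ⟨h1, h2⟩ := hx i
    obtain ⟨h3, h4⟩ := hx' i
    have hp := Q.edge_pos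
    have hp' := Q'.edge_pos
    rcases hl with hl | hl | hl
    · have he := edge_eq_of_level_add_one (Q := Q') (Q' := Q) (by omega)
      rw [he] at h3 h4
      have i1 : (2 * Q'.corner i : ℝ) ≤ Q.corner i + 1 := by
        refine le_of_mul_le_mul_left (a := Q.edge) ?_ hp; linarith
      have i2 : (Q.corner i : ℝ) ≤ 2 * (Q'.corner i + 1) := by
        refine le_of_mul_le_mul_left (a := Q.edge) ?_ hp; linarith
      norm_cast at i1 i2
      rw [if_pos (by omega)]
      omega
    · have he := edge_eq_of_level_eq hl
      rw [he] at h3 h4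
      have i1 : (Q'.corner i : ℝ) ≤ Q.corner i + 1 := by
        refine le_of_mul_le_mul_left (a := Q.edge) ?_ hp; linarith
      have i2 : (Q.corner i : ℝ) ≤ Q'.corner i + 1 := by
        refine le_of_mul_le_mul_left (a := Q.edge) ?_ hp; linarith
      norm_cast at i1 i2
      rw [if_neg (by omega), if_pos (by omega)]
      omega
    · have he := edge_eq_of_level_add_one hl
      rw [he] at h1 h2
      have i1 : (Q'.corner i : ℝ) ≤ 2 * (Q.corner i + 1) := by
        refine le_of_mul_le_mul_left (a := Q'.edge) ?_ hp'; linarith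
      have i2 : (2 * Q.corner i : ℝ) ≤ Q'.corner i + 1 := by
        refine le_of_mul_le_mul_left (a := Q'.edge) ?_ hp'; linarith
      norm_cast at i1 i2
      rw [if_neg (by omega), if_neg (by omega)]
      omega
  · ext <;> simp

/-- The neighbors of `Q` as a finite set. -/
def neighborFinset (Q : DyadicCube ι) : Finset (DyadicCube ι) := by
  classical exact Q.nearby.filter (Neighbor Q)

lemma mem_neighborFinset {Q Q' : DyadicCube ι} : Q' ∈ Q.neighborFinset ↔ Neighbor Q Q' := by
  classical
  simp only [neighborFinset, Finset.mem_filter, and_iff_right_iff_imp]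
  exact Neighbor.mem_nearby

lemma card_neighborFinset_le (Q : DyadicCube ι) : Q.neighborFinset.card ≤ neighborBound ι := by
  classical
  exact (Finset.card_filter_le _ _).trans Q.card_nearby_le

lemma tsum_neighbor (Q : DyadicCube ι) (g : DyadicCube ι → ℝ≥0∞) :
    ∑' Q' : {Q' : DyadicCube ι // Neighbor Q Q'}, g Q' = ∑ Q' ∈ Q.neighborFinset, g Q' := by
  rw [← Finset.tsum_subtype]
  exact (Equiv.tsum_eq (Equiv.subtypeEquivRight fun _ => mem_neighborFinset) fun x => g x.1).symm

end

end DyadicCube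

/-! ### The Poincaré inequality on convex sets -/

section Poincare

variable {ι : Type} [Fintype ι]

lemma lintegral_comp_smul_add (h : EuclideanSpace ℝ ι → ℝ≥0∞) (hh : Measurable h)
    (a : EuclideanSpace ℝ ι) {t : ℝ} (ht : 1 / 2 ≤ t) :
    ∫⁻ Y, h (a + t • Y) ≤ 2 ^ Fintype.card ι * ∫⁻ Y, h Y := by
  have ht0 : 0 < t := by linarith
  have h1 : ∫⁻ Y, h (a + t • Y) = ∫⁻ Y, h (a + Y) ∂(Measure.map (t • ·) volume) := by
    rw [lintegral_map (by fun_prop) (by fun_prop)]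
  rw [h1, Measure.map_addHaar_smul _ ht0.ne', lintegral_smul_measure, lintegral_add_left_eq_self,
    finrank_euclideanSpace, smul_eq_mul]
  gcongr
  have : |(t ^ Fintype.card ι)⁻¹| ≤ 2 ^ Fintype.card ι := by
    rw [abs_of_pos (by positivity), ← inv_pow]
    gcongr
    rw [inv_le_comm₀ ht0 two_pos]; linarith
  calc ENNReal.ofReal |(t ^ Fintype.card ι)⁻¹| ≤ ENNReal.ofReal (2 ^ Fintype.card ι) :=
        ENNReal.ofReal_le_ofReal this
    _ = 2 ^ Fintype.card ι := by rw [ENNReal.ofReal_pow two_pos.le]; simp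

/-- The double integral of a function along the segments between the points of a convex set: of
the two endpoints one has a weight at least `1 / 2`, and it serves as the integration variable. -/
lemma lintegral_segment_le {V : Set (EuclideanSpace ℝ ι)} (hV : Convex ℝ V)
    (hVm : MeasurableSet V) {h : EuclideanSpace ℝ ι → ℝ≥0∞} (hh : Measurable h) {t : ℝ}
    (ht : t ∈ Icc (0 : ℝ) 1) :
    ∫⁻ X in V, ∫⁻ Y in V, h (X + t • (Y - X)) ≤
      2 ^ Fintype.card ι * volume V * ∫⁻ X in V, h X := by
  have key : ∀ s ∈ Icc (1 / 2 : ℝ) 1, ∀ X ∈ V, ∫⁻ Y in V, h ((1 - s) • X + s • Y) ≤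
      2 ^ Fintype.card ι * ∫⁻ X in V, h X := by
    intro s hs X hX
    rw [← lintegral_indicator hVm, ← lintegral_indicator hVm]
    refine le_trans (lintegral_mono fun Y => ?_)
      (lintegral_comp_smul_add (V.indicator h) (hh.indicator hVm) ((1 - s) • X) hs.1)
    by_cases hY : Y ∈ V
    · have := hV hX hY (by linarith [hs.2] : 0 ≤ 1 - s) (by linarith [hs.1] : 0 ≤ s) (by ring)
      simp [hY, this]
    · simp [hY]
  have e : ∀ X Y : EuclideanSpace ℝ ι, X + t • (Y - X) = (1 - t) • X + t • Y := by
    intro X Y; module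
  simp_rw [e]
  rcases le_total (1 / 2) t with h1 | h1
  · calc ∫⁻ X in V, ∫⁻ Y in V, h ((1 - t) • X + t • Y)
        ≤ ∫⁻ X in V, 2 ^ Fintype.card ι * ∫⁻ X in V, h X :=
          setLIntegral_mono measurable_const fun X hX => key t ⟨h1, ht.2⟩ X hX
      _ = 2 ^ Fintype.card ι * volume V * ∫⁻ X in V, h X := by
          rw [setLIntegral_const]; ring
  · rw [lintegral_lintegral_swap (by fun_prop)]
    calc ∫⁻ Y in V, ∫⁻ X in V, h ((1 - t) • X + t • Y)
        ≤ ∫⁻ X in V, 2 ^ Fintype.card ι * ∫⁻ X in V, h X := by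
          refine setLIntegral_mono measurable_const fun Y hY => ?_
          have := key (1 - t) ⟨by linarith, by linarith [ht.1]⟩ Y hY
          simpa [add_comm] using this
      _ = 2 ^ Fintype.card ι * volume V * ∫⁻ X in V, h X := by
          rw [setLIntegral_const]; ring

lemma enorm_sub_le_lintegral_fderiv {g : EuclideanSpace ℝ ι → ℂ} (hg : ContDiff ℝ 1 g)
    (X Y : EuclideanSpace ℝ ι) :
    ‖g X - g Y‖ₑ ≤ ∫⁻ t in Icc (0 : ℝ) 1, ‖fderiv ℝ g (X + t • (Y - X))‖ₑ * ‖Y - X‖ₑ := by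
  have hd : ∀ t : ℝ, HasDerivAt (fun t : ℝ => g (X + t • (Y - X)))
      (fderiv ℝ g (X + t • (Y - X)) (Y - X)) t := by
    intro t
    have h1 : HasDerivAt (fun t : ℝ => X + t • (Y - X)) (Y - X) t := by
      simpa using ((hasDerivAt_id t).smul_const (Y - X)).const_add X
    exact ((hg.differentiable one_ne_zero) _).hasFDerivAt.comp_hasDerivAt t h1
  have h := enorm_sub_le_lintegral_deriv_of_contDiffOn_Icc (f := fun t : ℝ => g (X + t • (Y - X)))
    (a := 0) (b := 1) (by fun_prop) zero_le_one
  rw [← enorm_neg, neg_sub]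
  simp only [one_smul, add_sub_cancel, zero_smul, add_zero] at h
  refine h.trans (lintegral_mono fun t => ?_)
  rw [(hd t).deriv]
  exact ContinuousLinearMap.le_opENorm _ _

/-- The Poincaré inequality for continuously differentiable functions. -/
lemma lintegral_lintegral_sub_le_of_contDiff {V : Set (EuclideanSpace ℝ ι)} (hV : Convex ℝ V)
    (hVm : MeasurableSet V) {D : ℝ≥0∞} (hD : ∀ X ∈ V, ∀ Y ∈ V, ‖Y - X‖ₑ ≤ D)
    {g : EuclideanSpace ℝ ι → ℂ} (hg : ContDiff ℝ 1 g) :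
    ∫⁻ X in V, ∫⁻ Y in V, ‖g X - g Y‖ₑ ≤
      D * (2 ^ Fintype.card ι * volume V * ∫⁻ X in V, ‖fderiv ℝ g X‖ₑ) := by
  have hc : Continuous (fderiv ℝ g) := hg.continuous_fderiv one_ne_zero
  calc ∫⁻ X in V, ∫⁻ Y in V, ‖g X - g Y‖ₑ
      ≤ ∫⁻ X in V, ∫⁻ Y in V, D * ∫⁻ t in Icc (0 : ℝ) 1, ‖fderiv ℝ g (X + t • (Y - X))‖ₑ := by
        refine setLIntegral_mono' hVm fun X hX => setLIntegral_mono' hVm fun Y hY => ?_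
        refine (enorm_sub_le_lintegral_fderiv hg X Y).trans ?_
        rw [lintegral_mul_const _ (by fun_prop), mul_comm]
        gcongr
        exact hD X hX Y hY
    _ = D * ∫⁻ t in Icc (0 : ℝ) 1, ∫⁻ X in V, ∫⁻ Y in V, ‖fderiv ℝ g (X + t • (Y - X))‖ₑ := by
        have m1 : Measurable fun q : ((EuclideanSpace ℝ ι) × (EuclideanSpace ℝ ι)) × ℝ =>
            ‖fderiv ℝ g (q.1.1 + q.2 • (q.1.2 - q.1.1))‖ₑ :=
          (hc.comp (by fun_prop)).measurable.enorm
        have m2 : ∀ X, Measurable fun q : (EuclideanSpace ℝ ι) × ℝ =>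
            ‖fderiv ℝ g (X + q.2 • (q.1 - X))‖ₑ := fun X =>
          (hc.comp (by fun_prop)).measurable.enorm
        have e : ∀ X, ∫⁻ Y in V, D * ∫⁻ t in Icc (0 : ℝ) 1, ‖fderiv ℝ g (X + t • (Y - X))‖ₑ =
            D * ∫⁻ t in Icc (0 : ℝ) 1, ∫⁻ Y in V, ‖fderiv ℝ g (X + t • (Y - X))‖ₑ := by
          intro X
          rw [lintegral_const_mul _ (m2 X).lintegral_prod_right', lintegral_lintegral_swap
            (m2 X).aemeasurable]
        have m3 : Measurable fun q : (EuclideanSpace ℝ ι) × ℝ =>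
            ∫⁻ Y in V, ‖fderiv ℝ g (q.1 + q.2 • (Y - q.1))‖ₑ := by
          apply Measurable.lintegral_prod_right' (f := fun q : ((EuclideanSpace ℝ ι) × ℝ) ×
            (EuclideanSpace ℝ ι) => ‖fderiv ℝ g (q.1.1 + q.1.2 • (q.2 - q.1.1))‖ₑ)
          exact (hc.comp (by fun_prop)).measurable.enorm
        simp_rw [e]
        rw [lintegral_const_mul _ m3.lintegral_prod_right', lintegral_lintegral_swap
          m3.aemeasurable]
    _ ≤ D * ∫⁻ t in Icc (0 : ℝ) 1,
        2 ^ Fintype.card ι * volume V * ∫⁻ X in V, ‖fderiv ℝ g X‖ₑ := by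
        gcongr D * ?_
        refine setLIntegral_mono' measurableSet_Icc fun t ht => ?_
        exact lintegral_segment_le hV hVm hc.measurable.enorm ht
    _ = D * (2 ^ Fintype.card ι * volume V * ∫⁻ X in V, ‖fderiv ℝ g X‖ₑ) := by
        simp


open scoped Convolution in
/-- The gradient of a mollification is dominated by the mollification of the weak gradient. -/
lemma enorm_fderiv_convolution_le [DecidableEq ι] {f : EuclideanSpace ℝ ι → ℂ}
    {G : EuclideanSpace ℝ ι → EuclideanSpace ℂ ι} (hf : LocallyIntegrable f volume)
    (hG : IsWeakGradient f G) (φ : ContDiffBump (0 : EuclideanSpace ℝ ι))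
    (x : EuclideanSpace ℝ ι) :
    ‖fderiv ℝ (φ.normed volume ⋆[ContinuousLinearMap.lsmul ℝ ℝ, volume] f) x‖ₑ ≤
      ∫⁻ t, ENNReal.ofReal (φ.normed volume (x - t)) * ‖G t‖ₑ := by
  set ρ : EuclideanSpace ℝ ι → ℝ := φ.normed volume with hρ
  have hρc : HasCompactSupport ρ := φ.hasCompactSupport_normed
  have hρs : ContDiff ℝ ∞ ρ := φ.contDiff_normed
  have hρ0 : ∀ y, 0 ≤ ρ y := φ.nonneg_normed
  have hρ1 : ContDiff ℝ 1 ρ := hρs.of_le (by norm_cast)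
  have hρx : Continuous fun t => ρ (x - t) := hρs.continuous.comp (by fun_prop)
  have hρxc : HasCompactSupport fun t => ρ (x - t) :=
    hρc.comp_homeomorph (Homeomorph.subLeft x)
  have hint : Integrable (fun t => ρ (x - t) • G t) volume :=
    hG.1.integrable_smul_left_of_hasCompactSupport hρx hρxc
  -- the derivative of the mollification in a coordinate direction
  have hd : ∀ v, fderiv ℝ (ρ ⋆[ContinuousLinearMap.lsmul ℝ ℝ, volume] f) x v =
      ∫ t, (fderiv ℝ ρ (x - t) v) • f t := by
    intro v
    rw [(hρc.hasFDerivAt_convolution_left (ContinuousLinearMap.lsmul ℝ ℝ) hρ1 hf x).fderiv,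
      convolution_eq_swap]
    rw [ContinuousLinearMap.integral_apply]
    · rfl
    · exact ((hρc.fderiv ℝ).convolutionExists_left _ (hρ1.continuous_fderiv one_ne_zero) hf
        x).integrable_swap
  have hi : ∀ i, fderiv ℝ (ρ ⋆[ContinuousLinearMap.lsmul ℝ ℝ, volume] f) x
      (EuclideanSpace.single i 1) = ∫ t, ρ (x - t) • G t i := by
    intro i
    have h := hG.2 i (fun t => ρ (x - t)) (hρs.comp (by fun_prop))
      (hρc.comp_homeomorph (Homeomorph.subLeft x))
    rw [hd, ← neg_neg (∫ t, ρ (x - t) • G t i), ← h, ← integral_neg]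
    congr 1 with t
    have : fderiv ℝ (fun t => ρ (x - t)) t = -fderiv ℝ ρ (x - t) := by
      have h1 := ((hρ1.differentiable one_ne_zero) (x - t)).hasFDerivAt.comp t
        ((hasFDerivAt_id t).const_sub x)
      have := h1.fderiv
      simpa [Function.comp_def] using this
    simp [this]
  have hv : ∀ v : EuclideanSpace ℝ ι, fderiv ℝ (ρ ⋆[ContinuousLinearMap.lsmul ℝ ℝ, volume] f) x v =
      ∫ t, ρ (x - t) • ∑ i, v i • G t i := by
    intro v
    have e : v = ∑ i, v i • EuclideanSpace.single i (1 : ℝ) := by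
      ext j; simp [Finset.sum_apply, Pi.single_apply]
    conv_lhs => rw [e, map_sum]
    simp_rw [map_smul, hi, Finset.smul_sum]
    rw [integral_finsetSum]
    · refine Finset.sum_congr rfl fun i _ => ?_
      rw [← integral_smul]
      congr 1 with t
      rw [smul_comm]
    · intro i _
      have h1 := ((EuclideanSpace.proj (𝕜 := ℂ) i).integrable_comp hint).smul (v i)
      refine h1.congr (ae_of_all _ fun t => ?_)
      simp [mul_left_comm]
  have hcs : ∀ (v : EuclideanSpace ℝ ι) t, ‖∑ i, v i • G t i‖ ≤ ‖v‖ * ‖G t‖ := by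
    intro v t
    refine (norm_sum_le _ _).trans ?_
    simp_rw [norm_smul]
    refine (Real.sum_mul_le_sqrt_mul_sqrt _ _ _).trans_eq ?_
    rw [EuclideanSpace.norm_eq, EuclideanSpace.norm_eq]
  have hop : ‖fderiv ℝ (ρ ⋆[ContinuousLinearMap.lsmul ℝ ℝ, volume] f) x‖ ≤
      ∫ t, ‖ρ (x - t) • G t‖ := by
    refine ContinuousLinearMap.opNorm_le_bound _ (integral_nonneg fun t => norm_nonneg _)
      fun v => ?_
    rw [hv, ← integral_mul_const]
    refine norm_integral_le_of_norm_le (hint.norm.mul_const _) (ae_of_all _ fun t => ?_)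
    rw [norm_smul, norm_smul, mul_assoc, mul_comm ‖G t‖]
    gcongr
    exact hcs v t
  calc ‖fderiv ℝ (ρ ⋆[ContinuousLinearMap.lsmul ℝ ℝ, volume] f) x‖ₑ
      = ENNReal.ofReal ‖fderiv ℝ (ρ ⋆[ContinuousLinearMap.lsmul ℝ ℝ, volume] f) x‖ :=
        (ofReal_norm _).symm
    _ ≤ ENNReal.ofReal (∫ t, ‖ρ (x - t) • G t‖) := ENNReal.ofReal_le_ofReal hop
    _ = ∫⁻ t, ENNReal.ofReal (ρ (x - t)) * ‖G t‖ₑ := by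
        rw [ofReal_integral_norm_eq_lintegral_enorm hint]
        congr 1 with t
        rw [enorm_smul, Real.enorm_eq_ofReal (hρ0 _)]

/-- The integral of a mollified density over `V` is at most that of the density over a
neighborhood of `V`. -/
lemma lintegral_convolution_le {ρ : EuclideanSpace ℝ ι → ℝ} (hρ : Continuous ρ)
    (hρ0 : ∀ x, 0 ≤ ρ x) (hρi : Integrable ρ) (hρ1 : ∫ x, ρ x = 1) {r : ℝ}
    (hρr : Function.support ρ ⊆ Metric.ball 0 r)
    {V : Set (EuclideanSpace ℝ ι)} {H : EuclideanSpace ℝ ι → ℝ≥0∞} (hH : AEMeasurable H) :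
    ∫⁻ x in V, ∫⁻ t, ENNReal.ofReal (ρ (x - t)) * H t ≤
      ∫⁻ t in Metric.cthickening r V, H t := by
  have hm : Measurable fun q : EuclideanSpace ℝ ι × EuclideanSpace ℝ ι =>
      ENNReal.ofReal (ρ (q.1 - q.2)) :=
    (hρ.comp (by fun_prop)).measurable.ennreal_ofReal
  rw [lintegral_lintegral_swap (hm.aemeasurable.mul hH.comp_snd),
    ← lintegral_indicator Metric.isClosed_cthickening.measurableSet]
  refine lintegral_mono fun t => ?_
  have hm' : Measurable fun x => ENNReal.ofReal (ρ (x - t)) :=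
    hm.comp (by fun_prop : Measurable fun x => (x, t))
  rw [lintegral_mul_const _ hm']
  have h1 : ∫⁻ x, ENNReal.ofReal (ρ (x - t)) = 1 := by
    rw [lintegral_sub_right_eq_self (fun x => ENNReal.ofReal (ρ x)),
      ← ofReal_integral_eq_lintegral_ofReal hρi (ae_of_all _ hρ0),
      hρ1, ENNReal.ofReal_one]
  by_cases ht : t ∈ Metric.cthickening r V
  · rw [indicator_of_mem ht]
    calc (∫⁻ x in V, ENNReal.ofReal (ρ (x - t))) * H t ≤ 1 * H t := by
          gcongr
          exact (setLIntegral_le_lintegral _ _).trans_eq h1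
      _ = H t := one_mul _
  · rw [indicator_of_notMem ht]
    have : ∫⁻ x in V, ENNReal.ofReal (ρ (x - t)) ≤ 0 := by
      calc ∫⁻ x in V, ENNReal.ofReal (ρ (x - t)) ≤ ∫⁻ x in V, 0 := by
            refine setLIntegral_mono measurable_const fun x hx => ?_
            have : ρ (x - t) = 0 := by
              by_contra hne
              have hs' : x - t ∈ Function.support ρ := hne
              have hs := hρr hs'
              rw [mem_ball_zero_iff, ← dist_eq_norm, dist_comm] at hs
              exact ht (Metric.mem_cthickening_of_dist_le _ _ _ _ hx hs.le)
            simp [this]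
        _ = 0 := by simp
    simp [le_antisymm this bot_le]

/-- The Poincaré inequality for weakly differentiable functions on bounded convex sets. -/
theorem lintegral_lintegral_sub_le [DecidableEq ι] {V : Set (EuclideanSpace ℝ ι)}
    (hV : Convex ℝ V) (hVm : MeasurableSet V) (hVb : Bornology.IsBounded V)
    {D : ℝ≥0∞} (hDt : D ≠ ⊤) (hD : ∀ X ∈ V, ∀ Y ∈ V, ‖Y - X‖ₑ ≤ D)
    {f : EuclideanSpace ℝ ι → ℂ} {G : EuclideanSpace ℝ ι → EuclideanSpace ℂ ι}
    (hf : LocallyIntegrable f volume) (hG : IsWeakGradient f G) :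
    ∫⁻ X in V, ∫⁻ Y in V, ‖f X - f Y‖ₑ ≤
      D * (2 ^ Fintype.card ι * volume V * ∫⁻ X in V, ‖G X‖ₑ) := by
  let φ : ℕ → ContDiffBump (0 : EuclideanSpace ℝ ι) := fun m =>
    ⟨1 / (2 * (m + 1)), 1 / (m + 1), by positivity, by
      apply one_div_lt_one_div_of_lt <;> linarith [(Nat.cast_nonneg m : (0 : ℝ) ≤ m)]⟩
  have hφ0 : Tendsto (fun m => (φ m).rOut) atTop (𝓝 0) := tendsto_one_div_add_atTop_nhds_zero_nat
  let F : ℕ → EuclideanSpace ℝ ι → ℂ := fun m =>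
    MeasureTheory.convolution ((φ m).normed volume) f (ContinuousLinearMap.lsmul ℝ ℝ) volume
  have hF : ∀ m, ContDiff ℝ 1 (F m) := fun m =>
    (φ m).hasCompactSupport_normed.contDiff_convolution_left _ (φ m).contDiff_normed hf
  have hFae : ∀ᵐ x, Tendsto (fun m => F m x) atTop (𝓝 (f x)) :=
    ContDiffBump.ae_convolution_tendsto_right_of_locallyIntegrable (K := 2) hφ0
      (Eventually.of_forall fun m => by simp only [φ]; field_simp; rfl) hf
  have hVt : volume V ≠ ⊤ := hVb.measure_lt_top.ne
  -- convergence of the right-hand sides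
  have hlim : Tendsto (fun m => ∫⁻ t in Metric.cthickening (φ m).rOut V, ‖G t‖ₑ) atTop
      (𝓝 (∫⁻ t in V, ‖G t‖ₑ)) := by
    have h1 := tendsto_measure_cthickening (μ := volume.withDensity fun t => ‖G t‖ₑ) (s := V)
      ⟨1, one_pos, by
        rw [withDensity_apply _ Metric.isClosed_cthickening.measurableSet]
        exact (hG.1.integrableOn_isCompact (hVb.cthickening.isCompact_closure.of_isClosed_subset
          Metric.isClosed_cthickening subset_closure)).2.ne⟩
    have h2 := h1.comp hφ0
    rw [withDensity_apply _ isClosed_closure.measurableSet] at h2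
    have h3 : (closure V : Set _) =ᵐ[volume] V := by
      rw [closure_eq_self_union_frontier]
      exact union_ae_eq_left_of_ae_eq_empty (ae_eq_empty.2 (hV.addHaar_frontier volume))
    rw [setLIntegral_congr h3] at h2
    refine h2.congr fun m => ?_
    rw [Function.comp_apply, withDensity_apply _ Metric.isClosed_cthickening.measurableSet]
  have hstep : ∀ m, ∫⁻ X in V, ∫⁻ Y in V, ‖F m X - F m Y‖ₑ ≤
      D * (2 ^ Fintype.card ι * volume V * ∫⁻ t in Metric.cthickening (φ m).rOut V, ‖G t‖ₑ) := by
    intro m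
    refine (lintegral_lintegral_sub_le_of_contDiff hV hVm hD (hF m)).trans ?_
    refine mul_le_mul' le_rfl (mul_le_mul' le_rfl ?_)
    refine le_trans (lintegral_mono fun x => enorm_fderiv_convolution_le hf hG (φ m) x) ?_
    exact lintegral_convolution_le (φ m).continuous_normed (φ m).nonneg_normed
      (φ m).integrable_normed (φ m).integral_normed (φ m).support_normed_eq.subset
      hG.1.aestronglyMeasurable.enorm
  have hae : ∀ᵐ q ∂((volume.restrict V).prod (volume.restrict V)),
      Tendsto (fun m => ‖F m q.1 - F m q.2‖ₑ) atTop (𝓝 ‖f q.1 - f q.2‖ₑ) := by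
    have hF' := ae_restrict_of_ae (s := V) hFae
    filter_upwards [Measure.quasiMeasurePreserving_fst.ae hF',
      Measure.quasiMeasurePreserving_snd.ae hF'] with q h1 h2
    exact (h1.sub h2).enorm
  have hfm : AEStronglyMeasurable f (volume.restrict V) := hf.aestronglyMeasurable.restrict
  have hFm : ∀ m, Measurable fun q : EuclideanSpace ℝ ι × EuclideanSpace ℝ ι =>
      ‖F m q.1 - F m q.2‖ₑ := fun m =>
    (((hF m).continuous.comp continuous_fst).sub
      ((hF m).continuous.comp continuous_snd)).measurable.enorm
  calc ∫⁻ X in V, ∫⁻ Y in V, ‖f X - f Y‖ₑ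
      = ∫⁻ q, ‖f q.1 - f q.2‖ₑ ∂((volume.restrict V).prod (volume.restrict V)) := by
        rw [lintegral_prod]
        exact (hfm.comp_fst.sub hfm.comp_snd).enorm
    _ = ∫⁻ q, liminf (fun m => ‖F m q.1 - F m q.2‖ₑ) atTop
          ∂((volume.restrict V).prod (volume.restrict V)) := by
        refine lintegral_congr_ae ?_
        filter_upwards [hae] with q hq
        exact hq.liminf_eq.symm
    _ ≤ liminf (fun m => ∫⁻ q, ‖F m q.1 - F m q.2‖ₑ
          ∂((volume.restrict V).prod (volume.restrict V))) atTop := lintegral_liminf_le hFm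
    _ ≤ liminf (fun m => D * (2 ^ Fintype.card ι * volume V *
          ∫⁻ t in Metric.cthickening (φ m).rOut V, ‖G t‖ₑ)) atTop := by
        refine liminf_le_liminf (Eventually.of_forall fun m => ?_)
        rw [lintegral_prod _ (hFm m).aemeasurable]
        exact hstep m
    _ = D * (2 ^ Fintype.card ι * volume V * ∫⁻ X in V, ‖G X‖ₑ) := by
        refine Tendsto.liminf_eq ?_
        refine ENNReal.Tendsto.const_mul (ENNReal.Tendsto.const_mul hlim (Or.inr ?_)) (Or.inr hDt)
        exact ENNReal.mul_ne_top (by simp) hVt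

/-- The deviation of an average from a constant. -/
lemma enorm_average_sub_le {Ω E : Type*} [MeasurableSpace Ω] [NormedAddCommGroup E]
    [NormedSpace ℝ E] [CompleteSpace E] {μ : Measure Ω}
    {W : Set Ω} (h0 : μ W ≠ 0) (ht : μ W ≠ ⊤) {f : Ω → E} (hf : IntegrableOn f W μ) (c : E) :
    ‖(⨍ x in W, f x ∂μ) - c‖ₑ ≤ (μ W)⁻¹ * ∫⁻ x in W, ‖f x - c‖ₑ ∂μ := by
  have hfin : IsFiniteMeasure (μ.restrict W) := ⟨by simpa using ht.lt_top⟩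
  have hne : NeZero (μ.restrict W) := ⟨by simpa [Measure.restrict_eq_zero] using h0⟩
  have hi : Integrable f ((μ.restrict W univ)⁻¹ • μ.restrict W) :=
    hf.smul_measure (by simpa using h0)
  have e : (⨍ x in W, f x ∂μ) - c = ∫ x, (f x - c) ∂((μ.restrict W univ)⁻¹ • μ.restrict W) := by
    have hW : (μ W).toReal ≠ 0 := ENNReal.toReal_ne_zero.2 ⟨h0, ht⟩
    rw [integral_sub hi (integrable_const c), average]
    simp [measureReal_def, inv_mul_cancel₀ hW]
  rw [e]
  refine (enorm_integral_le_lintegral_enorm _).trans_eq ?_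
  rw [lintegral_smul_measure]
  simp

/-- The Poincaré inequality for the deviation from the average over a convex set. -/
lemma lintegral_sub_average_le [DecidableEq ι] {V : Set (EuclideanSpace ℝ ι)}
    (hV : Convex ℝ V) (hVm : MeasurableSet V) (hVb : Bornology.IsBounded V) (hV0 : volume V ≠ 0)
    {D : ℝ≥0∞} (hDt : D ≠ ⊤) (hD : ∀ X ∈ V, ∀ Y ∈ V, ‖Y - X‖ₑ ≤ D)
    {f : EuclideanSpace ℝ ι → ℂ} {G : EuclideanSpace ℝ ι → EuclideanSpace ℂ ι}
    (hf : LocallyIntegrable f volume) (hG : IsWeakGradient f G) :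
    ∫⁻ X in V, ‖f X - ⨍ Y in V, f Y‖ₑ ≤ D * 2 ^ Fintype.card ι * ∫⁻ X in V, ‖G X‖ₑ := by
  have hVt : volume V ≠ ⊤ := hVb.measure_lt_top.ne
  have hfV : IntegrableOn f V :=
    (hf.integrableOn_isCompact hVb.isCompact_closure).mono_set subset_closure
  calc ∫⁻ X in V, ‖f X - ⨍ Y in V, f Y‖ₑ
      ≤ ∫⁻ X in V, (volume V)⁻¹ * ∫⁻ Y in V, ‖f X - f Y‖ₑ := by
        refine lintegral_mono fun X => ?_
        rw [← enorm_neg, neg_sub]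
        refine (enorm_average_sub_le hV0 hVt hfV (f X)).trans_eq ?_
        congr 2 with Y
        rw [← enorm_neg, neg_sub]
    _ = (volume V)⁻¹ * ∫⁻ X in V, ∫⁻ Y in V, ‖f X - f Y‖ₑ := by
        rw [lintegral_const_mul']
        simpa using hV0
    _ ≤ (volume V)⁻¹ * (D * (2 ^ Fintype.card ι * volume V * ∫⁻ X in V, ‖G X‖ₑ)) := by
        gcongr
        exact lintegral_lintegral_sub_le hV hVm hVb hDt hD hf hG
    _ = ((volume V)⁻¹ * volume V) * (D * 2 ^ Fintype.card ι * ∫⁻ X in V, ‖G X‖ₑ) := by ring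
    _ = D * 2 ^ Fintype.card ι * ∫⁻ X in V, ‖G X‖ₑ := by
        rw [ENNReal.inv_mul_cancel hV0 hVt, one_mul]

end Poincare

/-! ### Powers of two -/

section TwoPow

lemma two_rpow_mul (a b : ℝ) : (2 : ℝ≥0∞) ^ a * 2 ^ b = 2 ^ (a + b) :=
  (ENNReal.rpow_add _ _ two_ne_zero ENNReal.ofNat_ne_top).symm

lemma two_rpow_ne_zero (a : ℝ) : (2 : ℝ≥0∞) ^ a ≠ 0 := by simp [ENNReal.rpow_eq_zero_iff]

lemma two_rpow_ne_top (a : ℝ) : (2 : ℝ≥0∞) ^ a ≠ ⊤ := by simp [ENNReal.rpow_eq_top_iff]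

lemma two_rpow_inv (a : ℝ) : ((2 : ℝ≥0∞) ^ a)⁻¹ = 2 ^ (-a) := (ENNReal.rpow_neg _ _).symm

lemma two_rpow_le {a b : ℝ} (h : a ≤ b) : (2 : ℝ≥0∞) ^ a ≤ 2 ^ b :=
  ENNReal.rpow_le_rpow_of_exponent_le (by norm_num) h

lemma ofReal_two_rpow (a : ℝ) : ENNReal.ofReal (2 ^ a) = (2 : ℝ≥0∞) ^ a := by
  rw [← ENNReal.ofReal_rpow_of_pos two_pos]; simp

lemma ofReal_two_zpow (k : ℤ) : ENNReal.ofReal ((2 : ℝ) ^ k) = (2 : ℝ≥0∞) ^ (k : ℝ) := by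
  rw [← Real.rpow_intCast, ofReal_two_rpow]

/-- The sum of the geometric series `∑ 2^{-iε}`. -/
def geomSum (ε : ℝ) : ℝ≥0∞ := ∑' i : ℕ, (2 : ℝ≥0∞) ^ (-(i : ℝ) * ε)

lemma geomSum_ne_top {ε : ℝ} (hε : 0 < ε) : geomSum ε ≠ ⊤ := by
  have h : ∀ i : ℕ, (2 : ℝ≥0∞) ^ (-(i : ℝ) * ε) = ((2 : ℝ≥0∞) ^ (-ε)) ^ i := by
    intro i
    rw [← ENNReal.rpow_natCast, ← ENNReal.rpow_mul]
    congr 1; ring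
  simp_rw [geomSum, h]
  rw [ENNReal.tsum_geometric]
  have : (2 : ℝ≥0∞) ^ (-ε) < 1 := ENNReal.rpow_lt_one_of_one_lt_of_neg (by norm_num) (by linarith)
  simpa [tsub_eq_zero_iff_le] using this

lemma tsum_two_rpow_add (a : ℝ) (ε : ℝ) :
    ∑' i : ℕ, (2 : ℝ≥0∞) ^ (-(a + i) * ε) = 2 ^ (-a * ε) * geomSum ε := by
  rw [geomSum, ← ENNReal.tsum_mul_left]
  congr 1 with i
  rw [two_rpow_mul]
  congr 1; ring

/-- The powers `(2^k u)^ε` below `1` sum up to at most a geometric series. -/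
lemma tsum_two_rpow_mul_le {ε : ℝ} (hε : 0 < ε) (u : ℝ≥0∞) :
    ∑' k : ℕ, (if 2 ^ (k : ℝ) * u ≤ 1 then 2 ^ ((k : ℝ) * ε) * u ^ ε else 0) ≤ geomSum ε := by
  rw [ENNReal.tsum_eq_iSup_nat]
  refine iSup_le fun N => ?_
  induction N with
  | zero => simp
  | succ N ih =>
    by_cases hN : 2 ^ (N : ℝ) * u ≤ 1
    · calc ∑ k ∈ Finset.range (N + 1),
            (if 2 ^ (k : ℝ) * u ≤ 1 then 2 ^ ((k : ℝ) * ε) * u ^ ε else 0)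
          ≤ ∑ k ∈ Finset.range (N + 1), (2 : ℝ≥0∞) ^ (-((N + 1 - 1 - k : ℕ) : ℝ) * ε) := by
            refine Finset.sum_le_sum fun k hk => ?_
            have hk' : k ≤ N := Nat.lt_succ_iff.1 (Finset.mem_range.1 hk)
            split_ifs
            · have h1 : 2 ^ ((N : ℝ) * ε) * u ^ ε ≤ 1 := by
                rw [ENNReal.rpow_mul, ← ENNReal.mul_rpow_of_nonneg _ _ hε.le]
                exact ENNReal.rpow_le_one hN hε.le
              calc 2 ^ ((k : ℝ) * ε) * u ^ ε
                  = 2 ^ (-((N + 1 - 1 - k : ℕ) : ℝ) * ε) * (2 ^ ((N : ℝ) * ε) * u ^ ε) := by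
                    rw [← mul_assoc, two_rpow_mul]
                    congr 2
                    rw [Nat.add_sub_cancel, Nat.cast_sub hk']; ring
                _ ≤ 2 ^ (-((N + 1 - 1 - k : ℕ) : ℝ) * ε) * 1 := by gcongr
                _ = _ := mul_one _
            · exact zero_le
        _ = ∑ k ∈ Finset.range (N + 1), (2 : ℝ≥0∞) ^ (-(k : ℝ) * ε) :=
            Finset.sum_range_reflect (fun k : ℕ => (2 : ℝ≥0∞) ^ (-(k : ℝ) * ε)) (N + 1)
        _ ≤ geomSum ε := ENNReal.sum_le_tsum _
    · rw [Finset.sum_range_succ, if_neg hN, add_zero]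
      exact ih

end TwoPow

namespace DyadicCube

variable {ι : Type}

lemma ofReal_edge (Q : DyadicCube ι) : ENNReal.ofReal Q.edge = 2 ^ (-(Q.level : ℝ)) := by
  rw [edge, ofReal_two_zpow]; push_cast; rfl

/-- The union of `Q` and of the cubes of its level that are at most `a` steps away. -/
def enlarge (Q : DyadicCube ι) (a : ℕ) : Set (EuclideanSpace ℝ ι) :=
  {x | ∀ i, Q.edge * ((Q.corner i : ℝ) - a) < x i ∧ x i ≤ Q.edge * ((Q.corner i : ℝ) + 1 + a)}

lemma enlarge_zero (Q : DyadicCube ι) : Q.enlarge 0 = Q.toSet := by simp [enlarge, toSet]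

lemma enlarge_mono (Q : DyadicCube ι) {a b : ℕ} (h : a ≤ b) : Q.enlarge a ⊆ Q.enlarge b := by
  intro x hx i
  have h' : (a : ℝ) ≤ b := by exact_mod_cast h
  have := Q.edge_pos
  obtain ⟨h1, h2⟩ := hx i
  constructor <;> nlinarith

lemma mem_enlarge_iff {Q : DyadicCube ι} {a : ℕ} {x : EuclideanSpace ℝ ι} : x ∈ Q.enlarge a ↔
    ∀ i, (containing Q.level x).corner i - Q.corner i ∈ Finset.Icc (-a : ℤ) a := by
  refine forall_congr' fun i => ?_
  have hp := Q.edge_pos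
  have hc : (containing Q.level x).edge = Q.edge := edge_eq_of_level_eq rfl
  obtain ⟨h7, h8⟩ := mem_toSet_containing Q.level x i
  rw [hc] at h7 h8
  set c := (containing Q.level x).corner i
  rw [Finset.mem_Icc]
  constructor
  · rintro ⟨h1, h2⟩
    have i1 : (c : ℝ) < Q.corner i + 1 + a := lt_of_mul_lt_mul_left (h7.trans_le h2) hp.le
    have i2 : (Q.corner i - a : ℝ) < c + 1 := lt_of_mul_lt_mul_left (h1.trans_le h8) hp.le
    norm_cast at i1
    have i2' : Q.corner i - a < c + 1 := by exact_mod_cast i2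
    omega
  · rintro ⟨h1, h2⟩
    have i1 : (c : ℝ) ≤ Q.corner i + a := by
      have : c ≤ Q.corner i + a := by omega
      exact_mod_cast this
    have i2 : (Q.corner i - a : ℝ) ≤ c := by
      have : Q.corner i - a ≤ c := by omega
      exact_mod_cast this
    exact ⟨by nlinarith, by nlinarith⟩

lemma convex_enlarge (Q : DyadicCube ι) (a : ℕ) : Convex ℝ (Q.enlarge a) := by
  have : Q.enlarge a = WithLp.linearEquiv 2 ℝ (ι → ℝ) ⁻¹' (univ.pi fun i =>
      Ioc (Q.edge * ((Q.corner i : ℝ) - a)) (Q.edge * ((Q.corner i : ℝ) + 1 + a))) := by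
    ext x; simp [enlarge]
  rw [this]
  exact (convex_pi fun i _ => convex_Ioc _ _).linear_preimage
    (WithLp.linearEquiv 2 ℝ (ι → ℝ)).toLinearMap

/-- The shift of `Q` by `v` steps. -/
def shift (Q : DyadicCube ι) (v : ι → ℤ) : DyadicCube ι := ⟨Q.level, fun i => Q.corner i + v i⟩

lemma Neighbor.subset_enlarge {Q Q' : DyadicCube ι} (h : Neighbor Q Q') :
    Q'.toSet ⊆ Q.enlarge 2 := fun _ hx => mem_enlarge_iff.2 fun i => by
  simpa using h.corner_containing hx i

lemma toSet_subset_enlarge (Q : DyadicCube ι) (a : ℕ) : Q.toSet ⊆ Q.enlarge a := by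
  rw [← enlarge_zero]; exact Q.enlarge_mono (Nat.zero_le _)

variable [Fintype ι]

lemma measurableSet_enlarge (Q : DyadicCube ι) (a : ℕ) : MeasurableSet (Q.enlarge a) := by
  have : Q.enlarge a = ⋂ i, {x | Q.edge * ((Q.corner i : ℝ) - a) < x i} ∩
      {x | x i ≤ Q.edge * ((Q.corner i : ℝ) + 1 + a)} := by
    ext x; simp [enlarge]
  rw [this]
  exact MeasurableSet.iInter fun i => (measurableSet_lt measurable_const (by fun_prop)).inter
    (measurableSet_le (by fun_prop) measurable_const)

lemma norm_sub_le_of_mem_enlarge {Q : DyadicCube ι} {a : ℕ} {x y : EuclideanSpace ℝ ι}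
    (hx : x ∈ Q.enlarge a) (hy : y ∈ Q.enlarge a) :
    ‖y - x‖ ≤ Fintype.card ι * ((1 + 2 * a) * Q.edge) := by
  have h1 : ‖y - x‖ ≤ ∑ i, ‖(y - x) i‖ := by
    rw [EuclideanSpace.norm_eq]
    refine Real.sqrt_le_iff.2 ⟨by positivity, ?_⟩
    exact Finset.sum_sq_le_sq_sum_of_nonneg fun i _ => norm_nonneg _
  refine h1.trans ?_
  rw [← nsmul_eq_mul, ← Finset.card_univ]
  refine Finset.sum_le_card_nsmul _ _ _ fun i _ => ?_
  obtain ⟨h1, h2⟩ := hx i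
  obtain ⟨h3, h4⟩ := hy i
  rw [PiLp.sub_apply, Real.norm_eq_abs, abs_le]
  constructor <;> nlinarith

/-- The vectors of at most `a` steps in each coordinate. -/
def steps (ι : Type) [Fintype ι] (a : ℕ) : Finset (ι → ℤ) := by
  classical exact Fintype.piFinset fun _ : ι => Finset.Icc (-a : ℤ) a

lemma mem_steps {a : ℕ} {v : ι → ℤ} : v ∈ steps ι a ↔ ∀ i, v i ∈ Finset.Icc (-a : ℤ) a := by
  classical simp [steps]

lemma lintegral_enlarge_le {Ω : Type*} [MeasurableSpace Ω] (ν : Measure Ω)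
    {π : Ω → EuclideanSpace ℝ ι} (Q : DyadicCube ι) (a : ℕ) (B : Set Ω)
    (g : Ω → ℝ≥0∞) :
    ∫⁻ x in π ⁻¹' (Q.enlarge a) ∩ B, g x ∂ν ≤
      ∑ v ∈ steps ι a, ∫⁻ x in π ⁻¹' (Q.shift v).toSet ∩ B, g x ∂ν := by
  have hsub : π ⁻¹' (Q.enlarge a) ∩ B ⊆
      ⋃ v : {v // v ∈ steps ι a}, (π ⁻¹' (Q.shift v.1).toSet ∩ B) := by
    rintro x ⟨hx, hxB⟩
    rw [mem_preimage, mem_enlarge_iff] at hx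
    refine mem_iUnion.2 ⟨⟨fun i => (containing Q.level (π x)).corner i - Q.corner i,
      mem_steps.2 hx⟩, ?_, hxB⟩
    rw [mem_preimage, mem_toSet_iff]
    ext <;> simp [shift]
  refine (lintegral_mono_set hsub).trans ((lintegral_iUnion_le _ _).trans_eq ?_)
  exact Finset.tsum_subtype (steps ι a) fun v => ∫⁻ x in π ⁻¹' (Q.shift v).toSet ∩ B, g x ∂ν

end DyadicCube

/-! ### Averages over boxes that touch the subspace -/

section BoxAverage

open DyadicCube

variable {d n : ℕ}

lemma slab_eq (S : Set (Base d)) (r : ℝ) :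
    (slab S r : Set (Ambient d n)) = hor ⁻¹' S ∩ {X | ‖ver X‖ < r} := rfl

lemma convex_slab {S : Set (Base d)} (hS : Convex ℝ S) (r : ℝ) :
    Convex ℝ (slab S r : Set (Ambient d n)) := by
  intro X hX Y hY a b ha hb hab
  refine ⟨hS hX.1 hY.1 ha hb hab, ?_⟩
  have h := convex_ball (0 : EuclideanSpace ℝ (Fin n)) r (mem_ball_zero_iff.2 hX.2)
    (mem_ball_zero_iff.2 hY.2) ha hb hab
  exact mem_ball_zero_iff.1 h

/-- The box `Q × {‖y‖ < ℓ(Q) / 2}`. -/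
def box (Q : DyadicCube (Fin d)) : Set (Ambient d n) := slab Q.toSet (Q.edge / 2)

/-- The volume of the ball of radius `1 / 2` in `ℝ^n`. -/
def halfBallVol (n : ℕ) : ℝ≥0∞ := volume (Metric.ball (0 : EuclideanSpace ℝ (Fin n)) (1 / 2))

lemma halfBallVol_ne_zero : halfBallVol n ≠ 0 := (Metric.measure_ball_pos _ _ (by norm_num)).ne'

lemma halfBallVol_ne_top : halfBallVol n ≠ ⊤ := measure_ball_lt_top.ne

lemma volume_ball_edge (Q : DyadicCube (Fin d)) :
    volume (Metric.ball (0 : EuclideanSpace ℝ (Fin n)) (Q.edge / 2)) =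
      2 ^ (-(Q.level : ℝ) * n) * halfBallVol n := by
  rw [div_eq_mul_one_div, Measure.addHaar_ball_mul_of_pos _ _ Q.edge_pos, halfBallVol,
    ENNReal.ofReal_pow Q.edge_pos.le, ofReal_edge, ENNReal.rpow_mul]
  simp

lemma measurableSet_box (Q : DyadicCube (Fin d)) : MeasurableSet (box Q : Set (Ambient d n)) :=
  measurableSet_slab (measurableSet_toSet Q) _

lemma volume_box (Q : DyadicCube (Fin d)) : volume (box Q : Set (Ambient d n)) =
    2 ^ (-(Q.level : ℝ) * (d + n)) * halfBallVol n := by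
  rw [box, volume_slab (measurableSet_toSet Q), volume_toSet, volume_ball_edge, ← mul_assoc,
    two_rpow_mul, Fintype.card_fin]
  congr 2; ring

lemma volume_box_ne_zero (Q : DyadicCube (Fin d)) : volume (box Q : Set (Ambient d n)) ≠ 0 := by
  rw [volume_box]; exact mul_ne_zero (two_rpow_ne_zero _) halfBallVol_ne_zero

lemma volume_box_ne_top (Q : DyadicCube (Fin d)) : volume (box Q : Set (Ambient d n)) ≠ ⊤ := by
  rw [volume_box]; exact ENNReal.mul_ne_top (two_rpow_ne_top _) halfBallVol_ne_top

lemma norm_sub_le_of_mem_slab {Q : DyadicCube (Fin d)} {r : ℝ} (hr : r ≤ Q.edge)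
    {X Y : Ambient d n} (hX : X ∈ (slab (Q.enlarge 2) r : Set (Ambient d n)))
    (hY : Y ∈ (slab (Q.enlarge 2) r : Set (Ambient d n))) :
    ‖Y - X‖ ≤ (5 * d + 2) * Q.edge := by
  have h1 := norm_le_hor_add_ver (Y - X)
  have h2 := norm_sub_le_of_mem_enlarge hX.1 hY.1
  have h3 : ‖ver Y - ver X‖ ≤ ‖ver Y‖ + ‖ver X‖ := norm_sub_le _ _
  rw [hor_sub, ver_sub] at h1
  have h4 := hX.2
  have h5 := hY.2
  rw [Fintype.card_fin] at h2
  push_cast at h2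
  linarith

lemma isBounded_slab {Q : DyadicCube (Fin d)} {r : ℝ} (hr : r ≤ Q.edge) :
    Bornology.IsBounded (slab (Q.enlarge 2) r : Set (Ambient d n)) := by
  rw [Metric.isBounded_iff]
  refine ⟨(5 * d + 2) * Q.edge, fun X hX Y hY => ?_⟩
  rw [dist_comm, dist_eq_norm]
  exact norm_sub_le_of_mem_slab hr hX hY

lemma integrableOn_box {f : Ambient d n → ℂ} (hf : LocallyIntegrable f volume)
    (Q : DyadicCube (Fin d)) : IntegrableOn f (box Q) := by
  have hb : Bornology.IsBounded (box Q : Set (Ambient d n)) :=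
    (isBounded_slab (Q := Q) (r := Q.edge) le_rfl).subset
      (slab_mono (Q.toSet_subset_enlarge 2) (by linarith [Q.edge_pos]))
  exact (hf.integrableOn_isCompact hb.isCompact_closure).mono_set subset_closure

/-- The integral of `‖G‖ min(1, |y|)^{1-n-s/2}` over `S × {‖y‖ < r}`. -/
def singIntegral (s : ℝ) (G : Ambient d n → EuclideanSpace ℂ (Fin d ⊕ Fin n)) (S : Set (Base d))
    (r : ℝ) : ℝ≥0∞ :=
  ∫⁻ X in slab S r, ‖G X‖ₑ * wt X ^ (1 - (n : ℝ) - s / 2)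

lemma singIntegral_mono {s : ℝ} {G : Ambient d n → EuclideanSpace ℂ (Fin d ⊕ Fin n)}
    {S S' : Set (Base d)} {r r' : ℝ} (hS : S ⊆ S') (hr : r ≤ r') :
    singIntegral s G S r ≤ singIntegral s G S' r' :=
  lintegral_mono_set (slab_mono hS hr)

lemma lintegral_slab_le_singIntegral (hn : 1 ≤ n) {s : ℝ} (hs : 0 < s)
    {G : Ambient d n → EuclideanSpace ℂ (Fin d ⊕ Fin n)}
    {S : Set (Base d)} (hS : MeasurableSet S) {r : ℝ} {R : ℝ≥0∞} (hr : ENNReal.ofReal r ≤ R)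
    (hR : R ≠ ⊤) :
    ∫⁻ X in slab S r, ‖G X‖ₑ ≤ R ^ ((n : ℝ) - 1 + s / 2) * singIntegral s G S r := by
  have hn' : (1 : ℝ) ≤ n := by exact_mod_cast hn
  rw [singIntegral, ← lintegral_const_mul' _ _ (ENNReal.rpow_ne_top_of_nonneg (by linarith) hR)]
  refine setLIntegral_mono_ae' (measurableSet_slab hS r) ?_
  filter_upwards [ae_ver_ne_zero (d := d) hn] with X hX hXS
  have h1 : wt X ≤ R := by
    refine (min_le_right _ _).trans (le_trans ?_ hr)
    rw [← ofReal_norm]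
    exact ENNReal.ofReal_le_ofReal hXS.2.le
  calc ‖G X‖ₑ = wt X ^ ((n : ℝ) - 1 + s / 2) * (‖G X‖ₑ * wt X ^ (1 - (n : ℝ) - s / 2)) := by
        rw [mul_left_comm, ← ENNReal.rpow_add _ _ (wt_ne_zero hX) (wt_ne_top X)]
        ring_nf
        simp
    _ ≤ R ^ ((n : ℝ) - 1 + s / 2) * (‖G X‖ₑ * wt X ^ (1 - (n : ℝ) - s / 2)) := by
        gcongr

/-- The constant of the Poincaré inequality on boxes. -/
def poincareConst (d n : ℕ) : ℝ≥0∞ := ENNReal.ofReal (5 * d + 2) * 2 ^ (d + n)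

lemma poincareConst_ne_top : poincareConst d n ≠ ⊤ :=
  ENNReal.mul_ne_top ENNReal.ofReal_ne_top (by simp)

/-- The Poincaré inequality on boxes, with the gradient measured by `singIntegral`. -/
lemma lintegral_slab_sub_average_le (hn : 1 ≤ n) {s : ℝ} (hs : 0 < s) {f : Ambient d n → ℂ}
    {G : Ambient d n → EuclideanSpace ℂ (Fin d ⊕ Fin n)}
    (hf : LocallyIntegrable f volume) (hG : IsWeakGradient f G) (Q : DyadicCube (Fin d)) {a : ℕ}
    (ha : a ≤ 2) {r : ℝ} (hr0 : 0 < r) (hr : r ≤ Q.edge) :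
    ∫⁻ X in slab (Q.enlarge a) r, ‖f X - ⨍ Y in slab (Q.enlarge a) r, f Y‖ₑ ≤
      poincareConst d n * 2 ^ (-(Q.level : ℝ) * (n + s / 2)) *
        singIntegral s G (Q.enlarge a) r := by
  have hsub : (slab (Q.enlarge a) r : Set (Ambient d n)) ⊆ slab (Q.enlarge 2) r :=
    slab_mono (Q.enlarge_mono ha) le_rfl
  have hv0 : volume (slab (Q.enlarge a) r : Set (Ambient d n)) ≠ 0 := by
    rw [volume_slab (Q.measurableSet_enlarge a)]
    refine mul_ne_zero ?_ (Metric.measure_ball_pos _ _ hr0).ne'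
    exact fun h => Q.volume_toSet_ne_zero (measure_mono_null (Q.toSet_subset_enlarge a) h)
  refine (lintegral_sub_average_le (convex_slab (Q.convex_enlarge a) r)
    (measurableSet_slab (Q.measurableSet_enlarge a) r) ((isBounded_slab hr).subset hsub) hv0
    (D := ENNReal.ofReal ((5 * d + 2) * Q.edge)) ENNReal.ofReal_ne_top ?_ hf hG).trans ?_
  · intro X hX Y hY
    rw [← ofReal_norm]
    exact ENNReal.ofReal_le_ofReal (norm_sub_le_of_mem_slab hr (hsub hX) (hsub hY))
  · have h1 := lintegral_slab_le_singIntegral (G := G) hn hs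
      (Q.measurableSet_enlarge a) (ENNReal.ofReal_le_ofReal hr) ENNReal.ofReal_ne_top
    rw [ofReal_edge, ← ENNReal.rpow_mul] at h1
    refine (mul_le_mul_right h1 _).trans_eq ?_
    rw [ENNReal.ofReal_mul (by positivity), ofReal_edge, poincareConst, Fintype.card_sum,
      Fintype.card_fin, Fintype.card_fin]
    have : (2 : ℝ≥0∞) ^ (-(Q.level : ℝ) * (n + s / 2)) =
        2 ^ (-(Q.level : ℝ)) * 2 ^ (-(Q.level : ℝ) * (n - 1 + s / 2)) := by
      rw [two_rpow_mul]; congr 1; ring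
    rw [this]
    ring

lemma lintegral_box_sub_average_le (hn : 1 ≤ n) {s : ℝ} (hs : 0 < s) {f : Ambient d n → ℂ}
    {G : Ambient d n → EuclideanSpace ℂ (Fin d ⊕ Fin n)}
    (hf : LocallyIntegrable f volume) (hG : IsWeakGradient f G) (Q : DyadicCube (Fin d)) :
    ∫⁻ X in box Q, ‖f X - ⨍ Y in box Q, f Y‖ₑ ≤
      poincareConst d n * 2 ^ (-(Q.level : ℝ) * (n + s / 2)) *
        singIntegral s G Q.toSet (Q.edge / 2) := by
  have h := lintegral_slab_sub_average_le hn hs hf hG Q (Nat.zero_le 2)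
    (half_pos Q.edge_pos) (half_le_self Q.edge_pos.le)
  rwa [enlarge_zero] at h

/-- The constant in the comparison of averages over boxes. -/
def boxConst (d n : ℕ) : ℝ≥0∞ := poincareConst d n * (2 ^ ((d : ℝ) + n) * (halfBallVol n)⁻¹)

lemma boxConst_ne_top : boxConst d n ≠ ⊤ :=
  ENNReal.mul_ne_top poincareConst_ne_top (ENNReal.mul_ne_top (two_rpow_ne_top _)
    (ENNReal.inv_ne_top.2 halfBallVol_ne_zero))

/-- Comparison of the averages over a small box and a larger one. -/
lemma enorm_average_box_sub_le (hn : 1 ≤ n) {s : ℝ} (hs : 0 < s) {f : Ambient d n → ℂ}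
    {G : Ambient d n → EuclideanSpace ℂ (Fin d ⊕ Fin n)}
    (hf : LocallyIntegrable f volume) (hG : IsWeakGradient f G) (Q Q' : DyadicCube (Fin d))
    (hl : Q'.level ≤ Q.level + 1) {a : ℕ} (ha : a ≤ 2) {r : ℝ} (hr0 : 0 < r) (hr : r ≤ Q.edge)
    (hsub : (box Q' : Set (Ambient d n)) ⊆ slab (Q.enlarge a) r) :
    ‖(⨍ X in box Q', f X) - ⨍ X in slab (Q.enlarge a) r, f X‖ₑ ≤
      boxConst d n * 2 ^ ((Q.level : ℝ) * (d - s / 2)) * singIntegral s G (Q.enlarge a) r := by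
  refine (enorm_average_sub_le (volume_box_ne_zero Q') (volume_box_ne_top Q')
    (integrableOn_box hf Q') _).trans ?_
  have h1 := (lintegral_mono_set hsub).trans
    (lintegral_slab_sub_average_le hn hs hf hG Q ha hr0 hr)
  have hl' : (Q'.level : ℝ) ≤ Q.level + 1 := by exact_mod_cast hl
  have h2 : (volume (box Q' : Set (Ambient d n)))⁻¹ ≤
      2 ^ ((Q.level : ℝ) * (d + n)) * (2 ^ ((d : ℝ) + n) * (halfBallVol n)⁻¹) := by
    rw [volume_box, ENNReal.mul_inv (Or.inl (two_rpow_ne_zero _)) (Or.inl (two_rpow_ne_top _)),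
      two_rpow_inv, ← mul_assoc, two_rpow_mul]
    refine mul_le_mul' (two_rpow_le ?_) le_rfl
    have : (0 : ℝ) ≤ d + n := by positivity
    nlinarith
  refine (mul_le_mul' h2 h1).trans_eq ?_
  have : (2 : ℝ≥0∞) ^ ((Q.level : ℝ) * (d - s / 2)) =
      2 ^ ((Q.level : ℝ) * (d + n)) * 2 ^ (-(Q.level : ℝ) * (n + s / 2)) := by
    rw [two_rpow_mul]; congr 1; ring
  rw [this, boxConst]
  ring

/-- The average of `f` over the box of level `k` at `x`. -/
def boxAverage (f : Ambient d n → ℂ) (k : ℤ) (x : Base d) : ℂ :=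
  ⨍ X in box (containing k x), f X

lemma measurable_comp_containing {β : Type*} [MeasurableSpace β] (F : DyadicCube (Fin d) → β)
    (k : ℤ) : Measurable fun x : Base d => F (containing k x) := by
  have h : Measurable fun m : Fin d → ℤ => F ⟨k, m⟩ := measurable_of_countable _
  exact h.comp (measurable_containing_corner k)

lemma measurable_boxAverage (f : Ambient d n → ℂ) (k : ℤ) : Measurable (boxAverage f k) :=
  measurable_comp_containing (fun Q => ⨍ X in box Q, f X) k

lemma boxAverage_eq {f : Ambient d n → ℂ} {Q : DyadicCube (Fin d)} {x : Base d}
    (hx : x ∈ Q.toSet) : boxAverage f Q.level x = ⨍ X in box Q, f X := by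
  rw [boxAverage, mem_toSet_iff.1 hx]

lemma box_containing_succ_subset (k : ℤ) (x : Base d) :
    (box (containing (k + 1) x) : Set (Ambient d n)) ⊆ box (containing k x) := by
  refine slab_mono (toSet_containing_subset (by omega) x) ?_
  have := edge_eq_of_level_add_one (Q := containing k x) (Q' := containing (k + 1) x) rfl
  have := (containing (k + 1) x).edge_pos
  linarith

lemma enorm_boxAverage_succ_sub_le (hn : 1 ≤ n) {s : ℝ} (hs : 0 < s) {f : Ambient d n → ℂ}
    {G : Ambient d n → EuclideanSpace ℂ (Fin d ⊕ Fin n)}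
    (hf : LocallyIntegrable f volume) (hG : IsWeakGradient f G) (k : ℤ) (x : Base d) :
    ‖boxAverage f (k + 1) x - boxAverage f k x‖ₑ ≤ boxConst d n * 2 ^ ((k : ℝ) * (d - s / 2)) *
      singIntegral s G (containing k x).toSet ((containing k x).edge / 2) := by
  have h := enorm_average_box_sub_le hn hs hf hG (containing k x) (containing (k + 1) x)
    le_rfl (Nat.zero_le 2) (half_pos (containing k x).edge_pos)
    (half_le_self (containing k x).edge_pos.le)
    (by rw [enlarge_zero]; exact box_containing_succ_subset k x)
  rwa [enlarge_zero] at h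

/-- The average over `x` of the integrals over the fibres above the cube that contains `x`. -/
lemma lintegral_fibre_containing {S : Set (Base d)} (k : ℤ)
    (hS : ∀ x ∈ S, (containing k x).toSet ⊆ S) (B : Set (Ambient d n))
    (H : Ambient d n → ℝ≥0∞) :
    ∫⁻ x in S, 2 ^ ((k : ℝ) * d) * ∫⁻ X in hor ⁻¹' (containing k x).toSet ∩ B, H X =
      ∫⁻ X in hor ⁻¹' S ∩ B, H X := by
  rw [lintegral_eq_tsum (volume.restrict S) k,
    lintegral_eq_tsum_preimage (volume.restrict (hor ⁻¹' S ∩ B)) measurable_hor k]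
  congr 1 with m
  set Q : DyadicCube (Fin d) := ⟨k, m⟩
  have hQ : MeasurableSet Q.toSet := measurableSet_toSet Q
  rw [Measure.restrict_restrict hQ, Measure.restrict_restrict (measurable_hor hQ), ← inter_assoc,
    ← preimage_inter]
  by_cases hne : (Q.toSet ∩ S).Nonempty
  · obtain ⟨x, hx, hxS⟩ := hne
    have hc : containing k x = Q := mem_toSet_iff.1 hx
    have hsub : Q.toSet ⊆ S := hc ▸ hS x hxS
    rw [inter_eq_left.2 hsub]
    have : ∀ z ∈ Q.toSet, (2 : ℝ≥0∞) ^ ((k : ℝ) * d) *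
        ∫⁻ X in hor ⁻¹' (containing k z).toSet ∩ B, H X =
        2 ^ ((k : ℝ) * d) * ∫⁻ X in hor ⁻¹' Q.toSet ∩ B, H X := by
      intro z hz
      rw [mem_toSet_iff.1 hz]
    rw [setLIntegral_congr_fun hQ this, setLIntegral_const, volume_toSet, mul_right_comm,
      two_rpow_mul, Fintype.card_fin]
    have : (k : ℝ) * d + -(Q.level : ℝ) * d = 0 := by simp [Q]
    rw [this, ENNReal.rpow_zero, one_mul]
  · rw [not_nonempty_iff_eq_empty.1 hne]
    simp

lemma toSet_saturated {Q : DyadicCube (Fin d)} {k : ℤ} (hk : Q.level ≤ k) {x : Base d}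
    (hx : x ∈ Q.toSet) : (containing k x).toSet ⊆ Q.toSet := by
  conv_rhs => rw [← mem_toSet_iff.1 hx]
  exact toSet_containing_subset hk x

lemma edge_containing {ι : Type} (k : ℤ) (x : EuclideanSpace ℝ ι) :
    (containing k x).edge = 2 ^ (-k) := rfl

/-- The integral of one term of the telescoping series of the box averages. -/
lemma lintegral_boxAverage_succ_sub_le (hn : 1 ≤ n) {s : ℝ} (hs : 0 < s) {f : Ambient d n → ℂ}
    {G : Ambient d n → EuclideanSpace ℂ (Fin d ⊕ Fin n)}
    (hf : LocallyIntegrable f volume) (hG : IsWeakGradient f G) {Q : DyadicCube (Fin d)} {k : ℤ}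
    (hk : Q.level ≤ k) :
    ∫⁻ x in Q.toSet, ‖boxAverage f (k + 1) x - boxAverage f k x‖ₑ ≤
      boxConst d n * 2 ^ (-(k : ℝ) * (s / 2)) * singIntegral s G Q.toSet (2 ^ (-k) / 2) := by
  calc ∫⁻ x in Q.toSet, ‖boxAverage f (k + 1) x - boxAverage f k x‖ₑ
      ≤ ∫⁻ x in Q.toSet, boxConst d n * 2 ^ (-(k : ℝ) * (s / 2)) * (2 ^ ((k : ℝ) * d) *
          singIntegral s G (containing k x).toSet (2 ^ (-k) / 2)) := by
        refine lintegral_mono fun x => (enorm_boxAverage_succ_sub_le hn hs hf hG k x).trans_eq ?_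
        rw [edge_containing]
        have : (2 : ℝ≥0∞) ^ ((k : ℝ) * (d - s / 2)) =
            2 ^ (-(k : ℝ) * (s / 2)) * 2 ^ ((k : ℝ) * d) := by
          rw [two_rpow_mul]; congr 1; ring
        rw [this]; ring
    _ = _ := by
        rw [lintegral_const_mul _ (measurable_comp_containing (fun Q : DyadicCube (Fin d) =>
          2 ^ ((k : ℝ) * d) * singIntegral s G Q.toSet (2 ^ (-k) / 2)) k)]
        congr 1
        exact lintegral_fibre_containing k
          (fun x hx => toSet_saturated hk hx) _ _

lemma lintegral_tsum_boxAverage_sub_le (hn : 1 ≤ n) {s : ℝ} (hs : 0 < s) {f : Ambient d n → ℂ}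
    {G : Ambient d n → EuclideanSpace ℂ (Fin d ⊕ Fin n)}
    (hf : LocallyIntegrable f volume) (hG : IsWeakGradient f G) {Q : DyadicCube (Fin d)} {k : ℤ}
    (hk : Q.level ≤ k) :
    ∫⁻ x in Q.toSet, ∑' i : ℕ, ‖boxAverage f (k + i + 1) x - boxAverage f (k + i) x‖ₑ ≤
      boxConst d n * geomSum (s / 2) * 2 ^ (-(k : ℝ) * (s / 2)) *
        singIntegral s G Q.toSet (2 ^ (-k) / 2) := by
  have hm : ∀ i : ℕ, Measurable fun x =>
      ‖boxAverage f (k + i + 1) x - boxAverage f (k + i) x‖ₑ := fun i =>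
    ((measurable_boxAverage f _).sub (measurable_boxAverage f _)).enorm
  rw [lintegral_tsum fun i => (hm i).aemeasurable]
  calc ∑' i : ℕ, ∫⁻ x in Q.toSet, ‖boxAverage f (k + i + 1) x - boxAverage f (k + i) x‖ₑ
      ≤ ∑' i : ℕ, boxConst d n * singIntegral s G Q.toSet (2 ^ (-k) / 2) *
          2 ^ (-((k : ℝ) + i) * (s / 2)) := by
        refine ENNReal.tsum_le_tsum fun i => ?_
        refine (lintegral_boxAverage_succ_sub_le hn hs hf hG (k := k + i) (by omega)).trans ?_
        have : singIntegral s G Q.toSet (2 ^ (-(k + i)) / 2) ≤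
            singIntegral s G Q.toSet (2 ^ (-k) / 2) := by
          refine singIntegral_mono le_rfl ?_
          gcongr
          · norm_num
          · omega
        push_cast
        calc _ ≤ boxConst d n * 2 ^ (-((k : ℝ) + i) * (s / 2)) *
            singIntegral s G Q.toSet (2 ^ (-k) / 2) := by gcongr
          _ = _ := by ring
    _ = _ := by
        rw [ENNReal.tsum_mul_left, tsum_two_rpow_add]; ring

/-- The box averages converge almost everywhere. -/
lemma ae_exists_tendsto_boxAverage (hn : 1 ≤ n) {s : ℝ} (hs : 0 < s) {f : Ambient d n → ℂ}
    {G : Ambient d n → EuclideanSpace ℂ (Fin d ⊕ Fin n)}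
    (hf : LocallyIntegrable f volume) (hG : IsWeakGradient f G) {Q : DyadicCube (Fin d)}
    (hJ : singIntegral s G Q.toSet (Q.edge / 2) ≠ ⊤) :
    ∀ᵐ x ∂(volume.restrict Q.toSet), ∃ l, Tendsto (fun k : ℤ => boxAverage f k x) atTop (𝓝 l) := by
  have h := lintegral_tsum_boxAverage_sub_le hn hs hf hG (Q := Q) (k := Q.level) le_rfl
  have hfin : ∫⁻ x in Q.toSet, ∑' i : ℕ,
      ‖boxAverage f (Q.level + i + 1) x - boxAverage f (Q.level + i) x‖ₑ ≠ ⊤ := by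
    refine ne_top_of_le_ne_top ?_ h
    exact ENNReal.mul_ne_top (ENNReal.mul_ne_top (ENNReal.mul_ne_top boxConst_ne_top
      (geomSum_ne_top (by linarith))) (two_rpow_ne_top _)) hJ
  have hm : Measurable fun x => ∑' i : ℕ,
      ‖boxAverage f (Q.level + i + 1) x - boxAverage f (Q.level + i) x‖ₑ :=
    Measurable.tsum fun i =>
      ((measurable_boxAverage f _).sub (measurable_boxAverage f _)).enorm
  filter_upwards [ae_lt_top hm hfin] with x hx
  have hc : CauchySeq fun i : ℕ => boxAverage f (Q.level + i) x := by
    refine cauchySeq_of_edist_le_of_tsum_ne_top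
      (fun i : ℕ => ‖boxAverage f (Q.level + i + 1) x - boxAverage f (Q.level + i) x‖ₑ)
      (fun i => ?_) hx.ne
    rw [edist_comm, edist_eq_enorm_sub]
    push_cast
    rw [add_assoc]
  obtain ⟨l, hl⟩ := cauchySeq_tendsto_of_complete hc
  refine ⟨l, ?_⟩
  have h1 : Tendsto (fun k : ℤ => (k - Q.level).toNat) atTop atTop := by
    refine tendsto_atTop.2 fun b => ?_
    filter_upwards [eventually_ge_atTop (Q.level + b)] with k hk
    omega
  refine (hl.comp h1).congr' ?_
  filter_upwards [eventually_ge_atTop Q.level] with k hk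
  simp only [Function.comp_apply]
  congr 1
  omega

/-- The distance between the box averages and their limit. -/
lemma lintegral_boxAverage_sub_limit_le (hn : 1 ≤ n) {s : ℝ} (hs : 0 < s) {f : Ambient d n → ℂ}
    {G : Ambient d n → EuclideanSpace ℂ (Fin d ⊕ Fin n)}
    (hf : LocallyIntegrable f volume) (hG : IsWeakGradient f G) {T : Base d → ℂ}
    (hT : ∀ᵐ x, Tendsto (fun k : ℤ => boxAverage f k x) atTop (𝓝 (T x)))
    {Q : DyadicCube (Fin d)} {k : ℤ} (hk : Q.level ≤ k) :
    ∫⁻ x in Q.toSet, ‖boxAverage f k x - T x‖ₑ ≤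
      boxConst d n * geomSum (s / 2) * 2 ^ (-(k : ℝ) * (s / 2)) *
        singIntegral s G Q.toSet (2 ^ (-k) / 2) := by
  refine le_trans (lintegral_mono_ae ?_) (lintegral_tsum_boxAverage_sub_le hn hs hf hG hk)
  filter_upwards [ae_restrict_of_ae hT] with x hx
  have h1 : Tendsto (fun i : ℕ => boxAverage f (k + i) x) atTop (𝓝 (T x)) :=
    hx.comp (tendsto_atTop_add_const_left _ k tendsto_natCast_atTop_atTop)
  have h2 := edist_le_tsum_of_edist_le_of_tendsto₀
    (fun i : ℕ => ‖boxAverage f (k + i + 1) x - boxAverage f (k + i) x‖ₑ) (fun i => ?_) h1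
  · simpa [edist_eq_enorm_sub] using h2
  · rw [edist_comm, edist_eq_enorm_sub]
    push_cast
    rw [add_assoc]

end BoxAverage

/-! ### Weighted energies -/

section Energy

open DyadicCube

variable {d n : ℕ}

lemma DyadicCube.card_steps (a : ℕ) : (steps (Fin d) a).card = (2 * a + 1) ^ d := by
  classical
  simp only [steps, Fintype.card_piFinset, Int.card_Icc, Finset.prod_const, Finset.card_univ,
    Fintype.card_fin]
  congr 1
  omega

lemma DyadicCube.volume_enlarge_le (Q : DyadicCube (Fin d)) (a : ℕ) :
    volume (Q.enlarge a) ≤ (2 * a + 1) ^ d * 2 ^ (-(Q.level : ℝ) * d) := by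
  have h := lintegral_enlarge_le (volume : Measure (Base d)) (π := id) Q a univ 1
  simp only [preimage_id, inter_univ, Pi.one_apply, setLIntegral_one, volume_toSet] at h
  refine h.trans_eq ?_
  simp [shift, Finset.sum_const, card_steps]

/-- Enlarged cubes of the same level have bounded overlap. -/
lemma tsum_lintegral_enlarge_le {Ω : Type*} [MeasurableSpace Ω] (ν : Measure Ω)
    {π : Ω → Base d} (hπ : Measurable π) (k : ℤ) (a : ℕ) (B : Set Ω) (H : Ω → ℝ≥0∞) :
    ∑' m : Fin d → ℤ, ∫⁻ X in π ⁻¹' (enlarge ⟨k, m⟩ a) ∩ B, H X ∂ν ≤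
      (2 * a + 1) ^ d * ∫⁻ X in B, H X ∂ν := by
  calc ∑' m : Fin d → ℤ, ∫⁻ X in π ⁻¹' (enlarge ⟨k, m⟩ a) ∩ B, H X ∂ν
      ≤ ∑' m : Fin d → ℤ, ∑ v ∈ steps (Fin d) a,
          ∫⁻ X in π ⁻¹' (shift ⟨k, m⟩ v).toSet ∩ B, H X ∂ν :=
        ENNReal.tsum_le_tsum fun m => lintegral_enlarge_le ν _ a B H
    _ = ∑ v ∈ steps (Fin d) a, ∑' m : Fin d → ℤ,
          ∫⁻ X in π ⁻¹' (shift ⟨k, m⟩ v).toSet ∩ B, H X ∂ν :=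
        Summable.tsum_finsetSum fun _ _ => ENNReal.summable
    _ = ∑ v ∈ steps (Fin d) a, ∫⁻ X in B, H X ∂ν := by
        refine Finset.sum_congr rfl fun v _ => ?_
        rw [lintegral_eq_tsum_preimage (ν.restrict B) hπ k]
        simp_rw [Measure.restrict_restrict (hπ (measurableSet_toSet _))]
        exact (Equiv.addRight v).tsum_eq fun m : Fin d → ℤ =>
          ∫⁻ X in π ⁻¹' (⟨k, m⟩ : DyadicCube (Fin d)).toSet ∩ B, H X ∂ν
    _ = (2 * a + 1) ^ d * ∫⁻ X in B, H X ∂ν := by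
        simp [card_steps]

variable {E : Type*} [NormedAddCommGroup E]

/-- The `p`-th power of the norm of `h` in `L^p(μ_α)`. -/
def energy (p α : ℝ) (h : Ambient d n → E) : ℝ≥0∞ := ∫⁻ X, wt X ^ α * ‖h X‖ₑ ^ p

lemma eLpNorm_rpow_eq_energy (hn : 1 ≤ n) {p : ℝ} (hp : 1 ≤ p) (α : ℝ) (h : Ambient d n → E) :
    eLpNorm h (ENNReal.ofReal p) (weightedMeasure d n α) ^ p = energy p α h := by
  have hp0 : 0 < p := by linarith
  rw [eLpNorm_eq_lintegral_rpow_enorm_toReal (by simpa using hp0) ENNReal.ofReal_ne_top,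
    ENNReal.toReal_ofReal hp0.le, ← ENNReal.rpow_mul, one_div_mul_cancel hp0.ne', ENNReal.rpow_one,
    lintegral_weightedMeasure hn, energy]

/-- The part of an energy, with an additional power of the weight, over `S × {‖y‖ < r}`. -/
def localEnergy (p α s : ℝ) (h : Ambient d n → E) (S : Set (Base d)) (r : ℝ) : ℝ≥0∞ :=
  ∫⁻ X in slab S r, wt X ^ (α + s / 2) * ‖h X‖ₑ ^ p

lemma localEnergy_le (hn : 1 ≤ n) {p α s : ℝ} (hs : 0 < s) (h : Ambient d n → E)
    {S : Set (Base d)} (hS : MeasurableSet S) {r : ℝ} {R : ℝ≥0∞} (hr : ENNReal.ofReal r ≤ R)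
    (hR : R ≠ ⊤) :
    localEnergy p α s h S r ≤ R ^ (s / 2) * energy p α h := by
  rw [energy, ← lintegral_const_mul' _ _ (ENNReal.rpow_ne_top_of_nonneg (by linarith) hR)]
  refine le_trans (setLIntegral_mono_ae' (measurableSet_slab hS r) ?_)
    (setLIntegral_le_lintegral _ _)
  filter_upwards [ae_ver_ne_zero (d := d) hn] with X hX hXS
  have h1 : wt X ≤ R := by
    refine (min_le_right _ _).trans (le_trans ?_ hr)
    rw [← ofReal_norm]
    exact ENNReal.ofReal_le_ofReal hXS.2.le
  rw [add_comm, ENNReal.rpow_add _ _ (wt_ne_zero hX) (wt_ne_top X), mul_assoc]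
  gcongr

/-- The sum of the local energies over all scales. -/
lemma tsum_localEnergy_le (hn : 1 ≤ n) {p α s : ℝ} (hs : 0 < s) {h : Ambient d n → E}
    (hh : AEStronglyMeasurable h volume) :
    ∑' k : ℕ, 2 ^ ((k : ℝ) * (s / 2)) * localEnergy p α s h univ (2 ^ (-(k : ℤ))) ≤
      geomSum (s / 2) * energy p α h := by
  have hm : AEMeasurable (fun X => wt X ^ (α + s / 2) * ‖h X‖ₑ ^ p) volume :=
    (measurable_wt.pow_const _).aemeasurable.mul (hh.enorm.pow_const p)
  have h1 : ∀ k : ℕ, 2 ^ ((k : ℝ) * (s / 2)) * localEnergy p α s h univ (2 ^ (-(k : ℤ))) =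
      ∫⁻ X, 2 ^ ((k : ℝ) * (s / 2)) * (slab univ (2 ^ (-(k : ℤ)))).indicator
        (fun X => wt X ^ (α + s / 2) * ‖h X‖ₑ ^ p) X := by
    intro k
    rw [lintegral_const_mul' _ _ (two_rpow_ne_top _),
      lintegral_indicator (measurableSet_slab MeasurableSet.univ _), localEnergy]
  simp_rw [h1]
  rw [← lintegral_tsum fun k =>
      ((hm.indicator (measurableSet_slab MeasurableSet.univ _)).const_mul _),
    energy, ← lintegral_const_mul' _ _ (geomSum_ne_top (by linarith))]
  refine lintegral_mono_ae ?_
  filter_upwards [ae_ver_ne_zero (d := d) hn] with X hX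
  calc ∑' k : ℕ, 2 ^ ((k : ℝ) * (s / 2)) * (slab univ (2 ^ (-(k : ℤ)))).indicator
        (fun X => wt X ^ (α + s / 2) * ‖h X‖ₑ ^ p) X
      ≤ ∑' k : ℕ, (if 2 ^ (k : ℝ) * wt X ≤ 1 then 2 ^ ((k : ℝ) * (s / 2)) * wt X ^ (s / 2) else 0) *
          (wt X ^ α * ‖h X‖ₑ ^ p) := by
        refine ENNReal.tsum_le_tsum fun k => ?_
        by_cases hXs : X ∈ (slab univ (2 ^ (-(k : ℤ))) : Set (Ambient d n))
        · have h2 : 2 ^ (k : ℝ) * wt X ≤ 1 := by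
            have : wt X ≤ 2 ^ (-(k : ℝ)) := by
              refine (min_le_right _ _).trans ?_
              rw [← ofReal_norm]
              refine (ENNReal.ofReal_le_ofReal hXs.2.le).trans_eq ?_
              rw [ofReal_two_zpow]; push_cast; rfl
            calc 2 ^ (k : ℝ) * wt X ≤ 2 ^ (k : ℝ) * 2 ^ (-(k : ℝ)) := by gcongr
              _ = 1 := by rw [two_rpow_mul]; simp
          rw [if_pos h2, indicator_of_mem hXs, add_comm α,
            ENNReal.rpow_add _ _ (wt_ne_zero hX) (wt_ne_top X)]
          exact le_of_eq (by ring)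
        · rw [indicator_of_notMem hXs]
          simp
    _ = (∑' k : ℕ, (if 2 ^ (k : ℝ) * wt X ≤ 1 then
          2 ^ ((k : ℝ) * (s / 2)) * wt X ^ (s / 2) else 0)) * (wt X ^ α * ‖h X‖ₑ ^ p) :=
        ENNReal.tsum_mul_right
    _ ≤ geomSum (s / 2) * (wt X ^ α * ‖h X‖ₑ ^ p) := by
        gcongr
        exact tsum_two_rpow_mul_le (by linarith) _

/-- The integral of `‖y‖^{-n+s/2}` over the unit ball of `ℝ^n`. -/
def ballIntegral (n : ℕ) (s : ℝ) : ℝ≥0∞ :=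
  ∫⁻ y in Metric.ball (0 : EuclideanSpace ℝ (Fin n)) 1, ‖y‖ₑ ^ (-((n : ℝ) - s / 2))

lemma ballIntegral_ne_top (hn : 1 ≤ n) {s : ℝ} (hs : 0 < s) : ballIntegral n s ≠ ⊤ :=
  (lintegral_ball_one_rpow_lt_top hn (by linarith)).ne

/-- Jensen's inequality for the density `wt ^ (-(n - s / 2))`: the factor that remains of the weight
in `singIntegral` is `wt ^ (1 - s)`, and `p (1 - s) - (n - s / 2) = α + s / 2`. -/
lemma singIntegral_rpow_le (hn : 1 ≤ n) {p α s : ℝ} (hp : 1 ≤ p) (hα : α + n = p * (1 - s))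
    {G : Ambient d n → EuclideanSpace ℂ (Fin d ⊕ Fin n)} (hG : AEStronglyMeasurable G volume)
    {S : Set (Base d)} (hS : MeasurableSet S) {r : ℝ} (hr : 0 < r) (hr1 : r ≤ 1) :
    singIntegral s G S r ^ p ≤
      (volume S * (ENNReal.ofReal r ^ (s / 2) * ballIntegral n s)) ^ (p - 1)
      * localEnergy p α s G S r := by
  have hm : AEMeasurable (fun X => ‖G X‖ₑ * wt X ^ (1 - (n : ℝ) - s / 2)) volume :=
    hG.enorm.mul (measurable_wt.pow_const _).aemeasurable
  refine (rpow_setLIntegral_le_wt hn hp ((n : ℝ) - s / 2) (slab S r) hm).trans_eq ?_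
  congr 1
  · rw [lintegral_slab_wt_rpow hS _ hr hr1, ballIntegral]
    congr 4; ring
  · refine lintegral_congr_ae (ae_restrict_of_ae ?_)
    filter_upwards [ae_ver_ne_zero (d := d) hn] with X hX
    rw [ENNReal.mul_rpow_of_nonneg _ _ (by linarith), ← ENNReal.rpow_mul, mul_left_comm,
      ← ENNReal.rpow_add _ _ (wt_ne_zero hX) (wt_ne_top X), mul_comm]
    congr 2
    have : α = p * (1 - s) - n := by linarith
    rw [this]; ring

/-- The constant in the scaled estimate of `singIntegral`. -/
def singConst (d n : ℕ) (p s : ℝ) : ℝ≥0∞ := (5 ^ d * ballIntegral n s) ^ (p - 1)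

lemma singConst_ne_top (hn : 1 ≤ n) {p s : ℝ} (hp : 1 ≤ p) (hs : 0 < s) :
    singConst d n p s ≠ ⊤ :=
  ENNReal.rpow_ne_top_of_nonneg (by linarith)
    (ENNReal.mul_ne_top (by simp) (ballIntegral_ne_top hn hs))

/-- The `p`-th power of the quantity that bounds the differences of averages, in terms of the local
energy: `d (p - 1)` powers of `2` are absorbed by the volume of the cube, and `(s / 2) (p - 1)` by
the total mass of the density in Jensen's inequality. -/
lemma two_rpow_mul_singIntegral_rpow_le (hn : 1 ≤ n) {p α s : ℝ} (hp : 1 ≤ p) (hs : 0 < s)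
    (hα : α + n = p * (1 - s))
    {G : Ambient d n → EuclideanSpace ℂ (Fin d ⊕ Fin n)} (hG : AEStronglyMeasurable G volume)
    (Q : DyadicCube (Fin d)) {a : ℕ} (ha : a ≤ 2) {r : ℝ} (hr : 0 < r) (hr1 : r ≤ 1)
    (hrQ : r ≤ Q.edge) :
    (2 ^ ((Q.level : ℝ) * (d - s / 2)) * singIntegral s G (Q.enlarge a) r) ^ p ≤
      singConst d n p s * 2 ^ ((Q.level : ℝ) * (d + s / 2 - s * p)) *
        localEnergy p α s G (Q.enlarge a) r := by
  have hp1 : 0 ≤ p - 1 := by linarith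
  rw [ENNReal.mul_rpow_of_nonneg _ _ (by linarith)]
  have h1 := singIntegral_rpow_le hn hp hα hG (Q.measurableSet_enlarge a) hr hr1
  have h2 : volume (Q.enlarge a) ≤ 5 ^ d * 2 ^ (-(Q.level : ℝ) * d) := by
    refine (measure_mono (Q.enlarge_mono ha)).trans ((Q.volume_enlarge_le 2).trans_eq ?_)
    norm_num
  have h3 : ENNReal.ofReal r ^ (s / 2) ≤ 2 ^ (-(Q.level : ℝ) * (s / 2)) := by
    rw [ENNReal.rpow_mul, ← ofReal_edge]
    exact ENNReal.rpow_le_rpow (ENNReal.ofReal_le_ofReal hrQ) (by linarith)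
  have h4 : (volume (Q.enlarge a) * (ENNReal.ofReal r ^ (s / 2) * ballIntegral n s)) ^ (p - 1) ≤
      singConst d n p s * 2 ^ (-(Q.level : ℝ) * (d + s / 2) * (p - 1)) := by
    rw [singConst, ENNReal.rpow_mul 2, ← ENNReal.mul_rpow_of_nonneg _ _ hp1]
    refine ENNReal.rpow_le_rpow ?_ hp1
    calc _ ≤ 5 ^ d * 2 ^ (-(Q.level : ℝ) * d) * (2 ^ (-(Q.level : ℝ) * (s / 2)) *
          ballIntegral n s) := by gcongr
      _ = 5 ^ d * ballIntegral n s *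
            (2 ^ (-(Q.level : ℝ) * d) * 2 ^ (-(Q.level : ℝ) * (s / 2))) := by
          ring
      _ = _ := by rw [two_rpow_mul]; congr 2; ring
  calc _ ≤ (2 ^ ((Q.level : ℝ) * (d - s / 2))) ^ p * (singConst d n p s *
        2 ^ (-(Q.level : ℝ) * (d + s / 2) * (p - 1)) * localEnergy p α s G (Q.enlarge a) r) := by
        gcongr
        exact h1.trans (by gcongr)
    _ = singConst d n p s * (2 ^ ((Q.level : ℝ) * (d - s / 2) * p) *
        2 ^ (-(Q.level : ℝ) * (d + s / 2) * (p - 1))) * localEnergy p α s G (Q.enlarge a) r := by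
        rw [ENNReal.rpow_mul 2 ((Q.level : ℝ) * (d - s / 2)) p]; ring
    _ = _ := by
        rw [two_rpow_mul]; congr 3; ring

/-- Functions of finite energy are integrable over bounded sets, with a quantitative bound near
the subspace. -/
lemma rpow_setLIntegral_le_energy (hn : 1 ≤ n) {p α s : ℝ} (hp : 1 ≤ p) (hs : 0 < s)
    (hα : α + n = p * (1 - s)) {h : Ambient d n → E} (hh : AEStronglyMeasurable h volume)
    (A : Set (Ambient d n)) :
    (∫⁻ X in A, ‖h X‖ₑ) ^ p ≤ (∫⁻ X in A, wt X ^ (-((n : ℝ) - s / 2))) ^ (p - 1) *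
      ∫⁻ X in A, wt X ^ α * ‖h X‖ₑ ^ p := by
  refine (rpow_setLIntegral_le_wt hn hp ((n : ℝ) - s / 2) A hh.enorm).trans ?_
  refine mul_le_mul' le_rfl (lintegral_mono fun X => mul_le_mul' ?_ le_rfl)
  have hn' : (1 : ℝ) ≤ n := by exact_mod_cast hn
  refine ENNReal.rpow_le_rpow_of_exponent_ge (wt_le_one X) ?_
  have : α = p * (1 - s) - n := by linarith
  rw [this]
  nlinarith

lemma lintegral_slab_wt_lt_top (hn : 1 ≤ n) {s : ℝ} (hs : 0 < s) {S : Set (Base d)}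
    (hS : MeasurableSet S) (hSt : volume S ≠ ⊤) (R : ℝ) :
    ∫⁻ X in (slab S R : Set (Ambient d n)), wt X ^ (-((n : ℝ) - s / 2)) < ⊤ := by
  have hn' : (1 : ℝ) ≤ n := by exact_mod_cast hn
  have hle : ∀ X ∈ (slab S R : Set (Ambient d n)), wt X ^ (-((n : ℝ) - s / 2)) ≤
      (slab S 1).indicator (fun X => wt X ^ (-((n : ℝ) - s / 2))) X + 1 := by
    intro X hX
    by_cases h1 : X ∈ (slab S 1 : Set (Ambient d n))
    · rw [indicator_of_mem h1]; exact le_self_add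
    · have h2 : 1 ≤ ‖ver X‖ := by
        by_contra hlt
        exact h1 ⟨hX.1, not_le.1 hlt⟩
      have : wt X = 1 := by
        refine min_eq_left ?_
        rw [← ofReal_norm, ← ENNReal.ofReal_one]
        exact ENNReal.ofReal_le_ofReal h2
      simp [this]
  refine lt_of_le_of_lt (setLIntegral_mono' (measurableSet_slab hS R) hle) ?_
  rw [lintegral_add_right _ measurable_const]
  refine ENNReal.add_lt_top.2 ⟨?_, ?_⟩
  · refine lt_of_le_of_lt (setLIntegral_le_lintegral _ _) ?_
    rw [lintegral_indicator (measurableSet_slab hS 1),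
      lintegral_slab_wt_rpow hS _ one_pos le_rfl]
    refine ENNReal.mul_lt_top hSt.lt_top (ENNReal.mul_lt_top (by simp) ?_)
    exact (ballIntegral_ne_top hn hs).lt_top
  · rw [setLIntegral_one, volume_slab hS]
    exact ENNReal.mul_lt_top hSt.lt_top measure_ball_lt_top

lemma lintegral_slab_lt_top (hn : 1 ≤ n) {p α s : ℝ} (hp : 1 ≤ p) (hs : 0 < s)
    (hα : α + n = p * (1 - s)) {h : Ambient d n → E} (hh : AEStronglyMeasurable h volume)
    (hE : energy p α h ≠ ⊤) {S : Set (Base d)} (hS : MeasurableSet S) (hSt : volume S ≠ ⊤)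
    (R : ℝ) : ∫⁻ X in slab S R, ‖h X‖ₑ < ⊤ := by
  have h1 := rpow_setLIntegral_le_energy hn hp hs hα hh (slab S R)
  have h2 : (∫⁻ X in slab S R, ‖h X‖ₑ) ^ p < ⊤ := by
    refine lt_of_le_of_lt h1 (ENNReal.mul_lt_top ?_ ?_)
    · exact (ENNReal.rpow_ne_top_of_nonneg (by linarith)
        (lintegral_slab_wt_lt_top hn hs hS hSt R).ne).lt_top
    · exact lt_of_le_of_lt (setLIntegral_le_lintegral _ _) hE.lt_top
  exact (ENNReal.rpow_lt_top_iff_of_pos (by linarith)).1 h2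

/-- Functions of finite energy are locally integrable with respect to Lebesgue measure. -/
lemma locallyIntegrable_of_energy (hn : 1 ≤ n) {p α s : ℝ} (hp : 1 ≤ p) (hs : 0 < s)
    (hα : α + n = p * (1 - s)) {h : Ambient d n → E} (hh : AEStronglyMeasurable h volume)
    (hE : energy p α h ≠ ⊤) : LocallyIntegrable h volume := by
  rw [locallyIntegrable_iff]
  intro K hK
  obtain ⟨R, hR⟩ := hK.isBounded.subset_ball 0
  refine ⟨hh.restrict, ?_⟩
  refine lt_of_le_of_lt (lintegral_mono_set (t := slab (Metric.ball 0 R) R) fun X hX => ?_)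
    (lintegral_slab_lt_top hn hp hs hα hh hE Metric.isOpen_ball.measurableSet
      measure_ball_lt_top.ne R)
  have h1 := mem_ball_zero_iff.1 (hR hX)
  exact ⟨mem_ball_zero_iff.2 ((norm_hor_le X).trans_lt h1), (norm_ver_le X).trans_lt h1⟩

end Energy

/-! ### The trace belongs to the Besov space -/

section TraceBesov

open DyadicCube

variable {d n : ℕ}

lemma ae_of_forall_ae_toSet {P : Base d → Prop} (k : ℤ)
    (h : ∀ m : Fin d → ℤ, ∀ᵐ x ∂(volume.restrict (⟨k, m⟩ : DyadicCube (Fin d)).toSet), P x) :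
    ∀ᵐ x, P x := by
  have h1 := (ae_restrict_iUnion_iff (μ := volume)
    (fun m : Fin d → ℤ => (⟨k, m⟩ : DyadicCube (Fin d)).toSet) P).2 h
  rwa [iUnion_toSet, Measure.restrict_univ] at h1

lemma singIntegral_ne_top (hn : 1 ≤ n) {p α s : ℝ} (hp : 1 ≤ p) (hs : 0 < s)
    (hα : α + n = p * (1 - s))
    {G : Ambient d n → EuclideanSpace ℂ (Fin d ⊕ Fin n)} (hG : AEStronglyMeasurable G volume)
    (hE : energy p α G ≠ ⊤) {S : Set (Base d)} (hS : MeasurableSet S) (hSt : volume S ≠ ⊤)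
    {r : ℝ} (hr : 0 < r) (hr1 : r ≤ 1) : singIntegral s G S r ≠ ⊤ := by
  have h := singIntegral_rpow_le hn hp hα hG hS hr hr1
  have h1 : singIntegral s G S r ^ p < ⊤ := by
    refine lt_of_le_of_lt h (ENNReal.mul_lt_top ?_ ?_)
    · refine (ENNReal.rpow_ne_top_of_nonneg (by linarith) ?_).lt_top
      exact ENNReal.mul_ne_top hSt (ENNReal.mul_ne_top
        (ENNReal.rpow_ne_top_of_nonneg (by linarith) ENNReal.ofReal_ne_top)
        (ballIntegral_ne_top hn hs))
    · exact lt_of_le_of_lt (localEnergy_le hn hs G hS le_rfl ENNReal.ofReal_ne_top)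
        (ENNReal.mul_lt_top (ENNReal.rpow_ne_top_of_nonneg (by linarith)
          ENNReal.ofReal_ne_top).lt_top hE.lt_top)
  exact ((ENNReal.rpow_lt_top_iff_of_pos (by linarith)).1 h1).ne

/-- The limit of the box averages exists almost everywhere. -/
lemma ae_exists_limit_boxAverage (hn : 1 ≤ n) {p α s : ℝ} (hp : 1 ≤ p) (hs : 0 < s)
    (hα : α + n = p * (1 - s)) {f : Ambient d n → ℂ}
    {G : Ambient d n → EuclideanSpace ℂ (Fin d ⊕ Fin n)}
    (hf : LocallyIntegrable f volume) (hG : IsWeakGradient f G) (hE : energy p α G ≠ ⊤) :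
    ∀ᵐ x, ∃ l, Tendsto (fun k : ℤ => boxAverage f k x) atTop (𝓝 l) := by
  refine ae_of_forall_ae_toSet 0 fun m => ?_
  refine ae_exists_tendsto_boxAverage hn hs hf hG ?_
  have he : (⟨0, m⟩ : DyadicCube (Fin d)).edge = 1 := by simp [edge]
  rw [he]
  exact singIntegral_ne_top hn hp hs hα hG.1.aestronglyMeasurable hE (measurableSet_toSet _)
    (volume_toSet_ne_top _) (by norm_num) (by norm_num)

lemma integrableOn_toSet {E : Type*} [NormedAddCommGroup E] {T : Base d → E}
    (hT : LocallyIntegrable T volume) (Q : DyadicCube (Fin d)) : IntegrableOn T Q.toSet := by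
  have hb : Bornology.IsBounded Q.toSet := by
    rw [Metric.isBounded_iff, ← enlarge_zero]
    refine ⟨Fintype.card (Fin d) * ((1 + 2 * ((0 : ℕ) : ℝ)) * Q.edge), fun x hx y hy => ?_⟩
    rw [dist_comm, dist_eq_norm]
    exact norm_sub_le_of_mem_enlarge hx hy
  exact (hT.integrableOn_isCompact hb.isCompact_closure).mono_set subset_closure

/-- The constant in the comparison of the averages of the trace over neighboring cubes. -/
def neighborConst (d n : ℕ) (s : ℝ) : ℝ≥0∞ :=
  boxConst d n * (geomSum (s / 2) * (1 + 2 ^ ((d : ℝ) + 1)) + 2)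

lemma neighborConst_ne_top {s : ℝ} (hs : 0 < s) : neighborConst d n s ≠ ⊤ :=
  ENNReal.mul_ne_top boxConst_ne_top (ENNReal.add_ne_top.2 ⟨ENNReal.mul_ne_top
    (geomSum_ne_top (by linarith)) (ENNReal.add_ne_top.2 ⟨by simp, two_rpow_ne_top _⟩), by simp⟩)

section

variable {s : ℝ} {f : Ambient d n → ℂ} {G : Ambient d n → EuclideanSpace ℂ (Fin d ⊕ Fin n)}
  {T : Base d → ℂ}

lemma enorm_average_limit_sub_le (hn : 1 ≤ n) (hs : 0 < s)
    (hf : LocallyIntegrable f volume) (hG : IsWeakGradient f G)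
    (hT : ∀ᵐ x, Tendsto (fun k : ℤ => boxAverage f k x) atTop (𝓝 (T x)))
    (hTi : LocallyIntegrable T volume) (Q : DyadicCube (Fin d)) :
    ‖(⨍ x in Q.toSet, T x) - ⨍ X in box Q, f X‖ₑ ≤ boxConst d n * geomSum (s / 2) *
      (2 ^ ((Q.level : ℝ) * (d - s / 2)) * singIntegral s G Q.toSet (Q.edge / 2)) := by
  have hTQ : IntegrableOn T Q.toSet := integrableOn_toSet hTi Q
  refine (enorm_average_sub_le Q.volume_toSet_ne_zero Q.volume_toSet_ne_top hTQ _).trans ?_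
  have h1 : ∫⁻ x in Q.toSet, ‖T x - ⨍ X in box Q, f X‖ₑ =
      ∫⁻ x in Q.toSet, ‖boxAverage f Q.level x - T x‖ₑ := by
    refine setLIntegral_congr_fun (measurableSet_toSet Q) fun x hx => ?_
    rw [boxAverage_eq hx, ← enorm_neg, neg_sub]
  rw [h1, volume_toSet, two_rpow_inv, Fintype.card_fin]
  refine (mul_le_mul' le_rfl (lintegral_boxAverage_sub_limit_le hn hs hf hG hT le_rfl)).trans_eq ?_
  have : (2 : ℝ≥0∞) ^ ((Q.level : ℝ) * (d - s / 2)) =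
      2 ^ (-(-(Q.level : ℝ) * d)) * 2 ^ (-(Q.level : ℝ) * (s / 2)) := by
    rw [two_rpow_mul]; congr 1; ring
  rw [this, edge]
  ring

/-- Comparison of the averages of the trace over neighboring cubes. -/
lemma enorm_average_neighbor_sub_le (hn : 1 ≤ n) (hs : 0 < s) (hs1 : s ≤ 1)
    (hf : LocallyIntegrable f volume) (hG : IsWeakGradient f G)
    (hT : ∀ᵐ x, Tendsto (fun k : ℤ => boxAverage f k x) atTop (𝓝 (T x)))
    (hTi : LocallyIntegrable T volume) {Q Q' : DyadicCube (Fin d)} (h : Neighbor Q Q') :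
    ‖(⨍ x in Q.toSet, T x) - ⨍ x in Q'.toSet, T x‖ₑ ≤ neighborConst d n s *
      (2 ^ ((Q.level : ℝ) * (d - s / 2)) * singIntegral s G (Q.enlarge 2) Q.edge) := by
  set Z := 2 ^ ((Q.level : ℝ) * (d - s / 2)) * singIntegral s G (Q.enlarge 2) Q.edge with hZ
  set V : Set (Ambient d n) := slab (Q.enlarge 2) Q.edge
  have hp := Q.edge_pos
  have hp' := Q'.edge_pos
  have hed : Q'.edge / 2 ≤ Q.edge := by
    have := h.1
    rw [le_div_iff₀ hp'] at this
    linarith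
  have hQ'l : Q'.level ≤ Q.level + 1 := by have := h.level_eq; omega
  -- Both averages are compared with those over the boxes above the cubes, and these with the
  -- average over the common superset `V`.
  have b1 : ‖(⨍ x in Q.toSet, T x) - ⨍ X in box Q, f X‖ₑ ≤ boxConst d n * geomSum (s / 2) * Z := by
    refine (enorm_average_limit_sub_le hn hs hf hG hT hTi Q).trans ?_
    exact mul_le_mul' le_rfl (mul_le_mul' le_rfl
      (singIntegral_mono (Q.toSet_subset_enlarge 2) (by linarith)))
  have b2 : ‖(⨍ x in Q'.toSet, T x) - ⨍ X in box Q', f X‖ₑ ≤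
      boxConst d n * geomSum (s / 2) * (2 ^ ((d : ℝ) + 1) * Z) := by
    refine (enorm_average_limit_sub_le hn hs hf hG hT hTi Q').trans ?_
    rw [hZ, ← mul_assoc (2 ^ ((d : ℝ) + 1)), two_rpow_mul]
    gcongr
    · norm_num
    · have hd0 : (0 : ℝ) ≤ d := Nat.cast_nonneg d
      rcases h.level_eq with e | e | e <;> rw [e] <;> push_cast <;> linarith
    · exact singIntegral_mono h.subset_enlarge hed
  have b3 : ‖(⨍ X in box Q, f X) - ⨍ X in V, f X‖ₑ ≤ boxConst d n * Z := by
    rw [hZ, ← mul_assoc]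
    exact enorm_average_box_sub_le hn hs hf hG Q Q (by omega) le_rfl hp le_rfl
      (slab_mono (Q.toSet_subset_enlarge 2) (by linarith))
  have b4 : ‖(⨍ X in box Q', f X) - ⨍ X in V, f X‖ₑ ≤ boxConst d n * Z := by
    rw [hZ, ← mul_assoc]
    exact enorm_average_box_sub_le hn hs hf hG Q Q' hQ'l le_rfl hp le_rfl
      (slab_mono h.subset_enlarge hed)
  have e : (⨍ x in Q.toSet, T x) - ⨍ x in Q'.toSet, T x =
      (((⨍ x in Q.toSet, T x) - ⨍ X in box Q, f X) + ((⨍ X in box Q, f X) - ⨍ X in V, f X)) -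
      (((⨍ x in Q'.toSet, T x) - ⨍ X in box Q', f X) + ((⨍ X in box Q', f X) - ⨍ X in V, f X)) := by
    ring
  rw [e]
  refine enorm_sub_le.trans ((add_le_add (enorm_add_le _ _) (enorm_add_le _ _)).trans ?_)
  refine (add_le_add (add_le_add b1 b3) (add_le_add b2 b4)).trans_eq ?_
  rw [neighborConst]
  ring

/-- The bound of the seminorm part of the Besov norm of the trace. -/
lemma tsum_besov_limit_le (hn : 1 ≤ n) {p α : ℝ} (hp : 1 ≤ p) (hs : 0 < s) (hs1 : s ≤ 1)
    (hα : α + n = p * (1 - s))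
    (hf : LocallyIntegrable f volume) (hG : IsWeakGradient f G)
    (hT : ∀ᵐ x, Tendsto (fun k : ℤ => boxAverage f k x) atTop (𝓝 (T x)))
    (hTi : LocallyIntegrable T volume) :
    (∑' k : ℕ, ENNReal.ofReal ((2 : ℝ) ^ ((k : ℝ) * s * p)) *
      ∑' m : Fin d → ℤ, volume (DyadicCube.toSet ⟨(k : ℤ), m⟩) *
        ∑' Q' : {Q' : DyadicCube (Fin d) // DyadicCube.Neighbor ⟨(k : ℤ), m⟩ Q'},
          ‖(⨍ x in DyadicCube.toSet ⟨(k : ℤ), m⟩, T x) - ⨍ x in Q'.1.toSet, T x‖ₑ ^ p) ≤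
      neighborBound (Fin d) * neighborConst d n s ^ p * singConst d n p s * 5 ^ d *
        geomSum (s / 2) * energy p α G := by
  have hp0 : 0 ≤ p := by linarith
  set C := (neighborBound (Fin d) : ℝ≥0∞) * neighborConst d n s ^ p * singConst d n p s with hC
  have hk : ∀ k : ℕ, ENNReal.ofReal ((2 : ℝ) ^ ((k : ℝ) * s * p)) *
      ∑' m : Fin d → ℤ, volume (DyadicCube.toSet ⟨(k : ℤ), m⟩) *
        ∑' Q' : {Q' : DyadicCube (Fin d) // DyadicCube.Neighbor ⟨(k : ℤ), m⟩ Q'},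
          ‖(⨍ x in DyadicCube.toSet ⟨(k : ℤ), m⟩, T x) - ⨍ x in Q'.1.toSet, T x‖ₑ ^ p ≤
      C * 5 ^ d * (2 ^ ((k : ℝ) * (s / 2)) * localEnergy p α s G univ (2 ^ (-(k : ℤ)))) := by
    intro k
    -- The contribution of one cube is controlled by the energy above an enlargement of it; the
    -- enlargements of the cubes of one level overlap at most `5 ^ d` times.
    have hm : ∀ m : Fin d → ℤ, volume (DyadicCube.toSet ⟨(k : ℤ), m⟩) *
        ∑' Q' : {Q' : DyadicCube (Fin d) // DyadicCube.Neighbor ⟨(k : ℤ), m⟩ Q'},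
          ‖(⨍ x in DyadicCube.toSet ⟨(k : ℤ), m⟩, T x) - ⨍ x in Q'.1.toSet, T x‖ₑ ^ p ≤
        C * 2 ^ ((k : ℝ) * (s / 2 - s * p)) *
          localEnergy p α s G (enlarge ⟨(k : ℤ), m⟩ 2) (2 ^ (-(k : ℤ))) := by
      intro m
      set Q : DyadicCube (Fin d) := ⟨(k : ℤ), m⟩ with hQ
      have he : Q.edge = 2 ^ (-(k : ℤ)) := rfl
      have he1 : Q.edge ≤ 1 := by
        rw [he, zpow_neg]
        exact inv_le_one_of_one_le₀ (one_le_zpow₀ one_le_two (by positivity))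
      rw [tsum_neighbor Q fun Q' => ‖(⨍ x in Q.toSet, T x) - ⨍ x in Q'.toSet, T x‖ₑ ^ p]
      have h1 : ∑ Q' ∈ Q.neighborFinset, ‖(⨍ x in Q.toSet, T x) - ⨍ x in Q'.toSet, T x‖ₑ ^ p ≤
          neighborBound (Fin d) * (neighborConst d n s ^ p * (singConst d n p s *
            2 ^ ((Q.level : ℝ) * (d + s / 2 - s * p)) *
            localEnergy p α s G (Q.enlarge 2) Q.edge)) := by
        refine (Finset.sum_le_card_nsmul _ _ (neighborConst d n s ^ p * (singConst d n p s *
            2 ^ ((Q.level : ℝ) * (d + s / 2 - s * p)) *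
            localEnergy p α s G (Q.enlarge 2) Q.edge)) fun Q' hQ' => ?_).trans ?_
        · refine (ENNReal.rpow_le_rpow (enorm_average_neighbor_sub_le hn hs hs1 hf hG hT hTi
            (mem_neighborFinset.1 hQ')) hp0).trans ?_
          rw [ENNReal.mul_rpow_of_nonneg _ _ hp0]
          gcongr
          exact two_rpow_mul_singIntegral_rpow_le hn hp hs hα hG.1.aestronglyMeasurable Q le_rfl
            Q.edge_pos he1 le_rfl
        · rw [nsmul_eq_mul]
          gcongr
          exact Q.card_neighborFinset_le
      refine (mul_le_mul' le_rfl h1).trans_eq ?_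
      have e : (2 : ℝ≥0∞) ^ ((k : ℝ) * (s / 2 - s * p)) = 2 ^ (-(Q.level : ℝ) * d) *
          2 ^ ((Q.level : ℝ) * (d + s / 2 - s * p)) := by
        rw [two_rpow_mul]; congr 1; simp only [hQ, Int.cast_natCast]; ring
      rw [volume_toSet, Fintype.card_fin, e, he, hC]
      ring
    calc _ ≤ (2 : ℝ≥0∞) ^ ((k : ℝ) * s * p) * ∑' m : Fin d → ℤ,
          C * 2 ^ ((k : ℝ) * (s / 2 - s * p)) *
          localEnergy p α s G (enlarge ⟨(k : ℤ), m⟩ 2) (2 ^ (-(k : ℤ))) := by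
          rw [ofReal_two_rpow]
          exact mul_le_mul' le_rfl (ENNReal.tsum_le_tsum hm)
      _ ≤ (2 : ℝ≥0∞) ^ ((k : ℝ) * s * p) * (C * 2 ^ ((k : ℝ) * (s / 2 - s * p)) *
          (5 ^ d * localEnergy p α s G univ (2 ^ (-(k : ℤ))))) := by
          rw [ENNReal.tsum_mul_left]
          refine mul_le_mul' le_rfl (mul_le_mul' le_rfl ?_)
          refine (tsum_lintegral_enlarge_le volume measurable_hor (k : ℤ) 2
            {X | ‖ver X‖ < 2 ^ (-(k : ℤ))}
            fun X : Ambient d n => wt X ^ (α + s / 2) * ‖G X‖ₑ ^ p).trans_eq ?_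
          rw [localEnergy, slab_eq]
          norm_num
      _ = _ := by
          have e : (2 : ℝ≥0∞) ^ ((k : ℝ) * (s / 2)) = 2 ^ ((k : ℝ) * s * p) *
              2 ^ ((k : ℝ) * (s / 2 - s * p)) := by
            rw [two_rpow_mul]; congr 1; ring
          rw [e]; ring
  refine (ENNReal.tsum_le_tsum hk).trans ?_
  rw [ENNReal.tsum_mul_left, mul_assoc (C * 5 ^ d)]
  exact mul_le_mul' le_rfl (tsum_localEnergy_le hn hs hG.1.aestronglyMeasurable)

end

end TraceBesov

section TraceLp

open DyadicCube

variable {d n : ℕ}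

lemma eLpNorm_rpow_eq_lintegral {Ω E : Type*} [MeasurableSpace Ω] [NormedAddCommGroup E]
    {μ : Measure Ω} {p : ℝ} (hp : 1 ≤ p) (h : Ω → E) :
    eLpNorm h (ENNReal.ofReal p) μ ^ p = ∫⁻ x, ‖h x‖ₑ ^ p ∂μ := by
  have hp0 : 0 < p := by linarith
  rw [eLpNorm_eq_lintegral_rpow_enorm_toReal (by simpa using hp0) ENNReal.ofReal_ne_top,
    ENNReal.toReal_ofReal hp0.le, ← ENNReal.rpow_mul, one_div_mul_cancel hp0.ne', ENNReal.rpow_one]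

lemma eLpNorm_le_of_lintegral_le {Ω E : Type*} [MeasurableSpace Ω] [NormedAddCommGroup E]
    {μ : Measure Ω} {p : ℝ} (hp : 1 ≤ p) {h : Ω → E} {A B : ℝ≥0∞}
    (hle : ∫⁻ x, ‖h x‖ₑ ^ p ∂μ ≤ A * B ^ p) :
    eLpNorm h (ENNReal.ofReal p) μ ≤ A ^ (1 / p) * B := by
  have hp0 : 0 < p := by linarith
  rw [← ENNReal.rpow_le_rpow_iff hp0, eLpNorm_rpow_eq_lintegral hp,
    ENNReal.mul_rpow_of_nonneg _ _ hp0.le, ← ENNReal.rpow_mul, one_div_mul_cancel hp0.ne',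
    ENNReal.rpow_one]
  exact hle

section

variable {p α s : ℝ} {f : Ambient d n → ℂ}
  {G : Ambient d n → EuclideanSpace ℂ (Fin d ⊕ Fin n)}

/-- The terms of the telescoping series of the box averages decay geometrically in `L^p`. -/
lemma lintegral_boxAverage_succ_sub_rpow_le (hn : 1 ≤ n) (hp : 1 ≤ p) (hs : 0 < s)
    (hα : α + n = p * (1 - s)) (hf : LocallyIntegrable f volume) (hG : IsWeakGradient f G)
    (k : ℕ) :
    ∫⁻ x, ‖boxAverage f (k + 1) x - boxAverage f k x‖ₑ ^ p ≤
      (boxConst d n ^ p * singConst d n p s * 2 ^ (-(k : ℝ) * s * p)) * energy p α G := by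
  have hp0 : 0 ≤ p := by linarith
  set C := boxConst d n ^ p * singConst d n p s * 2 ^ ((k : ℝ) * (s / 2 - s * p)) with hC
  have hr0 : (0 : ℝ) < 2 ^ (-(k : ℤ)) / 2 := by positivity
  have hr1 : (2 : ℝ) ^ (-(k : ℤ)) ≤ 1 := by
    rw [zpow_neg]
    exact inv_le_one_of_one_le₀ (one_le_zpow₀ one_le_two (by positivity))
  calc ∫⁻ x, ‖boxAverage f (k + 1) x - boxAverage f k x‖ₑ ^ p
      ≤ ∫⁻ x, C * (2 ^ (((k : ℤ) : ℝ) * d) *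
          localEnergy p α s G (containing (k : ℤ) x).toSet (2 ^ (-(k : ℤ)) / 2)) := by
        refine lintegral_mono fun x => ?_
        have h1 := enorm_boxAverage_succ_sub_le hn hs hf hG (k : ℤ) x
        rw [mul_assoc] at h1
        refine (ENNReal.rpow_le_rpow h1 hp0).trans ?_
        rw [ENNReal.mul_rpow_of_nonneg _ _ hp0]
        have h2 := two_rpow_mul_singIntegral_rpow_le hn hp hs hα hG.1.aestronglyMeasurable
          (containing (k : ℤ) x) (Nat.zero_le 2) (half_pos (containing (k : ℤ) x).edge_pos)
          (by rw [edge_containing]; linarith) (half_le_self (containing (k : ℤ) x).edge_pos.le)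
        rw [enlarge_zero] at h2
        refine (mul_le_mul' le_rfl h2).trans_eq ?_
        rw [edge_containing, level_containing]
        have e : (2 : ℝ≥0∞) ^ (((k : ℤ) : ℝ) * (d + s / 2 - s * p)) =
            2 ^ ((k : ℝ) * (s / 2 - s * p)) * 2 ^ (((k : ℤ) : ℝ) * d) := by
          rw [two_rpow_mul]; congr 1; push_cast; ring
        rw [e, hC]; ring
    _ = C * localEnergy p α s G univ (2 ^ (-(k : ℤ)) / 2) := by
        rw [lintegral_const_mul _ (measurable_comp_containing (fun Q : DyadicCube (Fin d) =>
          2 ^ (((k : ℤ) : ℝ) * d) * localEnergy p α s G Q.toSet (2 ^ (-(k : ℤ)) / 2)) k)]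
        congr 1
        have h := lintegral_fibre_containing (S := (univ : Set (Base d))) (k : ℤ)
          (fun x _ => subset_univ _) {X : Ambient d n | ‖ver X‖ < 2 ^ (-(k : ℤ)) / 2}
          fun X => wt X ^ (α + s / 2) * ‖G X‖ₑ ^ p
        simp only [Measure.restrict_univ] at h
        simp only [localEnergy, slab_eq]
        exact h
    _ ≤ C * (2 ^ (-(k : ℝ) * (s / 2)) * energy p α G) := by
        refine mul_le_mul' le_rfl ?_
        rw [ENNReal.rpow_mul]
        refine localEnergy_le hn hs G MeasurableSet.univ ?_ (two_rpow_ne_top _)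
        refine (ENNReal.ofReal_le_ofReal (half_le_self (by positivity))).trans_eq ?_
        rw [ofReal_two_zpow]; push_cast; rfl
    _ = _ := by
        rw [hC, ← mul_assoc, mul_assoc (boxConst d n ^ p * _), two_rpow_mul]
        congr 3; ring

/-- The box averages of level `0` are bounded in `L^p` by the norm of `f` in `L^p(μ_α)`, by
Jensen's inequality for the density `wt ^ (-(n - s / 2))` again. -/
lemma lintegral_boxAverage_zero_rpow_le (hn : 1 ≤ n) (hp : 1 ≤ p) (hs : 0 < s)
    (hα : α + n = p * (1 - s)) (hf : LocallyIntegrable f volume) :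
    ∫⁻ x, ‖boxAverage f 0 x‖ₑ ^ p ≤
      ((halfBallVol n)⁻¹ ^ p * ballIntegral n s ^ (p - 1)) * energy p α f := by
  have hp0 : 0 ≤ p := by linarith
  set C := (halfBallVol n)⁻¹ ^ p * ballIntegral n s ^ (p - 1) with hC
  calc ∫⁻ x, ‖boxAverage f 0 x‖ₑ ^ p
      ≤ ∫⁻ x, C * (2 ^ (((0 : ℤ) : ℝ) * d) * ∫⁻ X in hor ⁻¹' (containing 0 x).toSet ∩
          {X : Ambient d n | ‖ver X‖ < 1 / 2}, wt X ^ α * ‖f X‖ₑ ^ p) := by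
        refine lintegral_mono fun x => ?_
        set Q := containing (0 : ℤ) x with hQ
        have he : Q.edge = 1 := by rw [hQ, edge_containing]; simp
        have hv : volume (box Q : Set (Ambient d n)) = halfBallVol n := by
          rw [volume_box]; simp [hQ, level_containing]
        have h1 : ‖boxAverage f 0 x‖ₑ ≤ (halfBallVol n)⁻¹ * ∫⁻ X in box Q, ‖f X‖ₑ := by
          have := enorm_average_sub_le (volume_box_ne_zero Q) (volume_box_ne_top (n := n) Q)
            (integrableOn_box hf Q) 0
          rw [hv] at this
          simp only [sub_zero] at this
          exact this
        refine (ENNReal.rpow_le_rpow h1 hp0).trans ?_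
        rw [ENNReal.mul_rpow_of_nonneg _ _ hp0]
        have h2 := rpow_setLIntegral_le_energy hn hp hs hα hf.aestronglyMeasurable (box Q)
        have h3 : ∫⁻ X in (box Q : Set (Ambient d n)), wt X ^ (-((n : ℝ) - s / 2)) ≤
            ballIntegral n s := by
          rw [box, he, lintegral_slab_wt_rpow (measurableSet_toSet Q) _ (by norm_num) (by norm_num),
            volume_toSet, ballIntegral]
          have : ENNReal.ofReal (1 / 2) ^ (-((n : ℝ) - s / 2) + n) ≤ 1 :=
            ENNReal.rpow_le_one (by simp) (by linarith)
          simp only [hQ, level_containing, Int.cast_zero, neg_zero, zero_mul, ENNReal.rpow_zero,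
            one_mul]
          exact mul_le_of_le_one_left' this
        have h4 : (box Q : Set (Ambient d n)) = hor ⁻¹' Q.toSet ∩
          {X : Ambient d n | ‖ver X‖ < 1 / 2} := by rw [box, he, slab_eq]
        rw [h4] at h2 h3
        rw [h4]
        refine (mul_le_mul' le_rfl (h2.trans (mul_le_mul' (ENNReal.rpow_le_rpow h3 (by linarith))
          le_rfl))).trans_eq ?_
        rw [hC]; simp [mul_assoc]
    _ = C * ∫⁻ X in hor ⁻¹' univ ∩ {X : Ambient d n | ‖ver X‖ < 1 / 2},
          wt X ^ α * ‖f X‖ₑ ^ p := by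
        rw [lintegral_const_mul _ (measurable_comp_containing (fun Q : DyadicCube (Fin d) =>
          2 ^ (((0 : ℤ) : ℝ) * d) * ∫⁻ X in hor ⁻¹' Q.toSet ∩
          {X : Ambient d n | ‖ver X‖ < 1 / 2}, wt X ^ α * ‖f X‖ₑ ^ p) 0)]
        congr 1
        have h := lintegral_fibre_containing (S := (univ : Set (Base d))) (0 : ℤ)
          (fun x _ => subset_univ _) {X : Ambient d n | ‖ver X‖ < 1 / 2}
          fun X => wt X ^ α * ‖f X‖ₑ ^ p
        simpa only [Measure.restrict_univ] using h
    _ ≤ C * energy p α f := mul_le_mul' le_rfl (setLIntegral_le_lintegral _ _)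

/-- The constant in the bound of the `L^p` norm of the trace. -/
def traceLpConst (d n : ℕ) (p s : ℝ) : ℝ≥0∞ :=
  ((halfBallVol n)⁻¹ ^ p * ballIntegral n s ^ (p - 1)) ^ (1 / p) +
    (boxConst d n ^ p * singConst d n p s) ^ (1 / p) * geomSum s

lemma traceLpConst_ne_top (hn : 1 ≤ n) (hp : 1 ≤ p) (hs : 0 < s) : traceLpConst d n p s ≠ ⊤ := by
  have hp0 : 0 ≤ 1 / p := by positivity
  refine ENNReal.add_ne_top.2 ⟨ENNReal.rpow_ne_top_of_nonneg hp0 (ENNReal.mul_ne_top ?_ ?_),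
    ENNReal.mul_ne_top (ENNReal.rpow_ne_top_of_nonneg hp0 (ENNReal.mul_ne_top ?_ ?_))
      (geomSum_ne_top hs)⟩
  · exact ENNReal.rpow_ne_top_of_nonneg (by linarith) (ENNReal.inv_ne_top.2 halfBallVol_ne_zero)
  · exact ENNReal.rpow_ne_top_of_nonneg (by linarith) (ballIntegral_ne_top hn hs)
  · exact ENNReal.rpow_ne_top_of_nonneg (by linarith) boxConst_ne_top
  · exact singConst_ne_top hn hp hs

/-- The `L^p` bound of the trace: the box averages are bounded in `L^p` uniformly in the scale. -/
lemma eLpNorm_limit_boxAverage_le (hn : 1 ≤ n) (hp : 1 ≤ p) (hs : 0 < s)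
    (hα : α + n = p * (1 - s)) (hf : LocallyIntegrable f volume) (hG : IsWeakGradient f G)
    {T : Base d → ℂ} (hT : ∀ᵐ x, Tendsto (fun k : ℤ => boxAverage f k x) atTop (𝓝 (T x))) :
    eLpNorm T (ENNReal.ofReal p) volume ≤ traceLpConst d n p s *
      (eLpNorm f (ENNReal.ofReal p) (weightedMeasure d n α) +
        eLpNorm G (ENNReal.ofReal p) (weightedMeasure d n α)) := by
  have hp0 : 0 < p := by linarith
  have hp1 : 1 ≤ ENNReal.ofReal p := by simpa using hp
  set nf := eLpNorm f (ENNReal.ofReal p) (weightedMeasure d n α)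
  set nG := eLpNorm G (ENNReal.ofReal p) (weightedMeasure d n α)
  set A := ((halfBallVol n)⁻¹ ^ p * ballIntegral n s ^ (p - 1)) ^ (1 / p)
  set B := (boxConst d n ^ p * singConst d n p s) ^ (1 / p)
  have hmeas : ∀ k : ℤ, AEStronglyMeasurable (boxAverage f k) volume := fun k =>
    (measurable_boxAverage f k).aestronglyMeasurable
  have h0 : eLpNorm (boxAverage f 0) (ENNReal.ofReal p) volume ≤ A * nf := by
    refine eLpNorm_le_of_lintegral_le hp ?_
    rw [eLpNorm_rpow_eq_energy hn hp]
    exact lintegral_boxAverage_zero_rpow_le hn hp hs hα hf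
  have hstep : ∀ k : ℕ, eLpNorm (boxAverage f (k + 1) - boxAverage f k) (ENNReal.ofReal p) volume ≤
      B * 2 ^ (-(k : ℝ) * s) * nG := by
    intro k
    have e : B * (2 : ℝ≥0∞) ^ (-(k : ℝ) * s) =
        (boxConst d n ^ p * singConst d n p s * 2 ^ (-(k : ℝ) * s * p)) ^ (1 / p) := by
      rw [ENNReal.mul_rpow_of_nonneg _ _ (by positivity : 0 ≤ 1 / p), ← ENNReal.rpow_mul 2]
      congr 2; field_simp
    rw [e]
    refine eLpNorm_le_of_lintegral_le hp ?_
    rw [eLpNorm_rpow_eq_energy hn hp]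
    exact lintegral_boxAverage_succ_sub_rpow_le hn hp hs hα hf hG k
  have hK : ∀ K : ℕ, eLpNorm (boxAverage f K) (ENNReal.ofReal p) volume ≤
      A * nf + ∑ k ∈ Finset.range K, B * 2 ^ (-(k : ℝ) * s) * nG := by
    intro K
    induction K with
    | zero => simpa using h0
    | succ K ih =>
      have e : boxAverage f ((K + 1 : ℕ) : ℤ) =
          boxAverage f K + (boxAverage f (K + 1) - boxAverage f K) := by
        push_cast; abel
      rw [e, Finset.sum_range_succ, ← add_assoc]
      exact (eLpNorm_add_le (hmeas _) ((hmeas _).sub (hmeas _)) hp1).trans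
        (add_le_add ih (hstep K))
  have hK' : ∀ K : ℕ, eLpNorm (boxAverage f K) (ENNReal.ofReal p) volume ≤
      traceLpConst d n p s * (nf + nG) := by
    intro K
    refine (hK K).trans ?_
    calc A * nf + ∑ k ∈ Finset.range K, B * 2 ^ (-(k : ℝ) * s) * nG
        ≤ A * nf + ∑' k : ℕ, B * 2 ^ (-(k : ℝ) * s) * nG := by
          gcongr; exact ENNReal.sum_le_tsum _
      _ = A * nf + B * geomSum s * nG := by
          rw [ENNReal.tsum_mul_right, ENNReal.tsum_mul_left]; rfl
      _ ≤ (A + B * geomSum s) * nf + (A + B * geomSum s) * nG := by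
          gcongr
          · exact le_self_add
          · exact le_add_self
      _ = _ := by rw [← mul_add]; rfl
  -- Fatou's lemma
  refine (Lp.eLpNorm_lim_le_liminf_eLpNorm (f := fun K : ℕ => boxAverage f K)
    (fun K => hmeas K) T ?_).trans ?_
  · filter_upwards [hT] with x hx
    exact hx.comp tendsto_natCast_atTop_atTop
  · exact (liminf_le_liminf (.of_forall hK')).trans_eq (liminf_const _)

lemma aestronglyMeasurable_limit_boxAverage {T : Base d → ℂ}
    (hT : ∀ᵐ x, Tendsto (fun k : ℤ => boxAverage f k x) atTop (𝓝 (T x))) :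
    AEStronglyMeasurable T volume :=
  (aemeasurable_of_tendsto_metrizable_ae (u := atTop) (f := fun k : ℤ => boxAverage f k)
    (fun k => (measurable_boxAverage f k).aemeasurable) hT).aestronglyMeasurable

/-- The constant in the bound of the Besov norm of the trace. -/
def traceConst (d n : ℕ) (p s : ℝ) : ℝ≥0∞ :=
  traceLpConst d n p s + (neighborBound (Fin d) * neighborConst d n s ^ p * singConst d n p s *
    5 ^ d * geomSum (s / 2)) ^ (1 / p)

lemma traceConst_ne_top (hn : 1 ≤ n) (hp : 1 ≤ p) (hs : 0 < s) : traceConst d n p s ≠ ⊤ := by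
  refine ENNReal.add_ne_top.2 ⟨traceLpConst_ne_top hn hp hs,
    ENNReal.rpow_ne_top_of_nonneg (by positivity) (ENNReal.mul_ne_top (ENNReal.mul_ne_top
      (ENNReal.mul_ne_top (ENNReal.mul_ne_top (by simp) ?_) (singConst_ne_top hn hp hs)) (by simp))
      (geomSum_ne_top (by linarith)))⟩
  exact ENNReal.rpow_ne_top_of_nonneg (by linarith) (neighborConst_ne_top hs)

lemma locallyIntegrable_limit_boxAverage (hn : 1 ≤ n) (hp : 1 ≤ p) (hs : 0 < s)
    (hα : α + n = p * (1 - s)) (hf : LocallyIntegrable f volume) (hG : IsWeakGradient f G)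
    (hfp : eLpNorm f (ENNReal.ofReal p) (weightedMeasure d n α) ≠ ⊤)
    (hGp : eLpNorm G (ENNReal.ofReal p) (weightedMeasure d n α) ≠ ⊤)
    {T : Base d → ℂ} (hT : ∀ᵐ x, Tendsto (fun k : ℤ => boxAverage f k x) atTop (𝓝 (T x))) :
    LocallyIntegrable T volume := by
  refine MemLp.locallyIntegrable (p := ENNReal.ofReal p)
    ⟨aestronglyMeasurable_limit_boxAverage hT, ?_⟩ (by simpa using hp)
  exact lt_of_le_of_lt (eLpNorm_limit_boxAverage_le hn hp hs hα hf hG hT)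
    (ENNReal.mul_lt_top (traceLpConst_ne_top hn hp hs).lt_top
      (ENNReal.add_lt_top.2 ⟨hfp.lt_top, hGp.lt_top⟩))

lemma besovNorm_limit_boxAverage_le (hn : 1 ≤ n) (hp : 1 ≤ p) (hs : 0 < s) (hs1 : s ≤ 1)
    (hα : α + n = p * (1 - s)) (hf : LocallyIntegrable f volume) (hG : IsWeakGradient f G)
    (hfp : eLpNorm f (ENNReal.ofReal p) (weightedMeasure d n α) ≠ ⊤)
    (hGp : eLpNorm G (ENNReal.ofReal p) (weightedMeasure d n α) ≠ ⊤)
    {T : Base d → ℂ} (hT : ∀ᵐ x, Tendsto (fun k : ℤ => boxAverage f k x) atTop (𝓝 (T x))) :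
    besovNorm s p p volume T ≤ traceConst d n p s *
      (eLpNorm f (ENNReal.ofReal p) (weightedMeasure d n α) +
        eLpNorm G (ENNReal.ofReal p) (weightedMeasure d n α)) := by
  have hp0 : 0 < p := by linarith
  have hTi := locallyIntegrable_limit_boxAverage hn hp hs hα hf hG hfp hGp hT
  have h1 := tsum_besov_limit_le hn hp hs hs1 hα hf hG hT hTi
  have h2 := ENNReal.rpow_le_rpow h1 (by positivity : 0 ≤ 1 / p)
  rw [besovNorm, div_self hp0.ne']
  simp only [ENNReal.rpow_one]
  rw [traceConst, add_mul]
  refine add_le_add (eLpNorm_limit_boxAverage_le hn hp hs hα hf hG hT) (h2.trans ?_)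
  rw [ENNReal.mul_rpow_of_nonneg _ _ (by positivity), ← eLpNorm_rpow_eq_energy hn hp,
    ← ENNReal.rpow_mul, mul_one_div_cancel hp0.ne', ENNReal.rpow_one]
  exact mul_le_mul' le_rfl le_add_self

end

end TraceLp

/-! ### The trace as a limit of averages over balls -/

section TraceLimit

open DyadicCube

variable {d n : ℕ}

section Slab

variable {s : ℝ} {f : Ambient d n → ℂ} {G : Ambient d n → EuclideanSpace ℂ (Fin d ⊕ Fin n)}
  {T : Base d → ℂ}

/-- The constant in the comparison of a function with its trace on boxes. -/
def slabConst (d n : ℕ) (s : ℝ) : ℝ≥0∞ :=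
  poincareConst d n + halfBallVol n * (boxConst d n * geomSum (s / 2))

lemma slabConst_ne_top (hs : 0 < s) : slabConst d n s ≠ ⊤ :=
  ENNReal.add_ne_top.2 ⟨poincareConst_ne_top, ENNReal.mul_ne_top halfBallVol_ne_top
    (ENNReal.mul_ne_top boxConst_ne_top (geomSum_ne_top (by linarith)))⟩

lemma lintegral_box_sub_limit_le (hn : 1 ≤ n) (hs : 0 < s)
    (hf : LocallyIntegrable f volume) (hG : IsWeakGradient f G)
    (hT : ∀ᵐ x, Tendsto (fun k : ℤ => boxAverage f k x) atTop (𝓝 (T x))) (hTm : Measurable T)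
    (Q : DyadicCube (Fin d)) :
    ∫⁻ X in box Q, ‖f X - T (hor X)‖ₑ ≤ slabConst d n s *
      2 ^ (-(Q.level : ℝ) * (n + s / 2)) * singIntegral s G Q.toSet (Q.edge / 2) := by
  have hm : Measurable fun X : Ambient d n => ‖boxAverage f Q.level (hor X) - T (hor X)‖ₑ :=
    (((measurable_boxAverage f _).comp measurable_hor).sub (hTm.comp measurable_hor)).enorm
  calc ∫⁻ X in box Q, ‖f X - T (hor X)‖ₑ
      ≤ ∫⁻ X in box Q, (‖f X - ⨍ Y in box Q, f Y‖ₑ +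
          ‖boxAverage f Q.level (hor X) - T (hor X)‖ₑ) := by
        refine setLIntegral_mono' (measurableSet_box Q) fun X hX => ?_
        rw [boxAverage_eq hX.1]
        refine le_trans (le_of_eq ?_) (enorm_add_le _ _)
        congr 1; ring
    _ = (∫⁻ X in box Q, ‖f X - ⨍ Y in box Q, f Y‖ₑ) +
          2 ^ (-(Q.level : ℝ) * n) * halfBallVol n *
            ∫⁻ x in Q.toSet, ‖boxAverage f Q.level x - T x‖ₑ := by
        rw [lintegral_add_right _ hm, ← volume_ball_edge, box,
          lintegral_slab (measurableSet_toSet Q) _ _ hm.aemeasurable]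
        congr 1
        simp only [hor_join, setLIntegral_const]
        rw [lintegral_mul_const' _ _ measure_ball_lt_top.ne, mul_comm]
    _ ≤ poincareConst d n * 2 ^ (-(Q.level : ℝ) * (n + s / 2)) *
          singIntegral s G Q.toSet (Q.edge / 2) +
        2 ^ (-(Q.level : ℝ) * n) * halfBallVol n * (boxConst d n * geomSum (s / 2) *
          2 ^ (-(Q.level : ℝ) * (s / 2)) * singIntegral s G Q.toSet (2 ^ (-Q.level) / 2)) :=
        add_le_add (lintegral_box_sub_average_le hn hs hf hG Q)
          (mul_le_mul' le_rfl (lintegral_boxAverage_sub_limit_le hn hs hf hG hT le_rfl))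
    _ = _ := by
        have e : (2 : ℝ≥0∞) ^ (-(Q.level : ℝ) * (n + s / 2)) =
            2 ^ (-(Q.level : ℝ) * n) * 2 ^ (-(Q.level : ℝ) * (s / 2)) := by
          rw [two_rpow_mul]; congr 1; ring
        rw [e, slabConst, edge]
        ring

/-- A weakly differentiable function is close to its trace on thin slabs: in comparison with the
volume of the slab, the integral of the difference has the additional decay `2 ^ (-k s / 2)`. -/
lemma lintegral_slab_sub_limit_le (hn : 1 ≤ n) (hs : 0 < s)
    (hf : LocallyIntegrable f volume) (hG : IsWeakGradient f G)
    (hT : ∀ᵐ x, Tendsto (fun k : ℤ => boxAverage f k x) atTop (𝓝 (T x))) (hTm : Measurable T)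
    {Q : DyadicCube (Fin d)} {k : ℤ} (hk : Q.level ≤ k) :
    ∫⁻ X in slab Q.toSet (2 ^ (-k) / 2), ‖f X - T (hor X)‖ₑ ≤ slabConst d n s *
      2 ^ (-(k : ℝ) * (n + s / 2)) * singIntegral s G Q.toSet (2 ^ (-k) / 2) := by
  have hsat : ∀ x ∈ Q.toSet, (containing k x).toSet ⊆ Q.toSet := fun x hx => toSet_saturated hk hx
  rw [slab_eq, ← lintegral_fibre_containing k hsat]
  calc _ ≤ ∫⁻ x in Q.toSet, slabConst d n s * 2 ^ (-(k : ℝ) * (n + s / 2)) *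
        (2 ^ ((k : ℝ) * d) * singIntegral s G (containing k x).toSet (2 ^ (-k) / 2)) := by
        refine lintegral_mono fun x => ?_
        have h := lintegral_box_sub_limit_le hn hs hf hG hT hTm (containing k x)
        rw [box, edge_containing, level_containing, slab_eq] at h
        refine (mul_le_mul' le_rfl h).trans_eq (by ring)
    _ = _ := by
        rw [lintegral_const_mul _ (measurable_comp_containing (fun Q : DyadicCube (Fin d) =>
          2 ^ ((k : ℝ) * d) * singIntegral s G Q.toSet (2 ^ (-k) / 2)) k)]
        congr 1
        exact lintegral_fibre_containing k hsat _ _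

end Slab

/-- A power of the weight is dominated by a sum over dyadic layers. -/
lemma wt_rpow_le_tsum (α : ℝ) (k : ℕ) {X : Ambient d n} (h0 : ver X ≠ 0)
    (hX : ‖ver X‖ < 2 ^ (-(k : ℤ)) / 2) :
    wt X ^ α ≤ 4 ^ |α| * ∑' j : ℕ, 2 ^ (-((k : ℝ) + j) * α) *
      (slab univ (2 ^ (-((k + j : ℕ) : ℤ)) / 2)).indicator 1 X := by
  obtain ⟨m, hm1, hm2⟩ := exists_mem_Ico_zpow (norm_pos_iff.2 h0) one_lt_two
  have hmk : m < -(k : ℤ) - 1 := by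
    have : (2 : ℝ) ^ m < 2 ^ (-(k : ℤ) - 1) := by
      rw [zpow_sub_one₀ two_ne_zero, ← div_eq_mul_inv]
      exact hm1.trans_lt hX
    exact (zpow_lt_zpow_iff_right₀ one_lt_two).1 this
  obtain ⟨j, hj⟩ : ∃ j : ℕ, (j : ℤ) = -m - 2 - k := ⟨(-m - 2 - k).toNat, by omega⟩
  have hmem : X ∈ (slab univ (2 ^ (-((k + j : ℕ) : ℤ)) / 2) : Set (Ambient d n)) := by
    refine ⟨mem_univ _, hm2.trans_le (le_of_eq ?_)⟩
    have : -((k + j : ℕ) : ℤ) = m + 1 + 1 := by push_cast; omega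
    rw [this, zpow_add_one₀ two_ne_zero (m + 1)]
    simp
  refine le_trans ?_ (mul_le_mul' le_rfl (ENNReal.le_tsum j))
  rw [indicator_of_mem hmem, Pi.one_apply, mul_one]
  have hle : (2 : ℝ≥0∞) ^ (m : ℝ) ≤ wt X := by
    refine le_min ?_ ?_
    · rw [← ENNReal.rpow_zero (x := 2)]
      refine two_rpow_le ?_
      have : m ≤ 0 := by omega
      exact_mod_cast this
    · rw [← ofReal_two_zpow, ← ofReal_norm]
      exact ENNReal.ofReal_le_ofReal hm1
  have hge : wt X ≤ (2 : ℝ≥0∞) ^ ((m : ℝ) + 2) := by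
    refine (min_le_right _ _).trans ?_
    have : (m : ℝ) + 2 = ((m + 2 : ℤ) : ℝ) := by push_cast; ring
    rw [this, ← ofReal_two_zpow, ← ofReal_norm]
    refine ENNReal.ofReal_le_ofReal (hm2.le.trans ?_)
    exact zpow_le_zpow_right₀ one_le_two (by omega)
  have hmj : -((k : ℝ) + j) = m + 2 := by
    have : ((j : ℤ) : ℝ) = ((-m - 2 - k : ℤ) : ℝ) := by rw [hj]
    push_cast at this
    linarith
  rw [hmj]
  rcases le_total 0 α with h | h
  · calc wt X ^ α ≤ (2 ^ ((m : ℝ) + 2)) ^ α := ENNReal.rpow_le_rpow hge h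
      _ = 1 * 2 ^ (((m : ℝ) + 2) * α) := by rw [one_mul, ENNReal.rpow_mul]
      _ ≤ _ := by
        gcongr
        calc (1 : ℝ≥0∞) = 4 ^ (0 : ℝ) := ENNReal.rpow_zero.symm
          _ ≤ 4 ^ |α| := ENNReal.rpow_le_rpow_of_exponent_le (by norm_num) (abs_nonneg _)
  · have h4 : (4 : ℝ≥0∞) = 2 ^ (2 : ℝ) := by norm_num
    rw [h4, ← ENNReal.rpow_mul, two_rpow_mul, abs_of_nonpos h]
    calc wt X ^ α = (wt X ^ (-α))⁻¹ := by rw [← ENNReal.rpow_neg, neg_neg]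
      _ ≤ ((2 ^ (m : ℝ)) ^ (-α))⁻¹ :=
        ENNReal.inv_le_inv.2 (ENNReal.rpow_le_rpow hle (by linarith))
      _ = 2 ^ (2 * -α + ((m : ℝ) + 2) * α) := by
        rw [← ENNReal.rpow_mul, two_rpow_inv]; congr 1; ring

/-- Integrals with weight are controlled by unweighted ones that decay like a power. -/
lemma lintegral_slab_wt_le (hn : 1 ≤ n) {α a : ℝ} {S : Set (Base d)}
    (hS : MeasurableSet S) {h : Ambient d n → ℝ≥0∞} (hh : AEMeasurable h volume) {A : ℝ≥0∞}
    (hA : ∀ k : ℕ, ∫⁻ X in slab S (2 ^ (-(k : ℤ)) / 2), h X ≤ A * 2 ^ (-(k : ℝ) * a)) (k : ℕ) :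
    ∫⁻ X in slab S (2 ^ (-(k : ℤ)) / 2), wt X ^ α * h X ≤
      4 ^ |α| * A * geomSum (α + a) * 2 ^ (-(k : ℝ) * (α + a)) := by
  set U : ℕ → Set (Ambient d n) := fun j => slab univ (2 ^ (-((k + j : ℕ) : ℤ)) / 2)
  have hU : ∀ j, MeasurableSet (U j) := fun j => measurableSet_slab MeasurableSet.univ _
  calc ∫⁻ X in slab S (2 ^ (-(k : ℤ)) / 2), wt X ^ α * h X
      ≤ ∫⁻ X in slab S (2 ^ (-(k : ℤ)) / 2), 4 ^ |α| * ∑' j : ℕ, 2 ^ (-((k : ℝ) + j) * α) *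
          (U j).indicator h X := by
        refine setLIntegral_mono_ae' (measurableSet_slab hS _) ?_
        filter_upwards [ae_ver_ne_zero (d := d) hn] with X hX hXS
        refine (mul_le_mul' (wt_rpow_le_tsum α k hX hXS.2) le_rfl).trans_eq ?_
        rw [mul_assoc, ← ENNReal.tsum_mul_right]
        congr 2 with j
        rw [mul_assoc]
        congr 1
        by_cases hm : X ∈ U j
        · rw [indicator_of_mem hm, indicator_of_mem hm]; simp
        · rw [indicator_of_notMem hm, indicator_of_notMem hm]; simp
    _ = 4 ^ |α| * ∑' j : ℕ, 2 ^ (-((k : ℝ) + j) * α) *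
          ∫⁻ X in slab S (2 ^ (-((k + j : ℕ) : ℤ)) / 2), h X := by
        rw [lintegral_const_mul' _ _ (ENNReal.rpow_ne_top_of_nonneg (abs_nonneg _) (by simp)),
          lintegral_tsum fun j => ((hh.indicator (hU j)).const_mul _).restrict]
        congr 2 with j
        rw [lintegral_const_mul' _ _ (two_rpow_ne_top _), lintegral_indicator (hU j),
          Measure.restrict_restrict (hU j)]
        congr 3
        ext X
        have hle : (2 : ℝ) ^ (-((k + j : ℕ) : ℤ)) ≤ 2 ^ (-(k : ℤ)) :=
          zpow_le_zpow_right₀ one_le_two (by push_cast; omega)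
        constructor
        · exact fun h => ⟨h.2.1, h.1.2⟩
        · exact fun h => ⟨⟨mem_univ _, h.2⟩, h.1, h.2.trans_le (by linarith)⟩
    _ ≤ 4 ^ |α| * ∑' j : ℕ, A * 2 ^ (-((k : ℝ) + j) * (α + a)) := by
        refine mul_le_mul' le_rfl (ENNReal.tsum_le_tsum fun j => ?_)
        refine (mul_le_mul' le_rfl (hA (k + j))).trans_eq ?_
        rw [mul_left_comm, two_rpow_mul]
        congr 2; push_cast; ring
    _ = _ := by
        rw [ENNReal.tsum_mul_left, tsum_two_rpow_add]; ring

/-- Tonelli's theorem for integrals over moving balls. -/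
lemma lintegral_lintegral_slab_ball_le {H : Ambient d n → ℝ≥0∞} (hH : Measurable H)
    (Q : DyadicCube (Fin d)) {r : ℝ} (hr : r ≤ Q.edge) :
    ∫⁻ x in Q.toSet, ∫⁻ X in slab (Metric.ball x r) r, H X ≤
      volume (Metric.ball (0 : Base d) r) * ∫⁻ X in slab (Q.enlarge 2) r, H X := by
  have hms : MeasurableSet {q : Base d × Ambient d n | q.2 ∈ slab (Metric.ball q.1 r) r} :=
    (measurableSet_lt ((measurable_hor.comp measurable_snd).dist measurable_fst)
      measurable_const).inter
      (measurableSet_lt (measurable_ver.comp measurable_snd).norm measurable_const)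
  have hsub : ∀ x ∈ Q.toSet, Metric.ball x r ⊆ Q.enlarge 2 := by
    intro x hx y hy i
    have h1 : |y i - x i| < r := by
      have h2 := PiLp.norm_apply_le (y - x) i
      rw [PiLp.sub_apply, Real.norm_eq_abs] at h2
      exact h2.trans_lt (by rwa [← dist_eq_norm])
    rw [abs_lt] at h1
    obtain ⟨h3, h4⟩ := hx i
    have := Q.edge_pos
    push_cast
    constructor <;> nlinarith
  calc ∫⁻ x in Q.toSet, ∫⁻ X in slab (Metric.ball x r) r, H X
      = ∫⁻ x in Q.toSet, ∫⁻ X, {q : Base d × Ambient d n |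
          q.2 ∈ slab (Metric.ball q.1 r) r}.indicator (fun q => H q.2) (x, X) := by
        congr 1 with x
        rw [← lintegral_indicator (measurableSet_slab Metric.isOpen_ball.measurableSet r)]
        rfl
    _ = ∫⁻ X, ∫⁻ x in Q.toSet, {q : Base d × Ambient d n |
          q.2 ∈ slab (Metric.ball q.1 r) r}.indicator (fun q => H q.2) (x, X) := by
        rw [lintegral_lintegral_swap]
        exact ((hH.comp measurable_snd).indicator hms).aemeasurable
    _ ≤ ∫⁻ X, (slab (Q.enlarge 2) r).indicator
          (fun X => volume (Metric.ball (0 : Base d) r) * H X) X := by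
        refine lintegral_mono fun X => ?_
        by_cases hX : X ∈ slab (Q.enlarge 2) r
        · rw [indicator_of_mem hX]
          calc _ ≤ ∫⁻ x, (Metric.ball (hor X) r).indicator (fun _ => H X) x := by
                refine (setLIntegral_le_lintegral _ _).trans (lintegral_mono fun x => ?_)
                by_cases hx : X ∈ slab (Metric.ball x r) r
                · have h1 : dist (hor X) x < r := hx.1
                  have h2 : x ∈ Metric.ball (hor X) r := by rwa [Metric.mem_ball, dist_comm]
                  rw [indicator_of_mem h2]
                  exact indicator_le_self _ (fun q : Base d × Ambient d n => H q.2) (x, X)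
                · rw [indicator_of_notMem (show (x, X) ∉ _ from hx)]
                  exact zero_le
            _ = _ := by
                rw [lintegral_indicator_const Metric.isOpen_ball.measurableSet,
                  Measure.addHaar_ball_center, mul_comm]
        · rw [indicator_of_notMem hX, nonpos_iff_eq_zero,
            ← lintegral_zero (μ := volume.restrict Q.toSet)]
          refine setLIntegral_congr_fun (measurableSet_toSet Q) fun x hx => ?_
          refine indicator_of_notMem (fun h => hX ?_) _
          exact ⟨hsub x hx h.1, h.2⟩
    _ = _ := by
        rw [lintegral_indicator (measurableSet_slab (Q.measurableSet_enlarge 2) r),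
          lintegral_const_mul _ hH]

/-- If the integrals of `H` over thin slabs decay faster than the power `e` of the width, then at
almost every point those over small balls are `o(r ^ (d + e))`: the rescaled integrals over
the balls, integrated over the centre, are summable over the dyadic radii. -/
lemma ae_tendsto_slab_ball {H : Ambient d n → ℝ≥0∞} (hH : AEMeasurable H volume)
    {Q : DyadicCube (Fin d)} (hQ : Q.level = 0) {e ε : ℝ} (hε : 0 < ε) {A : ℝ≥0∞} (hA : A ≠ ⊤)
    (h : ∀ k : ℕ, ∫⁻ X in slab (Q.enlarge 2) (2 ^ (-(k : ℤ)) / 2), H X ≤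
      A * 2 ^ (-(k : ℝ) * (e + ε))) :
    ∀ᵐ x ∂(volume.restrict Q.toSet), Tendsto (fun k : ℕ => 2 ^ ((k : ℝ) * (d + e)) *
      ∫⁻ X in slab (Metric.ball x (2 ^ (-(k : ℤ)) / 2)) (2 ^ (-(k : ℤ)) / 2), H X)
      atTop (𝓝 0) := by
  obtain ⟨H', hH', hHH'⟩ : ∃ H', Measurable H' ∧ H =ᵐ[volume] H' :=
    ⟨_, hH.measurable_mk, hH.ae_eq_mk⟩
  have hcongr : ∀ A : Set (Ambient d n), ∫⁻ X in A, H X = ∫⁻ X in A, H' X := fun A =>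
    lintegral_congr_ae (ae_restrict_of_ae hHH')
  simp_rw [hcongr] at h ⊢
  have hm : ∀ r : ℝ, Measurable fun x : Base d => ∫⁻ X in slab (Metric.ball x r) r, H' X := by
    intro r
    have hms : MeasurableSet {q : Base d × Ambient d n | q.2 ∈ slab (Metric.ball q.1 r) r} :=
      (measurableSet_lt ((measurable_hor.comp measurable_snd).dist measurable_fst)
        measurable_const).inter
        (measurableSet_lt (measurable_ver.comp measurable_snd).norm measurable_const)
    have := ((hH'.comp measurable_snd).indicator hms).lintegral_prod_right' (ν := volume)
    refine Eq.mp (congrArg Measurable (funext fun x => ?_)) this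
    rw [← lintegral_indicator (measurableSet_slab Metric.isOpen_ball.measurableSet r)]
    rfl
  have hedge : Q.edge = 1 := by simp [edge, hQ]
  have hb : ∀ k : ℕ, ∫⁻ x in Q.toSet, 2 ^ ((k : ℝ) * (d + e)) *
      ∫⁻ X in slab (Metric.ball x (2 ^ (-(k : ℤ)) / 2)) (2 ^ (-(k : ℤ)) / 2), H' X ≤
      halfBallVol d * A * 2 ^ (-(k : ℝ) * ε) := by
    intro k
    have hr1 : (2 : ℝ) ^ (-(k : ℤ)) ≤ 1 := by
      rw [zpow_neg]
      exact inv_le_one_of_one_le₀ (one_le_zpow₀ one_le_two (by positivity))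
    have hr0 : (0 : ℝ) < 2 ^ (-(k : ℤ)) := by positivity
    rw [lintegral_const_mul _ (hm _)]
    have h1 := lintegral_lintegral_slab_ball_le hH' Q (r := 2 ^ (-(k : ℤ)) / 2)
      (by rw [hedge]; linarith)
    have h2 : volume (Metric.ball (0 : Base d) (2 ^ (-(k : ℤ)) / 2)) =
        2 ^ (-(k : ℝ) * d) * halfBallVol d := by
      have := volume_ball_edge (n := d) (⟨k, 0⟩ : DyadicCube (Fin d))
      simpa [edge] using this
    rw [h2] at h1
    refine (mul_le_mul' le_rfl (h1.trans (mul_le_mul' le_rfl (h k)))).trans_eq ?_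
    have e1 : (2 : ℝ≥0∞) ^ (-(k : ℝ) * ε) = 2 ^ ((k : ℝ) * (d + e)) * 2 ^ (-(k : ℝ) * d) *
        2 ^ (-(k : ℝ) * (e + ε)) := by
      rw [two_rpow_mul, two_rpow_mul]; congr 1; ring
    rw [e1]; ring
  have hsum : ∫⁻ x in Q.toSet, ∑' k : ℕ, 2 ^ ((k : ℝ) * (d + e)) *
      ∫⁻ X in slab (Metric.ball x (2 ^ (-(k : ℤ)) / 2)) (2 ^ (-(k : ℤ)) / 2), H' X ≠ ⊤ := by
    rw [lintegral_tsum fun k => ((hm _).const_mul _).aemeasurable]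
    refine ne_top_of_le_ne_top ?_ (ENNReal.tsum_le_tsum hb)
    rw [ENNReal.tsum_mul_left]
    exact ENNReal.mul_ne_top (ENNReal.mul_ne_top halfBallVol_ne_top hA) (geomSum_ne_top hε)
  filter_upwards [ae_lt_top (Measurable.tsum fun k => (hm _).const_mul _) hsum] with x hx
  exact ENNReal.tendsto_atTop_zero_of_tsum_ne_top hx.ne

end TraceLimit

section TraceExists

open DyadicCube

variable {d n : ℕ}

/-- Passage from dyadic radii to all radii. -/
lemma tendsto_of_tendsto_dyadic {Φ : ℝ → ℝ≥0∞} (hΦ : Monotone Φ) {e : ℝ} (he : 0 ≤ e)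
    (h : Tendsto (fun k : ℕ => 2 ^ ((k : ℝ) * e) * Φ (2 ^ (-(k : ℤ)) / 2)) atTop (𝓝 0)) :
    Tendsto (fun r => ENNReal.ofReal r ^ (-e) * Φ r) (𝓝[>] 0) (𝓝 0) := by
  rw [ENNReal.tendsto_nhds_zero] at h ⊢
  intro ε hε
  have h4 : (2 : ℝ≥0∞) ^ (2 * e) ≠ ⊤ := two_rpow_ne_top _
  obtain ⟨K, hK⟩ := eventually_atTop.1 (h (ε / 2 ^ (2 * e)) (ENNReal.div_pos hε.ne' h4))
  filter_upwards [Ioo_mem_nhdsGT (show (0 : ℝ) < 2 ^ (-(K : ℤ)) / 2 by positivity)] with r hr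
  obtain ⟨m, hm1, hm2⟩ := exists_mem_Ico_zpow hr.1 one_lt_two
  have hmk : m < -(K : ℤ) - 1 := by
    have : (2 : ℝ) ^ m < 2 ^ (-(K : ℤ) - 1) := by
      rw [zpow_sub_one₀ two_ne_zero, ← div_eq_mul_inv]
      exact hm1.trans_lt hr.2
    exact (zpow_lt_zpow_iff_right₀ one_lt_two).1 this
  obtain ⟨k, hk⟩ : ∃ k : ℕ, (k : ℤ) = -m - 2 := ⟨(-m - 2).toNat, by omega⟩
  have hrk : r ≤ 2 ^ (-(k : ℤ)) / 2 := by
    refine hm2.le.trans (le_of_eq ?_)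
    have : -(k : ℤ) = m + 1 + 1 := by omega
    rw [this, zpow_add_one₀ two_ne_zero (m + 1)]
    simp
  have hr2 : ENNReal.ofReal r ^ (-e) ≤ 2 ^ (2 * e) * 2 ^ ((k : ℝ) * e) := by
    rw [two_rpow_mul, ENNReal.rpow_neg]
    have hkm : (m : ℝ) = -((k : ℝ) + 2) := by
      have : ((k : ℤ) : ℝ) = ((-m - 2 : ℤ) : ℝ) := by rw [hk]
      push_cast at this
      linarith
    calc (ENNReal.ofReal r ^ e)⁻¹ ≤ ((2 ^ (m : ℝ)) ^ e)⁻¹ := by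
          refine ENNReal.inv_le_inv.2 (ENNReal.rpow_le_rpow ?_ he)
          rw [← ofReal_two_zpow]
          exact ENNReal.ofReal_le_ofReal hm1
      _ = _ := by
          rw [← ENNReal.rpow_mul, two_rpow_inv, hkm]; congr 1; ring
  calc ENNReal.ofReal r ^ (-e) * Φ r
      ≤ (2 ^ (2 * e) * 2 ^ ((k : ℝ) * e)) * Φ (2 ^ (-(k : ℤ)) / 2) := mul_le_mul' hr2 (hΦ hrk)
    _ = 2 ^ (2 * e) * (2 ^ ((k : ℝ) * e) * Φ (2 ^ (-(k : ℤ)) / 2)) := mul_assoc _ _ _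
    _ ≤ 2 ^ (2 * e) * (ε / 2 ^ (2 * e)) := mul_le_mul' le_rfl (hK k (by omega))
    _ = ε := ENNReal.mul_div_cancel (two_rpow_ne_zero _) h4

lemma setLIntegral_weightedMeasure (hn : 1 ≤ n) (α : ℝ) {A : Set (Ambient d n)}
    (hA : MeasurableSet A) (h : Ambient d n → ℝ≥0∞) :
    ∫⁻ X in A, h X ∂(weightedMeasure d n α) = ∫⁻ X in A, wt X ^ α * h X := by
  rw [← lintegral_indicator hA, lintegral_weightedMeasure hn, ← lintegral_indicator hA]
  congr 1 with X
  by_cases hX : X ∈ A <;> simp [hX]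

/-- The integral of `‖y‖^α` over the unit ball of `ℝ^n`. -/
def ballWeight (n : ℕ) (α : ℝ) : ℝ≥0∞ :=
  ∫⁻ y in Metric.ball (0 : EuclideanSpace ℝ (Fin n)) 1, ‖y‖ₑ ^ α

lemma ballWeight_ne_top (hn : 1 ≤ n) {α : ℝ} (hα : -(n : ℝ) < α) : ballWeight n α ≠ ⊤ :=
  (lintegral_ball_one_rpow_lt_top hn hα).ne

lemma ballWeight_ne_zero (hn : 1 ≤ n) (α : ℝ) : ballWeight n α ≠ 0 := by
  have : Nonempty (Fin n) := ⟨⟨0, hn⟩⟩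
  intro h
  rw [ballWeight, lintegral_eq_zero_iff (by fun_prop)] at h
  have h0 : ∀ᵐ y : EuclideanSpace ℝ (Fin n), y ≠ 0 :=
    measure_eq_zero_iff_ae_notMem.1 (measure_singleton (0 : EuclideanSpace ℝ (Fin n)))
  have h1 : ∀ᵐ y ∂(volume.restrict (Metric.ball (0 : EuclideanSpace ℝ (Fin n)) 1)), False := by
    filter_upwards [h, ae_restrict_of_ae h0] with y hy hy0
    simp [ENNReal.rpow_eq_zero_iff, hy0] at hy
  rw [eventually_false_iff_eq_bot, ae_eq_bot, Measure.restrict_eq_zero] at h1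
  exact (Metric.measure_ball_pos volume (0 : EuclideanSpace ℝ (Fin n)) one_pos).ne' h1

lemma weightedMeasure_slab (hn : 1 ≤ n) (α : ℝ) {S : Set (Base d)} (hS : MeasurableSet S) {r : ℝ}
    (hr : 0 < r) (hr1 : r ≤ 1) : weightedMeasure d n α (slab S r) =
      volume S * (ENNReal.ofReal r ^ (α + n) * ballWeight n α) := by
  rw [← setLIntegral_one, setLIntegral_weightedMeasure hn α (measurableSet_slab hS r)]
  simp only [mul_one]
  exact lintegral_slab_wt_rpow hS α hr hr1

lemma ball_embedBase_subset (x : Base d) (r : ℝ) :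
    Metric.ball (embedBase n x) r ⊆ slab (Metric.ball x r) r := by
  intro X hX
  rw [Metric.mem_ball, dist_eq_norm] at hX
  have h1 := norm_hor_le (X - embedBase n x)
  have h2 := norm_ver_le (X - embedBase n x)
  rw [hor_sub, embedBase_eq_join, hor_join] at h1
  rw [ver_sub, embedBase_eq_join, ver_join, sub_zero] at h2
  rw [embedBase_eq_join] at hX
  refine ⟨?_, h2.trans_lt hX⟩
  rw [Metric.mem_ball, dist_eq_norm]
  exact h1.trans_lt hX

lemma slab_subset_ball_embedBase (x : Base d) (r : ℝ) :
    slab (Metric.ball x (r / 2)) (r / 2) ⊆ Metric.ball (embedBase n x) r := by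
  rintro X ⟨h1, h2⟩
  rw [Metric.mem_ball, dist_eq_norm] at h1
  rw [Metric.mem_ball, dist_eq_norm]
  refine (norm_le_hor_add_ver _).trans_lt ?_
  rw [hor_sub, ver_sub, embedBase_eq_join, hor_join, ver_join, sub_zero]
  linarith

lemma volume_ball_rpow (x : Base d) {r : ℝ} (hr : 0 < r) : volume (Metric.ball x r) =
    ENNReal.ofReal r ^ (d : ℝ) * volume (Metric.ball (0 : Base d) 1) := by
  rw [Measure.addHaar_ball_of_pos _ _ hr, finrank_euclideanSpace_fin, ENNReal.ofReal_pow hr.le,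
    ENNReal.rpow_natCast]

/-- Lower bound of the measure `μ_α` of balls centred on the subspace. -/
lemma le_weightedMeasure_ball (hn : 1 ≤ n) (α : ℝ) (x : Base d) {r : ℝ} (hr : 0 < r)
    (hr1 : r ≤ 1) : ENNReal.ofReal (r / 2) ^ (d + (α + n)) *
      (volume (Metric.ball (0 : Base d) 1) * ballWeight n α) ≤
        weightedMeasure d n α (Metric.ball (embedBase n x) r) := by
  refine le_trans (le_of_eq ?_) (measure_mono (slab_subset_ball_embedBase x r))
  rw [weightedMeasure_slab hn α Metric.isOpen_ball.measurableSet (by linarith) (by linarith),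
    volume_ball_rpow x (by linarith), ENNReal.rpow_add _ _ (by simpa using hr) (by simp)]
  ring

/-- A criterion for the existence of the trace at a point. -/
lemma hasTraceAt_of_tendsto (hn : 1 ≤ n) {α : ℝ} (hα : -(n : ℝ) < α)
    {f : Ambient d n → ℂ} {x : Base d} {c : ℂ}
    (hf : ∀ᶠ r in 𝓝[>] (0 : ℝ),
      IntegrableOn f (Metric.ball (embedBase n x) r) (weightedMeasure d n α))
    (h : Tendsto (fun r : ℝ => ENNReal.ofReal r ^ (-(d + (α + n))) *
      ∫⁻ X in slab (Metric.ball x r) r, wt X ^ α * ‖f X - c‖ₑ) (𝓝[>] 0) (𝓝 0)) :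
    HasTraceAt (weightedMeasure d n α) f x c := by
  refine ⟨hf, tendsto_iff_edist_tendsto_0.2 ?_⟩
  set V := volume (Metric.ball (0 : Base d) 1) * ballWeight n α with hV
  have hV0 : V ≠ 0 :=
    mul_ne_zero (Metric.measure_ball_pos _ _ one_pos).ne' (ballWeight_ne_zero hn α)
  have hVt : V ≠ ⊤ := ENNReal.mul_ne_top measure_ball_lt_top.ne (ballWeight_ne_top hn hα)
  set e := d + (α + n) with he
  have hlim := ENNReal.Tendsto.const_mul (a := V⁻¹ * 2 ^ e) h
    (Or.inr (ENNReal.mul_ne_top (ENNReal.inv_ne_top.2 hV0) (two_rpow_ne_top _)))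
  rw [mul_zero] at hlim
  refine tendsto_of_tendsto_of_tendsto_of_le_of_le' tendsto_const_nhds hlim
    (.of_forall fun _ => zero_le) ?_
  filter_upwards [hf, Ioc_mem_nhdsGT (zero_lt_one' ℝ)] with r hfr hr
  have hr0 : 0 < ENNReal.ofReal (r / 2) := by simpa using hr.1
  have hlow := le_weightedMeasure_ball hn α x hr.1 hr.2
  rw [← hV, ← he] at hlow
  have hμ0 : weightedMeasure d n α (Metric.ball (embedBase n x) r) ≠ 0 := by
    refine (lt_of_lt_of_le ?_ hlow).ne'
    exact ENNReal.mul_pos (ENNReal.rpow_pos hr0 ENNReal.ofReal_ne_top).ne' hV0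
  have hμt : weightedMeasure d n α (Metric.ball (embedBase n x) r) ≠ ⊤ := by
    refine ne_top_of_le_ne_top ?_ (measure_mono (ball_embedBase_subset x r))
    rw [weightedMeasure_slab hn α Metric.isOpen_ball.measurableSet hr.1 hr.2]
    exact ENNReal.mul_ne_top measure_ball_lt_top.ne (ENNReal.mul_ne_top
      (ENNReal.rpow_ne_top_of_nonneg (by linarith) ENNReal.ofReal_ne_top) (ballWeight_ne_top hn hα))
  rw [edist_eq_enorm_sub]
  refine (enorm_average_sub_le hμ0 hμt hfr c).trans ?_
  calc (weightedMeasure d n α (Metric.ball (embedBase n x) r))⁻¹ *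
        ∫⁻ X in Metric.ball (embedBase n x) r, ‖f X - c‖ₑ ∂(weightedMeasure d n α)
      ≤ (ENNReal.ofReal (r / 2) ^ e * V)⁻¹ *
        ∫⁻ X in slab (Metric.ball x r) r, ‖f X - c‖ₑ ∂(weightedMeasure d n α) :=
        mul_le_mul' (ENNReal.inv_le_inv.2 hlow) (lintegral_mono_set (ball_embedBase_subset x r))
    _ = _ := by
        rw [setLIntegral_weightedMeasure hn α
            (measurableSet_slab Metric.isOpen_ball.measurableSet r),
          ENNReal.mul_inv (Or.inr hVt) (Or.inr hV0), ← ENNReal.rpow_neg,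
          ENNReal.ofReal_div_of_pos two_pos, ENNReal.ofReal_ofNat, div_eq_mul_inv,
          ENNReal.mul_rpow_of_ne_top (by simp) (by simp), ← ENNReal.rpow_neg_one 2,
          ← ENNReal.rpow_mul]
        have : -1 * -e = e := by ring
        rw [this]; ring

/-- Lebesgue's differentiation theorem, in terms of lower integrals. -/
lemma ae_tendsto_lebesgue {T : Base d → ℂ} (hT : LocallyIntegrable T volume) :
    ∀ᵐ x, Tendsto (fun r : ℝ => ENNReal.ofReal r ^ (-(d : ℝ)) *
      ∫⁻ z in Metric.ball x r, ‖T z - T x‖ₑ) (𝓝[>] 0) (𝓝 0) := by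
  filter_upwards [(IsUnifLocDoublingMeasure.vitaliFamily
    (volume : Measure (Base d)) 1).ae_tendsto_lintegral_enorm_sub_div hT] with x hx
  have h1 := hx.comp (IsUnifLocDoublingMeasure.tendsto_closedBall_filterAt volume (K := 1) (x := x)
    (l := 𝓝[>] (0 : ℝ)) (fun _ => x) id tendsto_id (by
      filter_upwards [self_mem_nhdsWithin] with r hr
      simpa using (le_of_lt hr)))
  have h2 := ENNReal.Tendsto.const_mul (a := volume (Metric.ball (0 : Base d) 1)) h1
    (Or.inr measure_ball_lt_top.ne)
  rw [mul_zero] at h2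
  refine tendsto_of_tendsto_of_tendsto_of_le_of_le' tendsto_const_nhds h2
    (.of_forall fun _ => zero_le) ?_
  filter_upwards [self_mem_nhdsWithin] with r hr
  have hr : 0 < r := hr
  have hV0 : volume (Metric.ball (0 : Base d) 1) ≠ 0 := (Metric.measure_ball_pos _ _ one_pos).ne'
  have hVt : volume (Metric.ball (0 : Base d) 1) ≠ ⊤ := measure_ball_lt_top.ne
  simp only [Function.comp_apply, id]
  rw [Measure.addHaar_closedBall volume x hr.le, finrank_euclideanSpace_fin,
    ENNReal.ofReal_pow hr.le, ← ENNReal.rpow_natCast, div_eq_mul_inv,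
    ENNReal.mul_inv (Or.inr hVt) (Or.inr hV0), ← ENNReal.rpow_neg]
  calc ENNReal.ofReal r ^ (-(d : ℝ)) * ∫⁻ z in Metric.ball x r, ‖T z - T x‖ₑ
      ≤ ENNReal.ofReal r ^ (-(d : ℝ)) * ∫⁻ z in Metric.closedBall x r, ‖T z - T x‖ₑ :=
        mul_le_mul' le_rfl (lintegral_mono_set Metric.ball_subset_closedBall)
    _ = (volume (Metric.ball (0 : Base d) 1) * (volume (Metric.ball (0 : Base d) 1))⁻¹) *
        (ENNReal.ofReal r ^ (-(d : ℝ)) * ∫⁻ z in Metric.closedBall x r, ‖T z - T x‖ₑ) := by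
        rw [ENNReal.mul_inv_cancel hV0 hVt, one_mul]
    _ = _ := by ring

/-- At almost every point the trace is the limit of the averages over balls. -/
lemma ae_hasTraceAt_limit (hn : 1 ≤ n) {p α s : ℝ} (hp : 1 ≤ p) (hs : 0 < s)
    (hα0 : -(n : ℝ) < α) (hα : α + n = p * (1 - s)) {f : Ambient d n → ℂ}
    {G : Ambient d n → EuclideanSpace ℂ (Fin d ⊕ Fin n)}
    (hf : LocallyIntegrable f volume) (hG : IsWeakGradient f G)
    (hfp : eLpNorm f (ENNReal.ofReal p) (weightedMeasure d n α) ≠ ⊤) (hE : energy p α G ≠ ⊤)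
    {T : Base d → ℂ} (hT : ∀ᵐ x, Tendsto (fun k : ℤ => boxAverage f k x) atTop (𝓝 (T x)))
    (hTm : Measurable T) (hTi : LocallyIntegrable T volume) :
    ∀ᵐ x, HasTraceAt (weightedMeasure d n α) f x (T x) := by
  have hHm : AEMeasurable (fun X : Ambient d n => ‖f X - T (hor X)‖ₑ) volume :=
    (hf.aestronglyMeasurable.sub (hTm.comp measurable_hor).aestronglyMeasurable).enorm
  have hI : ∀ Q : DyadicCube (Fin d), Q.level = 0 →
      singIntegral s G Q.toSet (1 / 2) ≠ ⊤ := fun Q _ =>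
    singIntegral_ne_top hn hp hs hα hG.1.aestronglyMeasurable hE (measurableSet_toSet Q)
      Q.volume_toSet_ne_top (by norm_num) (by norm_num)
  -- the averages of `|f - T ∘ hor|` over small balls tend to `0`
  have h1 : ∀ᵐ x, Tendsto (fun k : ℕ => 2 ^ ((k : ℝ) * (d + (α + n))) *
      ∫⁻ X in slab (Metric.ball x (2 ^ (-(k : ℤ)) / 2)) (2 ^ (-(k : ℤ)) / 2),
        wt X ^ α * ‖f X - T (hor X)‖ₑ) atTop (𝓝 0) := by
    refine ae_of_forall_ae_toSet 0 fun m => ?_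
    set Q : DyadicCube (Fin d) := ⟨0, m⟩ with hQ
    set A : ℝ≥0∞ := ∑ v ∈ steps (Fin d) 2,
      slabConst d n s * singIntegral s G (Q.shift v).toSet (1 / 2) with hA
    have hAt : A ≠ ⊤ := ENNReal.sum_ne_top.2 fun v _ =>
      ENNReal.mul_ne_top (slabConst_ne_top hs) (hI _ rfl)
    have hk : ∀ k : ℕ, ∫⁻ X in slab (Q.enlarge 2) (2 ^ (-(k : ℤ)) / 2), ‖f X - T (hor X)‖ₑ ≤
        A * 2 ^ (-(k : ℝ) * (n + s / 2)) := by
      intro k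
      have hr1 : (2 : ℝ) ^ (-(k : ℤ)) ≤ 1 := by
        rw [zpow_neg]
        exact inv_le_one_of_one_le₀ (one_le_zpow₀ one_le_two (by positivity))
      rw [slab_eq]
      refine (lintegral_enlarge_le volume Q 2 _ _).trans ?_
      rw [hA, Finset.sum_mul]
      refine Finset.sum_le_sum fun v _ => ?_
      rw [← slab_eq]
      refine (lintegral_slab_sub_limit_le hn hs hf hG hT hTm (Q := Q.shift v) (k := k)
        (by simp [shift, hQ])).trans ?_
      rw [mul_right_comm]
      push_cast
      gcongr
      exact singIntegral_mono subset_rfl (by linarith)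
    refine ae_tendsto_slab_ball ((measurable_wt.pow_const α).aemeasurable.mul hHm) rfl
      (e := α + n) (ε := s / 2) (A := 4 ^ |α| * A * geomSum (α + (n + s / 2))) (by linarith) ?_
      fun k => ?_
    · refine ENNReal.mul_ne_top (ENNReal.mul_ne_top ?_ hAt) (geomSum_ne_top (by linarith))
      exact ENNReal.rpow_ne_top_of_nonneg (abs_nonneg _) (by simp)
    · refine (lintegral_slab_wt_le hn (measurableSet_enlarge Q 2) hHm hk k).trans_eq ?_
      congr 2; ring
  filter_upwards [h1, ae_tendsto_lebesgue hTi] with x hx hxL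
  have h2 := tendsto_of_tendsto_dyadic
    (Φ := fun r => ∫⁻ X in slab (Metric.ball x r) r, wt X ^ α * ‖f X - T (hor X)‖ₑ)
    (fun r r' hr => lintegral_mono_set (slab_mono (Metric.ball_subset_ball hr) hr))
    (by have : (0 : ℝ) ≤ d := Nat.cast_nonneg d
        linarith) hx
  -- the averages of `|T ∘ hor - T x|` reduce to those over balls of `ℝ^d`
  have h3 := ENNReal.Tendsto.const_mul (a := ballWeight n α) hxL
    (Or.inr (ballWeight_ne_top hn hα0))
  have h4 := h2.add h3
  rw [mul_zero, add_zero] at h4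
  refine hasTraceAt_of_tendsto hn hα0 ?_ ?_
  · filter_upwards [Ioc_mem_nhdsGT (zero_lt_one' ℝ)] with r hr
    have hμt : weightedMeasure d n α (Metric.ball (embedBase n x) r) < ⊤ := by
      refine lt_of_le_of_lt (measure_mono (ball_embedBase_subset x r)) ?_
      rw [weightedMeasure_slab hn α Metric.isOpen_ball.measurableSet hr.1 hr.2]
      exact (ENNReal.mul_ne_top measure_ball_lt_top.ne (ENNReal.mul_ne_top
        (ENNReal.rpow_ne_top_of_nonneg (by linarith) ENNReal.ofReal_ne_top)
        (ballWeight_ne_top hn hα0))).lt_top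
    have : IsFiniteMeasure ((weightedMeasure d n α).restrict (Metric.ball (embedBase n x) r)) :=
      ⟨by simpa using hμt⟩
    have hL : MemLp f (ENNReal.ofReal p) (weightedMeasure d n α) :=
      ⟨hf.aestronglyMeasurable.mono_ac (weightedMeasure_absolutelyContinuous α), hfp.lt_top⟩
    exact (hL.restrict _).integrable (by simpa using hp)
  · refine tendsto_of_tendsto_of_tendsto_of_le_of_le' tendsto_const_nhds h4
      (.of_forall fun _ => zero_le) ?_
    filter_upwards [Ioc_mem_nhdsGT (zero_lt_one' ℝ)] with r hr
    have hm : Measurable fun X : Ambient d n => wt X ^ α * ‖T (hor X) - T x‖ₑ :=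
      (measurable_wt.pow_const α).mul ((hTm.comp measurable_hor).sub measurable_const).enorm
    have hr0 : ENNReal.ofReal r ≠ 0 := by simpa using hr.1
    have hTe : Measurable fun z => ‖T z - T x‖ₑ := (hTm.sub measurable_const).enorm
    calc ENNReal.ofReal r ^ (-(d + (α + n))) *
          ∫⁻ X in slab (Metric.ball x r) r, wt X ^ α * ‖f X - T x‖ₑ
        ≤ ENNReal.ofReal r ^ (-(d + (α + n))) *
          ∫⁻ X in slab (Metric.ball x r) r, (wt X ^ α * ‖f X - T (hor X)‖ₑ +
            wt X ^ α * ‖T (hor X) - T x‖ₑ) := by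
          refine mul_le_mul' le_rfl (lintegral_mono fun X => ?_)
          rw [← mul_add]
          refine mul_le_mul' le_rfl (le_trans (le_of_eq ?_) (enorm_add_le _ _))
          congr 1; ring
      _ = ENNReal.ofReal r ^ (-(d + (α + n))) *
            (∫⁻ X in slab (Metric.ball x r) r, wt X ^ α * ‖f X - T (hor X)‖ₑ) +
          ENNReal.ofReal r ^ (-(d + (α + n))) *
            ((∫⁻ z in Metric.ball x r, ‖T z - T x‖ₑ) *
              (ENNReal.ofReal r ^ (α + n) * ballWeight n α)) := by
          rw [lintegral_add_right _ hm, mul_add]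
          congr 2
          rw [lintegral_slab Metric.isOpen_ball.measurableSet _ _ hm.aemeasurable, ballWeight,
            ← lintegral_ball_rpow α hr.1, ← lintegral_mul_const _ hTe]
          refine lintegral_congr fun z => ?_
          rw [mul_comm, ← lintegral_mul_const _ (by fun_prop)]
          refine setLIntegral_congr_fun Metric.isOpen_ball.measurableSet fun y hy => ?_
          have : ‖y‖ₑ ≤ 1 := by
            rw [← ofReal_norm, ← ENNReal.ofReal_one]
            exact ENNReal.ofReal_le_ofReal ((mem_ball_zero_iff.1 hy).le.trans hr.2)
          simp [wt, this]
      _ = _ := by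
          congr 1
          have e1 : ENNReal.ofReal r ^ (-(d + (α + n))) * ENNReal.ofReal r ^ (α + n) =
              ENNReal.ofReal r ^ (-(d : ℝ)) := by
            rw [← ENNReal.rpow_add _ _ hr0 ENNReal.ofReal_ne_top]; congr 1; ring
          rw [← e1]; ring

end TraceExists

section TraceSummary

open DyadicCube

variable {d n : ℕ}

lemma besovNorm_congr_ae {ι : Type} [Fintype ι] {s p q : ℝ} {μ : Measure (EuclideanSpace ℝ ι)}
    {f g : EuclideanSpace ℝ ι → ℂ} (h : f =ᵐ[μ] g) :
    besovNorm s p q μ f = besovNorm s p q μ g := by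
  have h1 : ∀ A : Set (EuclideanSpace ℝ ι), ⨍ x in A, f x ∂μ = ⨍ x in A, g x ∂μ := fun A => by
    rw [setAverage_eq, setAverage_eq, integral_congr_ae (ae_restrict_of_ae h)]
  simp only [besovNorm, eLpNorm_congr_ae h, h1]

/-- The trace of a function of the weighted Sobolev space: it is the limit of the box averages,
and it is also the limit of the averages over balls. -/
lemma exists_trace (hn : 1 ≤ n) {p α s : ℝ} (hp : 1 ≤ p) (hs : 0 < s) (hs1 : s ≤ 1)
    (hα0 : -(n : ℝ) < α) (hα : α + n = p * (1 - s)) {f : Ambient d n → ℂ}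
    (hf : f ∈ sobolevSpace p (weightedMeasure d n α)) :
    ∃ T : Base d → ℂ, Measurable T ∧ LocallyIntegrable T volume ∧
      (∀ᵐ x, Tendsto (fun k : ℤ => boxAverage f k x) atTop (𝓝 (T x))) ∧
      (∀ᵐ x, HasTraceAt (weightedMeasure d n α) f x (T x)) ∧
      traceFun (weightedMeasure d n α) f =ᵐ[volume] T ∧
      besovNorm s p p volume T ≤
        (traceConst d n p s + 1) * sobolevNorm p (weightedMeasure d n α) f := by
  obtain ⟨hfi, hfs⟩ := hf
  have hp0 : 0 < p := by linarith
  have hbound : ∀ G : Ambient d n → EuclideanSpace ℂ (Fin d ⊕ Fin n),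
      eLpNorm f (ENNReal.ofReal p) (weightedMeasure d n α) +
        eLpNorm G (ENNReal.ofReal p) (weightedMeasure d n α) < ⊤ →
      eLpNorm f (ENNReal.ofReal p) (weightedMeasure d n α) ≠ ⊤ ∧
        eLpNorm G (ENNReal.ofReal p) (weightedMeasure d n α) ≠ ⊤ ∧ energy p α G ≠ ⊤ := by
    intro G h
    obtain ⟨h1, h2⟩ := ENNReal.add_lt_top.1 h
    refine ⟨h1.ne, h2.ne, ?_⟩
    rw [← eLpNorm_rpow_eq_energy hn hp]
    exact ENNReal.rpow_ne_top_of_nonneg hp0.le h2.ne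
  have hfs' := hfs
  simp only [sobolevNorm, iInf_lt_iff] at hfs'
  obtain ⟨G, hG, hlt⟩ := hfs'
  obtain ⟨hfp, hGp, hE⟩ := hbound G hlt
  have hex := ae_exists_limit_boxAverage hn hp hs hα hfi hG hE
  obtain ⟨T, hTm, hT⟩ : ∃ T : Base d → ℂ, Measurable T ∧
      ∀ᵐ x, Tendsto (fun k : ℤ => boxAverage f k x) atTop (𝓝 (T x)) :=
    measurable_limit_of_tendsto_metrizable_ae
      (fun k => (measurable_boxAverage f k).aemeasurable) hex
  have hTi := locallyIntegrable_limit_boxAverage hn hp hs hα hfi hG hfp hGp hT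
  have htr := ae_hasTraceAt_limit hn hp hs hα0 hα hfi hG hfp hE hT hTm hTi
  refine ⟨T, hTm, hTi, hT, htr, ?_, ?_⟩
  · filter_upwards [htr] with x hx
    exact hx.2.limUnder_eq
  · have hC : traceConst d n p s + 1 ≠ ⊤ := by simp [traceConst_ne_top hn hp hs]
    have hC0 : traceConst d n p s + 1 ≠ 0 := by simp
    rw [mul_comm, ← ENNReal.div_le_iff hC0 hC]
    refine le_iInf₂ fun G' hG' => ?_
    rw [ENNReal.div_le_iff hC0 hC, mul_comm]
    by_cases hlt' : eLpNorm f (ENNReal.ofReal p) (weightedMeasure d n α) +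
        eLpNorm G' (ENNReal.ofReal p) (weightedMeasure d n α) < ⊤
    · obtain ⟨hfp', hGp', -⟩ := hbound G' hlt'
      exact (besovNorm_limit_boxAverage_le hn hp hs hs1 hα hfi hG' hfp' hGp' hT).trans
        (mul_le_mul' le_self_add le_rfl)
    · rw [not_lt_top_iff.1 hlt', ENNReal.mul_top hC0]
      exact le_top

end TraceSummary

/-! ### The geometry of the Whitney cubes -/

section WhitneyGeometry

open DyadicCube

variable {d n : ℕ}

/-- The maximum norm of the `ℝ^n`-component. -/
def vsup (X : Ambient d n) : ℝ := ‖fun j : Fin n => X (Sum.inr j)‖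

lemma vsup_nonneg (X : Ambient d n) : 0 ≤ vsup X := norm_nonneg _

lemma abs_le_vsup (X : Ambient d n) (j : Fin n) : |X (Sum.inr j)| ≤ vsup X :=
  norm_le_pi_norm (fun j : Fin n => X (Sum.inr j)) j

lemma vsup_le {X : Ambient d n} {r : ℝ} (hr : 0 ≤ r) (h : ∀ j, |X (Sum.inr j)| ≤ r) :
    vsup X ≤ r := (pi_norm_le_iff_of_nonneg hr).2 h

lemma continuous_vsup : Continuous (vsup : Ambient d n → ℝ) := by unfold vsup; fun_prop

lemma vsup_le_norm_ver (X : Ambient d n) : vsup X ≤ ‖ver X‖ :=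
  vsup_le (norm_nonneg _) fun j => PiLp.norm_apply_le (ver X) j

lemma norm_ver_le_vsup (X : Ambient d n) : ‖ver X‖ ≤ n * vsup X := by
  have h1 : ‖ver X‖ ≤ ∑ j, ‖ver X j‖ := by
    rw [EuclideanSpace.norm_eq]
    refine Real.sqrt_le_iff.2 ⟨by positivity, ?_⟩
    exact Finset.sum_sq_le_sq_sum_of_nonneg fun i _ => norm_nonneg _
  refine h1.trans ((Finset.sum_le_card_nsmul _ _ (vsup X) fun j _ => abs_le_vsup X j).trans_eq ?_)
  simp

lemma vsup_eq_zero_iff {X : Ambient d n} : vsup X = 0 ↔ ver X = 0 := by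
  constructor
  · intro h
    have := norm_ver_le_vsup X
    rw [h, mul_zero] at this
    exact norm_le_zero_iff.1 this
  · intro h
    have := vsup_le_norm_ver X
    rw [h, norm_zero] at this
    exact le_antisymm this (vsup_nonneg X)

lemma mem_of_mem_whitneyCubes {Q : DyadicCube (Fin d)} {P : DyadicCube (Fin d ⊕ Fin n)}
    (hP : P ∈ whitneyCubes n Q) {Z : Ambient d n} (hZ : Z ∈ P.toSet) :
    hor Z ∈ Q.toSet ∧ Q.edge ≤ vsup Z ∧ vsup Z ≤ 2 * Q.edge := by
  have hp := Q.edge_pos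
  obtain ⟨⟨h1, h2⟩, h3⟩ := hP.2 hZ
  refine ⟨h1, ?_, ?_⟩
  · by_contra hlt
    rw [not_le] at hlt
    refine h3 ⟨h1, fun j _ => ?_⟩
    have := (abs_le_vsup Z j).trans_lt hlt
    exact abs_lt.1 this
  · refine vsup_le (by linarith) fun j => abs_le.2 (h2 j (mem_univ j))

lemma edge_of_mem_whitneyCubes {Q : DyadicCube (Fin d)} {P : DyadicCube (Fin d ⊕ Fin n)}
    (hP : P ∈ whitneyCubes n Q) : P.edge = Q.edge := by
  rw [edge, edge, hP.1]

/-- The set `A_Q` as a finite set. -/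
def whitneyFinset (n : ℕ) (Q : DyadicCube (Fin d)) : Finset (DyadicCube (Fin d ⊕ Fin n)) := by
  classical
  exact ((Fintype.piFinset fun _ : Fin n => Finset.Icc (-3 : ℤ) 1).image
    fun v => (⟨Q.level, Sum.elim Q.corner v⟩ : DyadicCube (Fin d ⊕ Fin n))).filter
      (· ∈ whitneyCubes n Q)

lemma card_whitneyFinset_le (Q : DyadicCube (Fin d)) : (whitneyFinset n Q).card ≤ 5 ^ n := by
  classical
  refine (Finset.card_filter_le _ _).trans (Finset.card_image_le.trans ?_)
  simp

lemma mem_whitneyFinset {Q : DyadicCube (Fin d)} {P : DyadicCube (Fin d ⊕ Fin n)} :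
    P ∈ whitneyFinset n Q ↔ P ∈ whitneyCubes n Q := by
  classical
  rw [whitneyFinset, Finset.mem_filter, and_iff_right_iff_imp]
  intro hP
  have hp := Q.edge_pos
  have he := edge_of_mem_whitneyCubes hP
  set u : Ambient d n := WithLp.toLp 2 fun i => P.edge * ((P.corner i : ℝ) + 1) with hu
  have huP : u ∈ P.toSet := fun i => by
    have := P.edge_pos
    simp only [hu]
    constructor <;> nlinarith
  obtain ⟨h1, -, h2⟩ := mem_of_mem_whitneyCubes hP huP
  rw [Finset.mem_image]
  refine ⟨fun j => P.corner (Sum.inr j), ?_, ?_⟩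
  · rw [Fintype.mem_piFinset]
    intro j
    have h3 := abs_le.1 ((abs_le_vsup u j).trans h2)
    have h4 : u (Sum.inr j) = Q.edge * ((P.corner (Sum.inr j) : ℝ) + 1) := by rw [← he]
    rw [h4] at h3
    have i1 : (-2 : ℝ) ≤ P.corner (Sum.inr j) + 1 :=
      le_of_mul_le_mul_left (by linarith [h3.1]) hp
    have i2 : (P.corner (Sum.inr j) + 1 : ℝ) ≤ 2 :=
      le_of_mul_le_mul_left (by linarith [h3.2]) hp
    norm_cast at i1 i2
    rw [Finset.mem_Icc]
    omega
  · ext i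
    · exact hP.1.symm
    · rcases i with i | j
      · obtain ⟨h3, h4⟩ := h1 i
        have h5 : hor u i = Q.edge * ((P.corner (Sum.inl i) : ℝ) + 1) := by rw [← he]; rfl
        rw [h5] at h3 h4
        have i1 : (Q.corner i : ℝ) < P.corner (Sum.inl i) + 1 := lt_of_mul_lt_mul_left h3 hp.le
        have i2 : (P.corner (Sum.inl i) + 1 : ℝ) ≤ Q.corner i + 1 := le_of_mul_le_mul_left h4 hp
        norm_cast at i1 i2
        simp only [Sum.elim_inl]
        omega
      · rfl

/-- The cube that contains a point at height comparable to `ℓ(Q)` above `Q` is a Whitney cube. -/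
lemma containing_mem_whitneyCubes {k : ℤ} {X : Ambient d n} (h1 : (2 : ℝ) ^ (-k) < vsup X)
    (h2 : vsup X < 2 * 2 ^ (-k)) : containing k X ∈ whitneyCubes n (containing k (hor X)) := by
  refine ⟨rfl, fun Z hZ => ⟨⟨fun i => hZ (Sum.inl i), fun j _ => ?_⟩, fun hZ' => ?_⟩⟩
  · obtain ⟨h3, h4⟩ := mem_toSet_containing k X (Sum.inr j)
    obtain ⟨h5, h6⟩ := hZ (Sum.inr j)
    rw [edge_containing]
    rw [edge_containing] at h3 h4 h5 h6
    have hp : (0 : ℝ) < 2 ^ (-k) := by positivity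
    set c := (containing k X).corner (Sum.inr j)
    have h7 := abs_lt.1 ((abs_le_vsup X j).trans_lt h2)
    have i1 : (c : ℝ) < 2 := by
      refine lt_of_mul_lt_mul_left (a := (2 : ℝ) ^ (-k)) ?_ hp.le
      linarith [h7.2]
    have i2 : (-2 : ℝ) < c + 1 := by
      refine lt_of_mul_lt_mul_left (a := (2 : ℝ) ^ (-k)) ?_ hp.le
      linarith [h7.1]
    norm_cast at i1 i2
    have j1 : (c : ℝ) ≤ 1 := by exact_mod_cast (by omega : c ≤ 1)
    have j2 : (-2 : ℝ) ≤ c := by exact_mod_cast (by omega : -2 ≤ c)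
    simp only [mem_Icc]
    constructor <;> nlinarith
  · obtain ⟨j, hj⟩ : ∃ j, 2 ^ (-k) < |X (Sum.inr j)| := by
      by_contra hall
      push Not at hall
      exact absurd (vsup_le (by positivity) hall) (not_le.2 h1)
    have h5 := hZ'.2 j (mem_univ j)
    obtain ⟨h3, h4⟩ := mem_toSet_containing k X (Sum.inr j)
    obtain ⟨h6, h7⟩ := hZ (Sum.inr j)
    rw [edge_containing] at h3 h4 h5 h6 h7
    have hp : (0 : ℝ) < 2 ^ (-k) := by positivity
    set c := (containing k X).corner (Sum.inr j)
    simp only [mem_Ioo] at h5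
    rcases lt_abs.1 hj with h | h
    · have i1 : (1 : ℝ) < c + 1 := by
        refine lt_of_mul_lt_mul_left (a := (2 : ℝ) ^ (-k)) ?_ hp.le
        linarith
      norm_cast at i1
      have j1 : (1 : ℝ) ≤ c := by exact_mod_cast (by omega : 1 ≤ c)
      nlinarith
    · have i1 : (c : ℝ) < -1 := by
        refine lt_of_mul_lt_mul_left (a := (2 : ℝ) ^ (-k)) ?_ hp.le
        linarith
      have i1' : c < -1 := by exact_mod_cast i1
      have j1 : (c : ℝ) + 1 ≤ -1 := by exact_mod_cast (by omega : c + 1 ≤ -1)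
      nlinarith

/-- A neighborhood of `{(x, y) : x ∈ Q, ℓ(Q) ≤ |y| < 2 ℓ(Q)}`, for the maximum norm. -/
def reach (Q : DyadicCube (Fin d)) : Set (Ambient d n) :=
  {X | (∃ x ∈ Q.toSet, ∀ i, |X (Sum.inl i) - x i| < Q.edge / 16) ∧
    9 / 16 * Q.edge < vsup X ∧ vsup X < 3 * Q.edge}

lemma isOpen_reach (Q : DyadicCube (Fin d)) : IsOpen (reach Q : Set (Ambient d n)) := by
  have : (reach Q : Set (Ambient d n)) =
      (⋃ x ∈ Q.toSet, ⋂ i, {X | |X (Sum.inl i) - x i| < Q.edge / 16}) ∩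
        ({X | 9 / 16 * Q.edge < vsup X} ∩ {X | vsup X < 3 * Q.edge}) := by
    ext X; simp [reach]
  rw [this]
  refine (isOpen_biUnion fun x _ => isOpen_iInter_of_finite fun i => ?_).inter
    ((isOpen_lt continuous_const continuous_vsup).inter
      (isOpen_lt continuous_vsup continuous_const))
  exact isOpen_lt (by fun_prop) continuous_const

lemma mem_reach {Q : DyadicCube (Fin d)} {X : Ambient d n} (h : hor X ∈ Q.toSet)
    (h1 : Q.edge ≤ vsup X) (h2 : vsup X < 2 * Q.edge) : X ∈ reach Q := by
  have := Q.edge_pos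
  exact ⟨⟨hor X, h, fun i => by simpa using this⟩, by linarith, by linarith⟩

lemma exists_mem_reach {X : Ambient d n} (hX : ver X ≠ 0) :
    ∃ k : ℤ, 2 ^ (-k) ≤ vsup X ∧ vsup X < 2 * 2 ^ (-k) ∧ X ∈ reach (containing k (hor X)) := by
  have h0 : 0 < vsup X :=
    lt_of_le_of_ne (vsup_nonneg X) fun h => hX (vsup_eq_zero_iff.1 h.symm)
  obtain ⟨m, h1, h2⟩ := exists_mem_Ico_zpow h0 one_lt_two
  rw [zpow_add_one₀ two_ne_zero, mul_comm] at h2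
  refine ⟨-m, by rwa [neg_neg], by rwa [neg_neg], mem_reach (mem_toSet_containing _ _) ?_ ?_⟩
  · rwa [edge_containing, neg_neg]
  · rwa [edge_containing, neg_neg]

section Bump

variable {ψ : DyadicCube (Fin d ⊕ Fin n) → Ambient d n → ℝ}

/-- The bump functions that do not vanish near a point of `reach Q` belong to neighbors of `Q`. -/
lemma neighbor_of_mem_tsupport (hψ : IsWhitneyBumpFamily d n ψ) {Q Q' : DyadicCube (Fin d)}
    (hQ' : 0 ≤ Q'.level) {P : DyadicCube (Fin d ⊕ Fin n)} (hP : P ∈ whitneyCubes n Q')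
    {X : Ambient d n} (hX : X ∈ tsupport (ψ P)) (hXr : X ∈ reach Q) : Neighbor Q Q' := by
  have he := edge_of_mem_whitneyCubes hP
  have hp := Q.edge_pos
  have hp' := Q'.edge_pos
  obtain ⟨Z, hZ, hXZ⟩ := Metric.mem_thickening_iff.1 (hψ.support_subset ⟨Q', hQ'⟩ P hP hX)
  rw [he, dist_eq_norm] at hXZ
  have hc : ∀ i, |X i - Z i| < Q'.edge / 4 := fun i =>
    (PiLp.norm_apply_le (X - Z) i).trans_lt hXZ
  obtain ⟨h1, h2, h3⟩ := mem_of_mem_whitneyCubes hP hZ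
  obtain ⟨⟨x, hx, hxX⟩, h4, h5⟩ := hXr
  have hv : |vsup X - vsup Z| ≤ Q'.edge / 4 := by
    refine (abs_norm_sub_norm_le _ _).trans ?_
    refine (pi_norm_le_iff_of_nonneg (by linarith)).2 fun j => ?_
    exact (hc (Sum.inr j)).le
  rw [abs_le] at hv
  have l1 : Q.edge < 4 * Q'.edge := by linarith [hv.2]
  have l2 : Q'.edge < 4 * Q.edge := by linarith [hv.1]
  have h4' : (4 : ℝ) = 2 ^ (2 : ℤ) := by norm_num
  rw [edge, edge, h4', ← zpow_add₀ two_ne_zero, zpow_lt_zpow_iff_right₀ one_lt_two] at l1 l2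
  -- The heights differ by less than the factor `4`, so the levels differ by at most one.
  have hl : Q'.level = Q.level - 1 ∨ Q'.level = Q.level ∨ Q'.level = Q.level + 1 := by omega
  refine neighbor_of_near hl hx fun i => ?_
  have hle : Q.edge ≤ 2 * Q'.edge := by
    rcases hl with h | h | h
    · have := edge_eq_of_level_add_one (Q := Q') (Q' := Q) (by omega)
      linarith
    · linarith [edge_eq_of_level_eq h]
    · linarith [edge_eq_of_level_add_one h]
  -- The horizontal margin is `ℓ(Q) / 16 + ℓ(Q') / 4 ≤ 3 ℓ(Q') / 8`.
  have a1 := abs_lt.1 (hxX i)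
  have a2 := abs_lt.1 (hc (Sum.inl i))
  obtain ⟨a3, a4⟩ := h1 i
  rw [hor_apply] at a3 a4
  constructor <;> linarith [a1.1, a1.2, a2.1, a2.2]

/-- The neighbors of `Q` of edge length at most `1`. -/
def unitNeighbors (Q : DyadicCube (Fin d)) : Finset (DyadicCube (Fin d)) :=
  Q.neighborFinset.filter (0 ≤ ·.level)

/-- The part of `∑_{Q'} ∑_{P ∈ A_{Q'}} c(Q') ψ_P` where `Q'` is a neighbor of `Q`. -/
def patch (ψ : DyadicCube (Fin d ⊕ Fin n) → Ambient d n → ℝ) (Q : DyadicCube (Fin d))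
    (c : DyadicCube (Fin d) → ℂ) (X : Ambient d n) : ℂ :=
  ∑ Q' ∈ unitNeighbors Q, ∑ P ∈ whitneyFinset n Q', c Q' * ((ψ P X : ℝ) : ℂ)

lemma tsum_tsum_eq_sum {M : Type*} [AddCommMonoid M] [TopologicalSpace M] [T2Space M]
    (Q : DyadicCube (Fin d)) (a : DyadicCube (Fin d) → DyadicCube (Fin d ⊕ Fin n) → M)
    (ha : ∀ Q', 0 ≤ Q'.level → ¬ Neighbor Q Q' → ∀ P ∈ whitneyCubes n Q', a Q' P = 0) :
    ∑' Q' : UnitDyadicCube d, ∑' P : whitneyCubes n Q'.1, a Q'.1 P.1 =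
      ∑ Q' ∈ unitNeighbors Q, ∑ P ∈ whitneyFinset n Q', a Q' P := by
  have h1 : ∀ Q' : DyadicCube (Fin d), ∑' P : whitneyCubes n Q', a Q' P.1 =
      ∑ P ∈ whitneyFinset n Q', a Q' P := by
    intro Q'
    rw [tsum_subtype (whitneyCubes n Q') (a Q'), tsum_eq_sum (s := whitneyFinset n Q')]
    · refine Finset.sum_congr rfl fun P hP => ?_
      rw [indicator_of_mem (mem_whitneyFinset.1 hP)]
    · intro P hP
      rw [indicator_of_notMem (fun h => hP (mem_whitneyFinset.2 h))]
  simp_rw [h1]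
  refine (tsum_subtype {Q' : DyadicCube (Fin d) | 0 ≤ Q'.level}
    (fun Q' => ∑ P ∈ whitneyFinset n Q', a Q' P)).trans ?_
  rw [tsum_eq_sum (s := unitNeighbors Q)]
  · refine Finset.sum_congr rfl fun Q' hQ' => ?_
    rw [indicator_of_mem]
    exact (Finset.mem_filter.1 hQ').2
  · intro Q' hQ'
    by_cases hl : 0 ≤ Q'.level
    · rw [indicator_of_mem (by exact hl)]
      refine Finset.sum_eq_zero fun P hP => ha Q' hl (fun hN => hQ' ?_) P (mem_whitneyFinset.1 hP)
      exact Finset.mem_filter.2 ⟨mem_neighborFinset.2 hN, hl⟩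
    · rw [indicator_of_notMem (by exact hl)]

/-- On `reach Q` the Whitney extension is a finite sum. -/
lemma tsum_eq_patch (hψ : IsWhitneyBumpFamily d n ψ) {Q : DyadicCube (Fin d)} {X : Ambient d n}
    (hX : X ∈ reach Q) (c : DyadicCube (Fin d) → ℂ) :
    ∑' Q' : UnitDyadicCube d, ∑' P : whitneyCubes n Q'.1, c Q'.1 * ((ψ P.1 X : ℝ) : ℂ) =
      patch ψ Q c X := by
  refine tsum_tsum_eq_sum Q (fun Q' P => c Q' * ((ψ P X : ℝ) : ℂ)) fun Q' hQ' hN P hP => ?_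
  have : ψ P X = 0 := by
    by_contra h
    exact hN (neighbor_of_mem_tsupport hψ hQ' hP (subset_tsupport _ h) hX)
  simp [this]

/-- The bump functions form a partition of unity at the heights where the cube of a point is a
Whitney cube of edge length at most `1`. -/
lemma patch_one (hψ : IsWhitneyBumpFamily d n ψ) {k : ℤ} (hk : 0 ≤ k) {X : Ambient d n}
    (h1 : (2 : ℝ) ^ (-k) < vsup X) (h2 : vsup X < 2 * 2 ^ (-k)) {Q : DyadicCube (Fin d)}
    (hX : X ∈ reach Q) : patch ψ Q (fun _ => 1) X = 1 := by
  have hs := hψ.sum_eq_one ⟨containing k (hor X), hk⟩ (containing k X)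
    (containing_mem_whitneyCubes h1 h2) X (mem_toSet_containing k X)
  rw [← tsum_eq_patch hψ hX]
  simp only [one_mul]
  have := congrArg (fun r : ℝ => (r : ℂ)) hs
  simpa only [Complex.ofReal_tsum, Complex.ofReal_one] using this

lemma contDiff_patch (hψ : IsWhitneyBumpFamily d n ψ) (Q : DyadicCube (Fin d))
    (c : DyadicCube (Fin d) → ℂ) : ContDiff ℝ ∞ (patch ψ Q c) := by
  refine ContDiff.sum fun Q' hQ' => ContDiff.sum fun P hP => ?_
  have h := hψ.smooth ⟨Q', (Finset.mem_filter.1 hQ').2⟩ P (mem_whitneyFinset.1 hP)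
  exact contDiff_const.mul (Complex.ofRealCLM.contDiff.comp h)

lemma patch_sub (Q : DyadicCube (Fin d)) (c : DyadicCube (Fin d) → ℂ) (a : ℂ) (X : Ambient d n) :
    patch ψ Q (fun Q' => c Q' - a) X = patch ψ Q c X - a * patch ψ Q (fun _ => 1) X := by
  simp only [patch, sub_mul, Finset.sum_sub_distrib, Finset.mul_sum, one_mul]

lemma enorm_patch_le (hψ : IsWhitneyBumpFamily d n ψ) (Q : DyadicCube (Fin d))
    (c : DyadicCube (Fin d) → ℂ) (X : Ambient d n) :
    ‖patch ψ Q c X‖ₑ ≤ 5 ^ n * ∑ Q' ∈ Q.neighborFinset, ‖c Q'‖ₑ := by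
  rw [patch, Finset.mul_sum]
  refine (enorm_sum_le _ _).trans ((Finset.sum_le_sum fun Q' hQ' => ?_).trans
    (Finset.sum_le_sum_of_subset (Finset.filter_subset _ _)))
  refine (enorm_sum_le _ _).trans ((Finset.sum_le_card_nsmul _ _ ‖c Q'‖ₑ fun P hP => ?_).trans ?_)
  · rw [enorm_mul]
    refine mul_le_of_le_one_right' ?_
    have h := hψ.mem_Icc ⟨Q', (Finset.mem_filter.1 hQ').2⟩ P (mem_whitneyFinset.1 hP) X
    rw [← ofReal_norm, Complex.norm_real, Real.norm_of_nonneg h.1]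
    exact ENNReal.ofReal_le_one.2 h.2
  · rw [nsmul_eq_mul]
    gcongr
    exact_mod_cast card_whitneyFinset_le Q'

/-- The bound of the derivative of a patch; `C` is the constant of the Lipschitz bounds. -/
lemma enorm_fderiv_patch_le (hψ : IsWhitneyBumpFamily d n ψ) {C : ℝ≥0}
    (hC : ∀ Q : UnitDyadicCube d, ∀ P ∈ whitneyCubes n Q.1, ∀ x y,
      |ψ P x - ψ P y| ≤ C / P.edge * dist x y) (Q : DyadicCube (Fin d))
    (c : DyadicCube (Fin d) → ℂ) (X : Ambient d n) :
    ‖fderiv ℝ (patch ψ Q c) X‖ₑ ≤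
      5 ^ n * (2 * C) * 2 ^ (Q.level : ℝ) * ∑ Q' ∈ Q.neighborFinset, ‖c Q'‖ₑ := by
  have hdiff : ∀ Q' ∈ unitNeighbors Q, ∀ P ∈ whitneyFinset n Q',
      DifferentiableAt ℝ (fun X => c Q' * ((ψ P X : ℝ) : ℂ)) X := by
    intro Q' hQ' P hP
    have h := hψ.smooth ⟨Q', (Finset.mem_filter.1 hQ').2⟩ P (mem_whitneyFinset.1 hP)
    exact ((contDiff_const.mul (Complex.ofRealCLM.contDiff.comp h)).differentiable
      (by simp)).differentiableAt
  have hsum : fderiv ℝ (patch ψ Q c) X = ∑ Q' ∈ unitNeighbors Q, ∑ P ∈ whitneyFinset n Q',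
      fderiv ℝ (fun X => c Q' * ((ψ P X : ℝ) : ℂ)) X := by
    unfold patch
    rw [fderiv_fun_sum fun Q' hQ' => DifferentiableAt.fun_sum (hdiff Q' hQ')]
    exact Finset.sum_congr rfl fun Q' hQ' => fderiv_fun_sum (hdiff Q' hQ')
  rw [hsum, Finset.mul_sum]
  refine (enorm_sum_le (unitNeighbors Q) fun Q' => ∑ P ∈ whitneyFinset n Q',
    fderiv ℝ (fun X => c Q' * ((ψ P X : ℝ) : ℂ)) X).trans
    ((Finset.sum_le_sum fun Q' hQ' => ?_).trans
    (Finset.sum_le_sum_of_subset (Finset.filter_subset _ _)))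
  refine (enorm_sum_le _ fun P => fderiv ℝ (fun X => c Q' * ((ψ P X : ℝ) : ℂ)) X).trans
    ((Finset.sum_le_card_nsmul _ _
    (2 * C * 2 ^ (Q.level : ℝ) * ‖c Q'‖ₑ) fun P hP => ?_).trans ?_)
  · have hQl := (Finset.mem_filter.1 hQ').2
    have hN := mem_neighborFinset.1 (Finset.mem_filter.1 hQ').1
    have hPm := mem_whitneyFinset.1 hP
    have he := edge_of_mem_whitneyCubes hPm
    have hp := Q'.edge_pos
    have hQ := Q.edge_pos
    have hL : LipschitzWith (‖c Q'‖₊ * (2 * C * Real.toNNReal (2 ^ Q.level)))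
        (fun X => c Q' * ((ψ P X : ℝ) : ℂ)) := by
      refine LipschitzWith.of_dist_le_mul fun x y => ?_
      rw [dist_eq_norm, ← mul_sub, norm_mul, ← Complex.ofReal_sub, Complex.norm_real]
      push_cast
      rw [Real.coe_toNNReal _ (by positivity), mul_assoc]
      refine mul_le_mul_of_nonneg_left ((hC ⟨Q', hQl⟩ P hPm x y).trans ?_) (norm_nonneg _)
      refine mul_le_mul_of_nonneg_right ?_ dist_nonneg
      rw [he, div_le_iff₀ hp]
      have h1 : Q.edge ≤ 2 * Q'.edge := (div_le_iff₀ hp).1 hN.2.1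
      have h2 : (2 : ℝ) ^ Q.level * Q.edge = 1 := by
        rw [edge, ← zpow_add₀ two_ne_zero]; simp
      have h3 : (0 : ℝ) < 2 ^ Q.level := by positivity
      have hC0 : (0 : ℝ) ≤ C := C.2
      have h4 : 1 ≤ 2 * 2 ^ Q.level * Q'.edge := by nlinarith
      nlinarith
    have h5 := norm_fderiv_le_of_lipschitz ℝ hL (x₀ := X)
    have h6 : ‖fderiv ℝ (fun X => c Q' * ((ψ P X : ℝ) : ℂ)) X‖ₑ ≤
        ((‖c Q'‖₊ * (2 * C * Real.toNNReal (2 ^ Q.level)) : ℝ≥0) : ℝ≥0∞) := by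
      rw [enorm_le_coe]
      exact h5
    refine h6.trans_eq ?_
    push_cast
    rw [← ofReal_two_zpow]
    rw [show ((2 ^ Q.level : ℝ).toNNReal : ℝ≥0∞) = ENNReal.ofReal (2 ^ Q.level) from rfl,
      show ((‖c Q'‖₊ : ℝ≥0) : ℝ≥0∞) = ‖c Q'‖ₑ from rfl]
    ring
  · rw [nsmul_eq_mul]
    have : ((whitneyFinset n Q').card : ℝ≥0∞) ≤ 5 ^ n := by
      exact_mod_cast card_whitneyFinset_le Q'
    refine (mul_le_mul' this le_rfl).trans_eq (by ring)

end Bump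

end WhitneyGeometry

/-! ### Discrete estimates for functions of the Besov space -/

section Oscillation

open DyadicCube

variable {d : ℕ}

/-- The average `f_Q`. -/
def cubeAverage (f : Base d → ℂ) (Q : DyadicCube (Fin d)) : ℂ := ⨍ x in Q.toSet, f x

/-- The sum of `|f_{Q'} - f_Q|` over the neighbors `Q'` of `Q`. -/
def neighborOsc (f : Base d → ℂ) (Q : DyadicCube (Fin d)) : ℝ≥0∞ :=
  ∑ Q' ∈ Q.neighborFinset, ‖cubeAverage f Q' - cubeAverage f Q‖ₑ

/-- The sum of `|f_{Q'}|` over the neighbors `Q'` of `Q`. -/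
def neighborSum (f : Base d → ℂ) (Q : DyadicCube (Fin d)) : ℝ≥0∞ :=
  ∑ Q' ∈ Q.neighborFinset, ‖cubeAverage f Q'‖ₑ

/-- The terms of the series in the Besov norm, for equal exponents. -/
def besovTerm (s p : ℝ) (f : Base d → ℂ) (k : ℕ) : ℝ≥0∞ :=
  ENNReal.ofReal ((2 : ℝ) ^ ((k : ℝ) * s * p)) *
    ∑' m : Fin d → ℤ, volume (DyadicCube.toSet ⟨(k : ℤ), m⟩) *
      ∑' Q' : {Q' : DyadicCube (Fin d) // DyadicCube.Neighbor ⟨(k : ℤ), m⟩ Q'},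
        ‖(⨍ x in DyadicCube.toSet ⟨(k : ℤ), m⟩, f x) - ⨍ x in Q'.1.toSet, f x‖ₑ ^ p

lemma besovNorm_eq {s p : ℝ} (hp : 1 ≤ p) (f : Base d → ℂ) : besovNorm s p p volume f =
    eLpNorm f (ENNReal.ofReal p) volume + (∑' k : ℕ, besovTerm s p f k) ^ (1 / p) := by
  rw [besovNorm, div_self (by linarith)]
  simp only [ENNReal.rpow_one, besovTerm]

lemma lintegral_containing (k : ℤ) (h : DyadicCube (Fin d) → ℝ≥0∞) :
    ∫⁻ x, h (containing k x) =
      ∑' m : Fin d → ℤ, volume (⟨k, m⟩ : DyadicCube (Fin d)).toSet * h ⟨k, m⟩ := by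
  rw [lintegral_eq_tsum (volume : Measure (Base d)) k]
  congr 1 with m
  refine (setLIntegral_congr_fun (g := fun _ => h ⟨k, m⟩) (measurableSet_toSet _)
    fun x hx => ?_).trans ?_
  · exact congrArg h (mem_toSet_iff.1 hx)
  · rw [setLIntegral_const, mul_comm]

/-- The bound of the number of neighbors, to the power `p - 1`. -/
def powBound (d : ℕ) (p : ℝ) : ℝ≥0∞ := (neighborBound (Fin d) : ℝ≥0∞) ^ (p - 1)

lemma powBound_ne_top {p : ℝ} (hp : 1 ≤ p) : powBound d p ≠ ⊤ :=
  ENNReal.rpow_ne_top_of_nonneg (by linarith) (by simp)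

lemma rpow_sum_neighborFinset_le {p : ℝ} (hp : 1 ≤ p) (Q : DyadicCube (Fin d))
    (g : DyadicCube (Fin d) → ℝ≥0∞) :
    (∑ Q' ∈ Q.neighborFinset, g Q') ^ p ≤ powBound d p * ∑ Q' ∈ Q.neighborFinset, g Q' ^ p := by
  refine (ENNReal.rpow_sum_le_const_mul_sum_rpow _ _ hp).trans (mul_le_mul' ?_ le_rfl)
  refine ENNReal.rpow_le_rpow ?_ (by linarith)
  exact_mod_cast Q.card_neighborFinset_le

lemma lintegral_oscillation_rpow_le {s p : ℝ} (hp : 1 ≤ p) (f : Base d → ℂ) (k : ℕ) :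
    2 ^ ((k : ℝ) * (s * p)) * ∫⁻ x, neighborOsc f (containing (k : ℤ) x) ^ p ≤
      powBound d p * besovTerm s p f k := by
  have e : (2 : ℝ≥0∞) ^ ((k : ℝ) * (s * p)) = ENNReal.ofReal ((2 : ℝ) ^ ((k : ℝ) * s * p)) := by
    rw [ofReal_two_rpow, mul_assoc]
  rw [lintegral_containing (k : ℤ) fun Q => neighborOsc f Q ^ p, besovTerm, e, mul_left_comm]
  refine mul_le_mul' le_rfl ?_
  rw [← ENNReal.tsum_mul_left]
  refine ENNReal.tsum_le_tsum fun m => ?_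
  rw [mul_left_comm]
  refine mul_le_mul' le_rfl ((rpow_sum_neighborFinset_le hp _ _).trans_eq ?_)
  rw [tsum_neighbor ⟨(k : ℤ), m⟩ fun Q' => ‖(⨍ x in DyadicCube.toSet ⟨(k : ℤ), m⟩, f x) -
    ⨍ x in Q'.toSet, f x‖ₑ ^ p]
  congr 1
  refine Finset.sum_congr rfl fun Q' _ => ?_
  rw [cubeAverage, cubeAverage, ← enorm_neg, neg_sub]

lemma enorm_cubeAverage_rpow_le {p : ℝ} (hp : 1 ≤ p) {f : Base d → ℂ}
    (hf : LocallyIntegrable f volume) (Q : DyadicCube (Fin d)) :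
    ‖cubeAverage f Q‖ₑ ^ p ≤ 2 ^ ((Q.level : ℝ) * d) * ∫⁻ x in Q.toSet, ‖f x‖ₑ ^ p := by
  have hp0 : 0 ≤ p := by linarith
  have h1 : ‖cubeAverage f Q‖ₑ ≤ (volume Q.toSet)⁻¹ * ∫⁻ x in Q.toSet, ‖f x‖ₑ := by
    simpa only [sub_zero, cubeAverage] using enorm_average_sub_le Q.volume_toSet_ne_zero
      Q.volume_toSet_ne_top (integrableOn_toSet hf Q) 0
  have h2 := rpow_lintegral_le (volume.restrict Q.toSet) hp hf.aestronglyMeasurable.enorm.restrict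
  rw [Measure.restrict_apply_univ] at h2
  refine (ENNReal.rpow_le_rpow h1 hp0).trans ?_
  rw [ENNReal.mul_rpow_of_nonneg _ _ hp0]
  refine (mul_le_mul' le_rfl h2).trans_eq ?_
  rw [← mul_assoc, volume_toSet, Fintype.card_fin, two_rpow_inv, ← ENNReal.rpow_mul,
    ← ENNReal.rpow_mul, two_rpow_mul]
  congr 2; ring

lemma lintegral_neighborSum_rpow_le {p : ℝ} (hp : 1 ≤ p) {f : Base d → ℂ}
    (hf : LocallyIntegrable f volume) (k : ℤ) :
    ∫⁻ x, neighborSum f (containing k x) ^ p ≤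
      powBound d p * neighborBound (Fin d) * 2 ^ (d : ℝ) * 5 ^ d * ∫⁻ x, ‖f x‖ₑ ^ p := by
  have hpt : ∀ Q : DyadicCube (Fin d), neighborSum f Q ^ p ≤
      powBound d p * neighborBound (Fin d) * 2 ^ (d : ℝ) *
        (2 ^ ((Q.level : ℝ) * d) * ∫⁻ x in Q.enlarge 2, ‖f x‖ₑ ^ p) := by
    intro Q
    refine (rpow_sum_neighborFinset_le hp _ _).trans ?_
    rw [mul_assoc, mul_assoc]
    refine mul_le_mul' le_rfl ?_
    refine (Finset.sum_le_card_nsmul _ _ (2 ^ (d : ℝ) *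
        (2 ^ ((Q.level : ℝ) * d) * ∫⁻ x in Q.enlarge 2, ‖f x‖ₑ ^ p)) fun Q' hQ' => ?_).trans ?_
    · have hN := mem_neighborFinset.1 hQ'
      refine (enorm_cubeAverage_rpow_le hp hf Q').trans ?_
      rw [← mul_assoc, two_rpow_mul]
      refine mul_le_mul' (two_rpow_le ?_) (lintegral_mono_set hN.subset_enlarge)
      have h0 : (0 : ℝ) ≤ d := Nat.cast_nonneg d
      have h1 : (Q'.level : ℝ) ≤ Q.level + 1 := by
        have := hN.level_eq
        exact_mod_cast (by omega : Q'.level ≤ Q.level + 1)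
      nlinarith
    · rw [nsmul_eq_mul]
      refine mul_le_mul' ?_ le_rfl
      exact_mod_cast Q.card_neighborFinset_le
  calc ∫⁻ x, neighborSum f (containing k x) ^ p
      ≤ ∫⁻ x : Base d, powBound d p * neighborBound (Fin d) * 2 ^ (d : ℝ) *
          (2 ^ ((k : ℝ) * d) * ∫⁻ z in (containing k x).enlarge 2, ‖f z‖ₑ ^ p) :=
        lintegral_mono fun x => hpt (containing k x)
    _ = powBound d p * neighborBound (Fin d) * 2 ^ (d : ℝ) *
          ∑' m : Fin d → ℤ, ∫⁻ z in (enlarge ⟨k, m⟩ 2), ‖f z‖ₑ ^ p := by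
        rw [lintegral_const_mul _ (measurable_comp_containing (fun Q : DyadicCube (Fin d) =>
          2 ^ ((k : ℝ) * d) * ∫⁻ z in Q.enlarge 2, ‖f z‖ₑ ^ p) k),
          lintegral_containing k (fun Q : DyadicCube (Fin d) =>
            2 ^ ((k : ℝ) * d) * ∫⁻ z in Q.enlarge 2, ‖f z‖ₑ ^ p)]
        congr 2 with m
        rw [volume_toSet, ← mul_assoc, two_rpow_mul, Fintype.card_fin]
        simp
    _ ≤ powBound d p * neighborBound (Fin d) * 2 ^ (d : ℝ) * (5 ^ d * ∫⁻ x, ‖f x‖ₑ ^ p) := by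
        refine mul_le_mul' le_rfl ?_
        have h := tsum_lintegral_enlarge_le (volume : Measure (Base d)) measurable_id k 2 univ
          fun z => ‖f z‖ₑ ^ p
        simp only [preimage_id, inter_univ, Measure.restrict_univ] at h
        refine h.trans_eq ?_
        norm_num
    _ = _ := by ring

/-- The averages over the dyadic cubes converge almost everywhere. -/
lemma ae_tendsto_cubeAverage {f : Base d → ℂ} (hf : LocallyIntegrable f volume) :
    ∀ᵐ x, Tendsto (fun k : ℕ => cubeAverage f (containing (k : ℤ) x)) atTop (𝓝 (f x)) := by
  filter_upwards [ae_tendsto_lebesgue hf] with x hx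
  set r : ℕ → ℝ := fun k => (d + 1) * 2 ^ (-(k : ℤ)) with hr
  have hr0 : ∀ k, 0 < r k := fun k => by simp only [hr]; positivity
  have hrt : Tendsto r atTop (𝓝[>] 0) := by
    refine tendsto_nhdsWithin_iff.2 ⟨?_, .of_forall hr0⟩
    have h1 : Tendsto (fun k : ℕ => (1 / 2 : ℝ) ^ k) atTop (𝓝 0) :=
      tendsto_pow_atTop_nhds_zero_of_lt_one (by norm_num) (by norm_num)
    have h2 := h1.const_mul ((d : ℝ) + 1)
    rw [mul_zero] at h2
    refine h2.congr fun k => ?_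
    simp [hr]
  have h1 := ENNReal.Tendsto.const_mul (a := ENNReal.ofReal (d + 1) ^ (d : ℝ)) (hx.comp hrt)
    (Or.inr (ENNReal.rpow_ne_top_of_nonneg (by positivity) ENNReal.ofReal_ne_top))
  rw [mul_zero] at h1
  rw [tendsto_iff_edist_tendsto_0]
  refine tendsto_of_tendsto_of_tendsto_of_le_of_le tendsto_const_nhds h1
    (fun _ => zero_le) fun k => ?_
  set Q := containing (k : ℤ) x
  have hsub : Q.toSet ⊆ Metric.ball x (r k) := by
    intro z hz
    rw [Metric.mem_ball, dist_eq_norm]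
    have h3 := norm_sub_le_of_mem_enlarge (a := 0)
      (by rw [enlarge_zero]; exact mem_toSet_containing (k : ℤ) x)
      (by rw [enlarge_zero]; exact hz)
    refine h3.trans_lt ?_
    rw [edge_containing, Fintype.card_fin]
    simp only [hr, Nat.cast_zero, mul_zero, add_zero, one_mul]
    have : (0 : ℝ) < 2 ^ (-(k : ℤ)) := by positivity
    linarith
  simp only [Function.comp_apply]
  rw [edist_eq_enorm_sub, cubeAverage]
  refine (enorm_average_sub_le Q.volume_toSet_ne_zero Q.volume_toSet_ne_top
    (integrableOn_toSet hf Q) (f x)).trans ?_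
  refine (mul_le_mul' le_rfl (lintegral_mono_set hsub)).trans_eq ?_
  rw [← mul_assoc]
  congr 1
  have hd1 : ENNReal.ofReal ((d : ℝ) + 1) ≠ 0 := by
    simp only [ne_eq, ENNReal.ofReal_eq_zero, not_le]; positivity
  simp only [hr]
  rw [ENNReal.ofReal_mul (by positivity), ENNReal.mul_rpow_of_ne_top ENNReal.ofReal_ne_top
    ENNReal.ofReal_ne_top, ← mul_assoc, ← ENNReal.rpow_add _ _ hd1 ENNReal.ofReal_ne_top,
    volume_toSet, two_rpow_inv, ofReal_two_zpow, ← ENNReal.rpow_mul, Fintype.card_fin]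
  simp [Q]

/-- The integrals of the oscillations over a unit cube decay geometrically. -/
lemma lintegral_oscillation_le {s p : ℝ} (hp : 1 ≤ p) {f : Base d → ℂ} {Q : DyadicCube (Fin d)}
    (hQ : Q.level = 0) (k : ℕ) :
    ∫⁻ x in Q.toSet, neighborOsc f (containing (k : ℤ) x) ≤
      (powBound d p * ∑' i, besovTerm s p f i) ^ (1 / p) * 2 ^ (-(k : ℝ) * s) := by
  have hp0 : 0 < p := by linarith
  rw [← ENNReal.rpow_le_rpow_iff hp0, ENNReal.mul_rpow_of_nonneg _ _ hp0.le, ← ENNReal.rpow_mul,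
    one_div_mul_cancel hp0.ne', ENNReal.rpow_one]
  have hm : Measurable fun x : Base d => neighborOsc f (containing (k : ℤ) x) :=
    measurable_comp_containing (fun Q => neighborOsc f Q) k
  have hv : volume Q.toSet = 1 := by simp [volume_toSet, hQ]
  have h1 := rpow_lintegral_le (volume.restrict Q.toSet) hp hm.aemeasurable
  rw [Measure.restrict_apply_univ, hv, ENNReal.one_rpow, one_mul] at h1
  have h2 := lintegral_oscillation_rpow_le (s := s) hp f k
  calc _ ≤ ∫⁻ x, neighborOsc f (containing (k : ℤ) x) ^ p :=
        h1.trans (setLIntegral_le_lintegral _ _)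
    _ = (2 ^ ((k : ℝ) * (s * p)) * ∫⁻ x, neighborOsc f (containing (k : ℤ) x) ^ p) *
          (2 ^ (-(k : ℝ) * s)) ^ p := by
        rw [mul_right_comm, ← ENNReal.rpow_mul, two_rpow_mul]
        have : (k : ℝ) * (s * p) + -(k : ℝ) * s * p = 0 := by ring
        rw [this, ENNReal.rpow_zero, one_mul]
    _ ≤ _ := mul_le_mul' (h2.trans (mul_le_mul' le_rfl (ENNReal.le_tsum k))) le_rfl

lemma enorm_cubeAverage_succ_sub_le (f : Base d → ℂ) (k : ℤ) (x : Base d) :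
    ‖cubeAverage f (containing (k + 1) x) - cubeAverage f (containing k x)‖ₑ ≤
      neighborOsc f (containing k x) :=
  Finset.single_le_sum (f := fun Q' => ‖cubeAverage f Q' - cubeAverage f (containing k x)‖ₑ)
    (fun _ _ => zero_le) (mem_neighborFinset.2 (neighbor_containing_succ k x))

/-- The distance between a function of the Besov space and its dyadic averages. -/
lemma lintegral_cubeAverage_sub_le {s p : ℝ} (hp : 1 ≤ p) {f : Base d → ℂ}
    (hf : LocallyIntegrable f volume) {Q : DyadicCube (Fin d)} (hQ : Q.level = 0) (k : ℕ) :
    ∫⁻ x in Q.toSet, ‖cubeAverage f (containing (k : ℤ) x) - f x‖ₑ ≤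
      (powBound d p * ∑' i, besovTerm s p f i) ^ (1 / p) * geomSum s * 2 ^ (-(k : ℝ) * s) := by
  have hm : ∀ i : ℕ, Measurable fun x : Base d => neighborOsc f (containing (k + i : ℤ) x) :=
    fun i => measurable_comp_containing (fun Q => neighborOsc f Q) _
  calc ∫⁻ x in Q.toSet, ‖cubeAverage f (containing (k : ℤ) x) - f x‖ₑ
      ≤ ∫⁻ x in Q.toSet, ∑' i : ℕ, neighborOsc f (containing (k + i : ℤ) x) := by
        refine lintegral_mono_ae ?_
        filter_upwards [ae_restrict_of_ae (ae_tendsto_cubeAverage hf)] with x hx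
        have h1 : Tendsto (fun i : ℕ => cubeAverage f (containing (k + i : ℤ) x)) atTop
            (𝓝 (f x)) := by
          refine (hx.comp (tendsto_add_atTop_nat k)).congr fun i => ?_
          simp only [Function.comp_apply]
          push_cast
          rw [add_comm]
        have h2 := edist_le_tsum_of_edist_le_of_tendsto₀
          (fun i : ℕ => neighborOsc f (containing (k + i : ℤ) x)) (fun i => ?_) h1
        · simpa [edist_eq_enorm_sub] using h2
        · rw [edist_comm, edist_eq_enorm_sub]
          push_cast
          rw [← add_assoc]
          exact enorm_cubeAverage_succ_sub_le f (k + i) x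
    _ = ∑' i : ℕ, ∫⁻ x in Q.toSet, neighborOsc f (containing (k + i : ℤ) x) :=
        lintegral_tsum fun i => (hm i).aemeasurable
    _ ≤ ∑' i : ℕ, (powBound d p * ∑' i, besovTerm s p f i) ^ (1 / p) *
          2 ^ (-((k : ℝ) + i) * s) := by
        refine ENNReal.tsum_le_tsum fun i => ?_
        have := lintegral_oscillation_le (s := s) hp (f := f) hQ (k + i)
        push_cast at this
        exact this
    _ = _ := by rw [ENNReal.tsum_mul_left, tsum_two_rpow_add]; ring

end Oscillation

/-! ### Norm estimates of the Whitney extension -/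

section Layers

open DyadicCube

variable {d n : ℕ}

/-- The layer of all points whose height, in the maximum norm, is between `2^{-k}` and
`2 · 2^{-k}`. -/
def layer (k : ℤ) : Set (Ambient d n) := {X | (2 : ℝ) ^ (-k) ≤ vsup X ∧ vsup X < 2 * 2 ^ (-k)}

lemma measurableSet_layer (k : ℤ) : MeasurableSet (layer k : Set (Ambient d n)) :=
  (measurableSet_le measurable_const continuous_vsup.measurable).inter
    (measurableSet_lt continuous_vsup.measurable measurable_const)

/-- The height `2^{-k}` itself has to be excluded in the partition of unity, as a point of this
height need not lie in a Whitney cube of level `k`: the cubes are half-open. -/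
lemma ae_vsup_ne {r : ℝ} (hr : r ≠ 0) : ∀ᵐ X : Ambient d n, vsup X ≠ r := by
  have h1 : Measure.QuasiMeasurePreserving
      (fun X : Ambient d n => WithLp.ofLp (ver X)) volume volume :=
    (PiLp.volume_preserving_ofLp (Fin n)).quasiMeasurePreserving.comp quasiMeasurePreserving_ver
  have h2 : ∀ᵐ y : Fin n → ℝ, y ∉ Metric.sphere (0 : Fin n → ℝ) r :=
    measure_eq_zero_iff_ae_notMem.1 (Measure.addHaar_sphere_of_ne_zero volume 0 hr)
  filter_upwards [h1.ae h2] with X hX h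
  exact hX (mem_sphere_zero_iff_norm.2 h)

lemma rpow_le_of_inv_mul_le_of_le_mul {a u w : ℝ≥0∞} (ha : 1 ≤ a) (hat : a ≠ ⊤) (h1 : u ≤ a * w)
    (h2 : w ≤ a * u) (β : ℝ) : w ^ β ≤ a ^ |β| * u ^ β := by
  rcases le_total 0 β with h | h
  · rw [abs_of_nonneg h, ← ENNReal.mul_rpow_of_nonneg _ _ h]
    exact ENNReal.rpow_le_rpow h2 h
  · have hb : 0 ≤ -β := by linarith
    have h3 := ENNReal.rpow_le_rpow h1 hb
    rw [ENNReal.mul_rpow_of_nonneg _ _ hb] at h3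
    have h4 := ENNReal.inv_le_inv.2 h3
    have ha0 : a ^ (-β) ≠ 0 := by
      have : a ≠ 0 := fun h => by simp [h] at ha
      simp [ENNReal.rpow_eq_zero_iff, this, hat]
    have hat' : a ^ (-β) ≠ ⊤ := ENNReal.rpow_ne_top_of_nonneg hb hat
    rw [ENNReal.mul_inv (Or.inl ha0) (Or.inl hat'), ← ENNReal.rpow_neg w, ← ENNReal.rpow_neg u,
      neg_neg] at h4
    rw [abs_of_nonpos h]
    calc w ^ β = a ^ (-β) * ((a ^ (-β))⁻¹ * w ^ β) := by
          rw [← mul_assoc, ENNReal.mul_inv_cancel ha0 hat', one_mul]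
      _ ≤ _ := mul_le_mul' le_rfl h4

lemma norm_ver_lt_of_mem_layer (hn : 1 ≤ n) {k : ℤ} {X : Ambient d n} (hX : X ∈ layer k) :
    ‖ver X‖ < 2 * n * 2 ^ (-k) := by
  have h1 := norm_ver_le_vsup X
  have h2 := hX.2
  have hn' : (1 : ℝ) ≤ n := by exact_mod_cast hn
  nlinarith

lemma wt_rpow_le_of_mem_layer (hn : 1 ≤ n) (β : ℝ) {k : ℤ} (hk : -1 ≤ k) {X : Ambient d n}
    (hX : X ∈ layer k) : wt X ^ β ≤ (2 * n) ^ |β| * 2 ^ (-(k : ℝ) * β) := by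
  have hn1 : (1 : ℝ≥0∞) ≤ n := by exact_mod_cast hn
  have e : (2 : ℝ≥0∞) ^ (-(k : ℝ) * β) = (2 ^ (-(k : ℝ))) ^ β := ENNReal.rpow_mul _ _ _
  rw [e]
  refine rpow_le_of_inv_mul_le_of_le_mul (one_le_mul (by norm_num) hn1)
    (ENNReal.mul_ne_top (by simp) (by simp)) ?_ ?_ β
  · have h2n : (2 : ℝ≥0∞) ≤ 2 * n := le_mul_of_one_le_right' hn1
    refine le_trans ?_ (mul_le_mul' h2n le_rfl)
    rw [wt, mul_min, mul_one]
    refine le_min ?_ ?_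
    · calc (2 : ℝ≥0∞) ^ (-(k : ℝ)) ≤ 2 ^ (1 : ℝ) := by
            refine two_rpow_le ?_
            have : (-1 : ℝ) ≤ k := by exact_mod_cast hk
            linarith
        _ = 2 := ENNReal.rpow_one _
    · have h3 : (2 : ℝ≥0∞) ^ (-(k : ℝ)) ≤ ‖ver X‖ₑ := by
        have : -(k : ℝ) = ((-k : ℤ) : ℝ) := by push_cast; rfl
        rw [this, ← ofReal_two_zpow, ← ofReal_norm]
        exact ENNReal.ofReal_le_ofReal (hX.1.trans (vsup_le_norm_ver X))
      exact h3.trans (le_mul_of_one_le_left' (by norm_num))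
  · refine (min_le_right _ _).trans ?_
    have : -(k : ℝ) = ((-k : ℤ) : ℝ) := by push_cast; rfl
    rw [this, ← ofReal_two_zpow, ← ofReal_norm]
    refine (ENNReal.ofReal_le_ofReal (norm_ver_lt_of_mem_layer hn hX).le).trans_eq ?_
    rw [ENNReal.ofReal_mul (by positivity), ENNReal.ofReal_mul (by positivity)]
    simp

/-- The constant in the estimate of weighted integrals over layers. -/
def layerConst (n : ℕ) (β : ℝ) : ℝ≥0∞ :=
  (2 * n) ^ |β| * volume (Metric.ball (0 : EuclideanSpace ℝ (Fin n)) (2 * n))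

lemma layerConst_ne_top (β : ℝ) : layerConst n β ≠ ⊤ :=
  ENNReal.mul_ne_top (ENNReal.rpow_ne_top_of_nonneg (abs_nonneg _)
    (ENNReal.mul_ne_top (by simp) (by simp))) measure_ball_lt_top.ne

/-- On a layer the weight is comparable to `2 ^ (-k)`, and the fibres have measure `2 ^ (-k n)`. -/
lemma lintegral_layer_le (hn : 1 ≤ n) (β : ℝ) {k : ℤ} (hk : -1 ≤ k) {S : Set (Base d)}
    (hS : MeasurableSet S) {g : Base d → ℝ≥0∞} (hg : AEMeasurable g volume) :
    ∫⁻ X in hor ⁻¹' S ∩ (layer k : Set (Ambient d n)), wt X ^ β * g (hor X) ≤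
      layerConst n β * 2 ^ (-(k : ℝ) * (β + n)) * ∫⁻ x in S, g x := by
  have hgm : AEMeasurable (fun X : Ambient d n => g (hor X)) volume :=
    hg.comp_quasiMeasurePreserving quasiMeasurePreserving_hor
  have hc : (2 * n : ℝ≥0∞) ^ |β| * 2 ^ (-(k : ℝ) * β) ≠ ⊤ :=
    ENNReal.mul_ne_top (ENNReal.rpow_ne_top_of_nonneg (abs_nonneg _)
      (ENNReal.mul_ne_top (by simp) (by simp))) (two_rpow_ne_top _)
  calc ∫⁻ X in hor ⁻¹' S ∩ (layer k : Set (Ambient d n)), wt X ^ β * g (hor X)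
      ≤ ∫⁻ X in hor ⁻¹' S ∩ (layer k : Set (Ambient d n)),
          (2 * n) ^ |β| * 2 ^ (-(k : ℝ) * β) * g (hor X) :=
        setLIntegral_mono' ((measurable_hor hS).inter (measurableSet_layer k)) fun X hX =>
          mul_le_mul' (wt_rpow_le_of_mem_layer hn β hk hX.2) le_rfl
    _ ≤ ∫⁻ X in (slab S (2 * n * 2 ^ (-k)) : Set (Ambient d n)),
          (2 * n) ^ |β| * 2 ^ (-(k : ℝ) * β) * g (hor X) :=
        lintegral_mono_set fun X hX => ⟨hX.1, norm_ver_lt_of_mem_layer hn hX.2⟩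
    _ = (2 * n) ^ |β| * 2 ^ (-(k : ℝ) * β) * ((∫⁻ x in S, g x) *
          volume (Metric.ball (0 : EuclideanSpace ℝ (Fin n)) (2 * n * 2 ^ (-k)))) := by
        rw [lintegral_const_mul' _ _ hc, lintegral_slab hS _ _ hgm]
        simp only [hor_join, setLIntegral_const]
        rw [lintegral_mul_const' _ _ measure_ball_lt_top.ne]
    _ = _ := by
        rw [mul_comm (2 * (n : ℝ)), Measure.addHaar_ball_mul_of_pos _ _ (by positivity),
          finrank_euclideanSpace_fin, ENNReal.ofReal_pow (by positivity), ofReal_two_zpow,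
          ← ENNReal.rpow_natCast, ← ENNReal.rpow_mul, layerConst]
        have e : (2 : ℝ≥0∞) ^ (-(k : ℝ) * (β + n)) =
            2 ^ (-(k : ℝ) * β) * 2 ^ (((-k : ℤ) : ℝ) * n) := by
          rw [two_rpow_mul]; congr 1; push_cast; ring
        rw [e]; ring

lemma exists_mem_layer {X : Ambient d n} (hX : ver X ≠ 0) : ∃ k : ℤ, X ∈ layer k := by
  obtain ⟨k, h1, h2, -⟩ := exists_mem_reach hX
  exact ⟨k, h1, h2⟩

lemma reach_of_mem_layer {k : ℤ} {X : Ambient d n} (hX : X ∈ layer k) :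
    X ∈ reach (containing k (hor X)) :=
  mem_reach (mem_toSet_containing _ _) hX.1 hX.2

lemma lt_of_mem_layer {j k : ℤ} {X : Ambient d n} (hX : X ∈ layer k) (h : vsup X < 2 ^ (-j)) :
    j < k := by
  have := (zpow_lt_zpow_iff_right₀ one_lt_two).1 (hX.1.trans_lt h)
  omega

/-- The energy of a function supported at heights below `4` is bounded by the sum over the layers of
level at least `-1`. -/
lemma energy_le_tsum (hn : 1 ≤ n) {E : Type*} [NormedAddCommGroup E] {p α : ℝ} (hp : 1 ≤ p)
    {F : Ambient d n → E} (hF : ∀ X, 4 ≤ vsup X → F X = 0) :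
    energy p α F ≤ ∑' j : ℕ, ∫⁻ X in layer ((j : ℤ) - 1), wt X ^ α * ‖F X‖ₑ ^ p := by
  have hU : MeasurableSet (⋃ j : ℕ, (layer ((j : ℤ) - 1) : Set (Ambient d n))) :=
    MeasurableSet.iUnion fun j => measurableSet_layer _
  refine le_trans ?_ (lintegral_iUnion_le _ _)
  rw [energy, ← lintegral_indicator hU]
  refine lintegral_mono_ae ?_
  filter_upwards [ae_ver_ne_zero (d := d) hn] with X hX
  by_cases h4 : 4 ≤ vsup X
  · rw [hF X h4, enorm_zero, ENNReal.zero_rpow_of_pos (by linarith), mul_zero]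
    exact zero_le
  · obtain ⟨k, hk⟩ := exists_mem_layer hX
    have h1 : -2 < k := lt_of_mem_layer hk (by norm_num; linarith)
    have h2 : X ∈ ⋃ j : ℕ, (layer ((j : ℤ) - 1) : Set (Ambient d n)) := by
      refine mem_iUnion.2 ⟨(k + 1).toNat, ?_⟩
      have : (((k + 1).toNat : ℕ) : ℤ) - 1 = k := by omega
      rwa [this]
    rw [indicator_of_mem h2]

end Layers

section Extension

open DyadicCube

variable {d n : ℕ} {ψ : DyadicCube (Fin d ⊕ Fin n) → Ambient d n → ℝ}

lemma whitneyExtension_eq_patch (hψ : IsWhitneyBumpFamily d n ψ) (f : Base d → ℂ)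
    {Q : DyadicCube (Fin d)} {X : Ambient d n} (hX : X ∈ reach Q) :
    whitneyExtension ψ f X = patch ψ Q (cubeAverage f) X :=
  tsum_eq_patch hψ hX (cubeAverage f)

lemma whitneyExtension_eventuallyEq (hψ : IsWhitneyBumpFamily d n ψ) (f : Base d → ℂ)
    {Q : DyadicCube (Fin d)} {X : Ambient d n} (hX : X ∈ reach Q) :
    whitneyExtension ψ f =ᶠ[𝓝 X] patch ψ Q (cubeAverage f) := by
  filter_upwards [(isOpen_reach Q).mem_nhds hX] with Y hY
  exact whitneyExtension_eq_patch hψ f hY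

/-- The Whitney extension is smooth away from the subspace. -/
lemma contDiffAt_whitneyExtension (hψ : IsWhitneyBumpFamily d n ψ) (f : Base d → ℂ)
    {X : Ambient d n} (hX : ver X ≠ 0) : ContDiffAt ℝ ∞ (whitneyExtension ψ f) X := by
  obtain ⟨k, -, -, h⟩ := exists_mem_reach hX
  exact (contDiff_patch hψ _ _).contDiffAt.congr_of_eventuallyEq
    (whitneyExtension_eventuallyEq hψ f h)

lemma patch_eq_zero {Q : DyadicCube (Fin d)} (hQ : Q.level ≤ -2) (c : DyadicCube (Fin d) → ℂ)
    (X : Ambient d n) : patch ψ Q c X = 0 := by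
  refine Finset.sum_eq_zero fun Q' hQ' => ?_
  obtain ⟨h1, h2⟩ := Finset.mem_filter.1 hQ'
  have := (mem_neighborFinset.1 h1).level_eq
  omega

lemma whitneyExtension_eventuallyEq_zero (hψ : IsWhitneyBumpFamily d n ψ) (f : Base d → ℂ)
    {X : Ambient d n} (hX : 4 ≤ vsup X) : whitneyExtension ψ f =ᶠ[𝓝 X] 0 := by
  have hv : ver X ≠ 0 := fun h => by
    rw [vsup_eq_zero_iff.2 h] at hX; norm_num at hX
  obtain ⟨k, h1, h2, h3⟩ := exists_mem_reach hv
  have hk : k ≤ -2 := by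
    have h4 : (2 : ℝ) ^ (2 : ℤ) < 2 ^ (-k + 1) := by
      rw [zpow_add_one₀ two_ne_zero, mul_comm]
      exact lt_of_le_of_lt (by norm_num; exact hX) h2
    have := (zpow_lt_zpow_iff_right₀ one_lt_two).1 h4
    omega
  filter_upwards [whitneyExtension_eventuallyEq hψ f h3] with Y hY
  rw [hY, patch_eq_zero (by simpa using hk)]
  rfl

/-- The gradient of the Whitney extension. -/
def extensionGradient (ψ : DyadicCube (Fin d ⊕ Fin n) → Ambient d n → ℝ) (f : Base d → ℂ)
    (X : Ambient d n) : EuclideanSpace ℂ (Fin d ⊕ Fin n) :=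
  WithLp.toLp 2 fun i => fderiv ℝ (whitneyExtension ψ f) X (EuclideanSpace.single i 1)

lemma enorm_extensionGradient_le (f : Base d → ℂ) (X : Ambient d n) :
    ‖extensionGradient ψ f X‖ₑ ≤ (d + n) * ‖fderiv ℝ (whitneyExtension ψ f) X‖ₑ := by
  have h1 : ‖extensionGradient ψ f X‖ ≤ ∑ i, ‖extensionGradient ψ f X i‖ := by
    rw [EuclideanSpace.norm_eq]
    refine Real.sqrt_le_iff.2 ⟨by positivity, ?_⟩
    exact Finset.sum_sq_le_sq_sum_of_nonneg fun i _ => norm_nonneg _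
  have h2 : ‖extensionGradient ψ f X‖ ≤ (d + n) * ‖fderiv ℝ (whitneyExtension ψ f) X‖ := by
    refine h1.trans ((Finset.sum_le_card_nsmul _ _
      ‖fderiv ℝ (whitneyExtension ψ f) X‖ fun i _ => ?_).trans_eq ?_)
    · refine ((fderiv ℝ (whitneyExtension ψ f) X).le_opNorm _).trans_eq ?_
      simp
    · simp
  rw [← ofReal_norm, ← ofReal_norm]
  refine (ENNReal.ofReal_le_ofReal h2).trans_eq ?_
  rw [ENNReal.ofReal_mul (by positivity), ENNReal.ofReal_add (by positivity) (by positivity)]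
  simp

lemma aestronglyMeasurable_whitneyExtension (hn : 1 ≤ n) (hψ : IsWhitneyBumpFamily d n ψ)
    (f : Base d → ℂ) : AEStronglyMeasurable (whitneyExtension ψ f) volume := by
  have ho : IsOpen {X : Ambient d n | ver X ≠ 0} :=
    isOpen_compl_singleton.preimage continuous_ver
  have hc : ContinuousOn (whitneyExtension ψ f) {X : Ambient d n | ver X ≠ 0} := fun X hX =>
    (contDiffAt_whitneyExtension hψ f hX).continuousAt.continuousWithinAt
  have h := hc.aestronglyMeasurable (μ := volume) ho.measurableSet
  have he : (volume : Measure (Ambient d n)).restrict {X | ver X ≠ 0} = volume :=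
    Measure.restrict_eq_self_of_ae_mem (ae_ver_ne_zero hn)
  rwa [he] at h

lemma aestronglyMeasurable_extensionGradient (f : Base d → ℂ) :
    AEStronglyMeasurable (extensionGradient ψ f) volume := by
  refine Measurable.aestronglyMeasurable ?_
  exact (PiLp.continuous_toLp 2 _).measurable.comp
    (measurable_pi_lambda _ fun i => measurable_fderiv_apply_const ℝ _ _)

section Pointwise

variable (hψ : IsWhitneyBumpFamily d n ψ) (f : Base d → ℂ) {k : ℤ} {X : Ambient d n}
include hψ

lemma enorm_whitneyExtension_le (hX : X ∈ layer k) :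
    ‖whitneyExtension ψ f X‖ₑ ≤ 5 ^ n * neighborSum f (containing k (hor X)) := by
  rw [whitneyExtension_eq_patch hψ f (reach_of_mem_layer hX)]
  exact enorm_patch_le hψ _ _ _

lemma whitneyExtension_sub_eventuallyEq (hk : 0 ≤ k) (hX : X ∈ layer k)
    (hX' : vsup X ≠ 2 ^ (-k)) (a : ℂ) : whitneyExtension ψ f =ᶠ[𝓝 X]
      fun Y => patch ψ (containing k (hor X)) (fun Q' => cubeAverage f Q' - a) Y + a := by
  have h1 : 2 ^ (-k) < vsup X := lt_of_le_of_ne hX.1 hX'.symm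
  have hr := reach_of_mem_layer hX
  filter_upwards [(isOpen_reach _).mem_nhds hr,
    (isOpen_lt continuous_const continuous_vsup).mem_nhds h1,
    (isOpen_lt continuous_vsup continuous_const).mem_nhds hX.2] with Y hY h2 h3
  rw [whitneyExtension_eq_patch hψ f hY, patch_sub, patch_one hψ hk h2 h3 hY]
  ring

lemma enorm_whitneyExtension_sub_le (hk : 0 ≤ k) (hX : X ∈ layer k) (hX' : vsup X ≠ 2 ^ (-k)) :
    ‖whitneyExtension ψ f X - cubeAverage f (containing k (hor X))‖ₑ ≤
      5 ^ n * neighborOsc f (containing k (hor X)) := by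
  rw [(whitneyExtension_sub_eventuallyEq hψ f hk hX hX'
    (cubeAverage f (containing k (hor X)))).self_of_nhds, add_sub_cancel_right]
  exact enorm_patch_le hψ _ _ _

variable {C : ℝ≥0} (hC : ∀ Q : UnitDyadicCube d, ∀ P ∈ whitneyCubes n Q.1, ∀ x y,
      |ψ P x - ψ P y| ≤ C / P.edge * dist x y)
include hC

lemma enorm_fderiv_whitneyExtension_le (hX : X ∈ layer k) :
    ‖fderiv ℝ (whitneyExtension ψ f) X‖ₑ ≤
      5 ^ n * (2 * C) * 2 ^ (k : ℝ) * neighborSum f (containing k (hor X)) := by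
  rw [(whitneyExtension_eventuallyEq hψ f (reach_of_mem_layer hX)).fderiv_eq]
  exact enorm_fderiv_patch_le hψ hC _ _ _

lemma enorm_fderiv_whitneyExtension_le_neighborOsc (hk : 0 ≤ k) (hX : X ∈ layer k)
    (hX' : vsup X ≠ 2 ^ (-k)) : ‖fderiv ℝ (whitneyExtension ψ f) X‖ₑ ≤
      5 ^ n * (2 * C) * 2 ^ (k : ℝ) * neighborOsc f (containing k (hor X)) := by
  rw [(whitneyExtension_sub_eventuallyEq hψ f hk hX hX'
    (cubeAverage f (containing k (hor X)))).fderiv_eq, fderiv_add_const]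
  exact enorm_fderiv_patch_le hψ hC _ _ _

end Pointwise

end Extension

section

open DyadicCube

variable {d n : ℕ} {ψ : DyadicCube (Fin d ⊕ Fin n) → Ambient d n → ℝ} {p α s : ℝ} {f : Base d → ℂ}

lemma lintegral_layer_rpow_le (hn : 1 ≤ n) {E : Type*} [NormedAddCommGroup E] (hp : 0 ≤ p) (α : ℝ)
    {k : ℤ} (hk : -1 ≤ k) {F : Ambient d n → E} {c : ℝ≥0∞} (hc : c ≠ ⊤) {g : Base d → ℝ≥0∞}
    (hg : Measurable g) (h : ∀ᵐ X, X ∈ layer k → ‖F X‖ₑ ≤ c * g (hor X)) :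
    ∫⁻ X in layer k, wt X ^ α * ‖F X‖ₑ ^ p ≤
      layerConst n α * 2 ^ (-(k : ℝ) * (α + n)) * (c ^ p * ∫⁻ x, g x ^ p) := by
  have hgp : Measurable fun x => g x ^ p := hg.pow_const p
  have h1 := lintegral_layer_le hn α hk MeasurableSet.univ (g := fun x => c ^ p * g x ^ p)
    (hgp.const_mul _).aemeasurable
  rw [preimage_univ, univ_inter, Measure.restrict_univ,
    lintegral_const_mul' _ _ (ENNReal.rpow_ne_top_of_nonneg hp hc)] at h1
  refine le_trans (setLIntegral_mono_ae' (measurableSet_layer k) ?_) h1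
  filter_upwards [h] with X hX hXk
  rw [← ENNReal.mul_rpow_of_nonneg _ _ hp]
  exact mul_le_mul' le_rfl (ENNReal.rpow_le_rpow (hX hXk) hp)

lemma measurable_neighborSum (f : Base d → ℂ) (k : ℤ) :
    Measurable fun x : Base d => neighborSum f (containing k x) :=
  measurable_comp_containing (fun Q => neighborSum f Q) k

lemma measurable_neighborOsc (f : Base d → ℂ) (k : ℤ) :
    Measurable fun x : Base d => neighborOsc f (containing k x) :=
  measurable_comp_containing (fun Q => neighborOsc f Q) k

/-- The constant in the comparison of the `L^p` norms of a function and of its averages over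
neighboring cubes. -/
def sumConst (d : ℕ) (p : ℝ) : ℝ≥0∞ :=
  powBound d p * neighborBound (Fin d) * 2 ^ (d : ℝ) * 5 ^ d

lemma sumConst_ne_top (hp : 1 ≤ p) : sumConst d p ≠ ⊤ :=
  ENNReal.mul_ne_top (ENNReal.mul_ne_top (ENNReal.mul_ne_top (powBound_ne_top hp) (by simp))
    (two_rpow_ne_top _)) (by simp)

/-- The constant in the bound of the `L^p` norm of the extension. -/
def extensionConst (d n : ℕ) (p α : ℝ) : ℝ≥0∞ :=
  layerConst n α * (5 ^ n) ^ p * sumConst d p * (2 ^ (α + n) * geomSum (α + n))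

lemma extensionConst_ne_top (hp : 1 ≤ p) (hα : 0 < α + n) : extensionConst d n p α ≠ ⊤ :=
  ENNReal.mul_ne_top (ENNReal.mul_ne_top (ENNReal.mul_ne_top (layerConst_ne_top α)
    (ENNReal.rpow_ne_top_of_nonneg (by linarith) (by simp))) (sumConst_ne_top hp))
    (ENNReal.mul_ne_top (two_rpow_ne_top _) (geomSum_ne_top hα))

lemma energy_whitneyExtension_le (hn : 1 ≤ n) (hp : 1 ≤ p) (hψ : IsWhitneyBumpFamily d n ψ)
    (hf : LocallyIntegrable f volume) :
    energy p α (whitneyExtension ψ f) ≤ extensionConst d n p α * ∫⁻ x, ‖f x‖ₑ ^ p := by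
  have hp0 : 0 ≤ p := by linarith
  have hstep : ∀ j : ℕ, ∫⁻ X in layer ((j : ℤ) - 1), wt X ^ α * ‖whitneyExtension ψ f X‖ₑ ^ p ≤
      layerConst n α * (5 ^ n) ^ p * sumConst d p * (∫⁻ x, ‖f x‖ₑ ^ p) *
        2 ^ (-((-1 : ℝ) + j) * (α + n)) := by
    intro j
    refine (lintegral_layer_rpow_le hn hp0 α (by omega) (c := 5 ^ n) (by simp)
      (measurable_neighborSum f ((j : ℤ) - 1))
      (.of_forall fun X hX => enorm_whitneyExtension_le hψ f hX)).trans ?_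
    refine (mul_le_mul' le_rfl (mul_le_mul' le_rfl
      (lintegral_neighborSum_rpow_le hp hf _))).trans_eq ?_
    have e : -(((j : ℤ) - 1 : ℤ) : ℝ) = -((-1 : ℝ) + j) := by push_cast; ring
    rw [e, sumConst]
    ring
  have hz : ∀ X : Ambient d n, 4 ≤ vsup X → whitneyExtension ψ f X = 0 := fun X hX =>
    (whitneyExtension_eventuallyEq_zero hψ f hX).self_of_nhds
  refine (energy_le_tsum hn hp hz).trans ((ENNReal.tsum_le_tsum hstep).trans_eq ?_)
  rw [ENNReal.tsum_mul_left, tsum_two_rpow_add, neg_neg, one_mul, extensionConst]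
  ring

/-- The constant in the bound of the `L^p` norm of the gradient of the extension. -/
def gradientConst (d n : ℕ) (p α : ℝ) (C : ℝ≥0) : ℝ≥0∞ :=
  layerConst n α * ((d + n) * (5 ^ n * (2 * C))) ^ p * (sumConst d p + powBound d p)

lemma gradientConst_ne_top (hp : 1 ≤ p) (C : ℝ≥0) : gradientConst d n p α C ≠ ⊤ := by
  refine ENNReal.mul_ne_top (ENNReal.mul_ne_top (layerConst_ne_top α)
    (ENNReal.rpow_ne_top_of_nonneg (by linarith) ?_))
    (ENNReal.add_ne_top.2 ⟨sumConst_ne_top hp, powBound_ne_top hp⟩)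
  exact ENNReal.mul_ne_top (by simp) (ENNReal.mul_ne_top (by simp)
    (ENNReal.mul_ne_top (by simp) (by simp)))

/-- The gradient is estimated through the oscillation of the averages over neighboring cubes on
the layers of height at most `2`, where the bump functions sum up to `1`, and through the averages
themselves on the remaining outermost layer. -/
lemma energy_extensionGradient_le (hn : 1 ≤ n) (hp : 1 ≤ p) (hs : 0 ≤ s)
    (hα : α + n = p * (1 - s)) (hψ : IsWhitneyBumpFamily d n ψ) {C : ℝ≥0}
    (hC : ∀ Q : UnitDyadicCube d, ∀ P ∈ whitneyCubes n Q.1, ∀ x y,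
      |ψ P x - ψ P y| ≤ C / P.edge * dist x y) (hf : LocallyIntegrable f volume) :
    energy p α (extensionGradient ψ f) ≤
      gradientConst d n p α C * ((∫⁻ x, ‖f x‖ₑ ^ p) + ∑' k, besovTerm s p f k) := by
  have hp0 : 0 ≤ p := by linarith
  set A : ℝ≥0∞ := (d + n) * (5 ^ n * (2 * C)) with hA
  have hAt : A ≠ ⊤ := ENNReal.mul_ne_top (by simp) (ENNReal.mul_ne_top (by simp)
    (ENNReal.mul_ne_top (by simp) (by simp)))
  have hz : ∀ X : Ambient d n, 4 ≤ vsup X → extensionGradient ψ f X = 0 := fun X hX => by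
    ext i
    simp [extensionGradient, (whitneyExtension_eventuallyEq_zero hψ f hX).fderiv_eq]
  -- The powers of `2` combine, since `p - (α + n) = p s`.
  have hpow : ∀ (k : ℤ) (I : ℝ≥0∞), layerConst n α * 2 ^ (-(k : ℝ) * (α + n)) *
      ((A * 2 ^ (k : ℝ)) ^ p * I) = layerConst n α * A ^ p * (2 ^ ((k : ℝ) * (s * p)) * I) := by
    intro k I
    have e : (2 : ℝ≥0∞) ^ ((k : ℝ) * (s * p)) =
        2 ^ (-(k : ℝ) * (α + n)) * (2 ^ (k : ℝ)) ^ p := by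
      rw [← ENNReal.rpow_mul, two_rpow_mul, hα]
      congr 1; ring
    rw [e, ENNReal.mul_rpow_of_nonneg _ _ hp0]
    ring
  have h0 : ∫⁻ X in layer (-1 : ℤ), wt X ^ α * ‖extensionGradient ψ f X‖ₑ ^ p ≤
      layerConst n α * A ^ p * (sumConst d p * ∫⁻ x, ‖f x‖ₑ ^ p) := by
    refine (lintegral_layer_rpow_le hn hp0 α le_rfl (c := A * 2 ^ ((-1 : ℤ) : ℝ))
      (ENNReal.mul_ne_top hAt (two_rpow_ne_top _)) (measurable_neighborSum f (-1))
      (.of_forall fun X hX => ?_)).trans ?_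
    · refine (enorm_extensionGradient_le f X).trans ((mul_le_mul' le_rfl
        (enorm_fderiv_whitneyExtension_le hψ f hC hX)).trans_eq ?_)
      rw [hA]; ring
    · rw [hpow]
      refine mul_le_mul' le_rfl ?_
      refine (mul_le_mul' (two_rpow_le (b := 0) ?_)
        (lintegral_neighborSum_rpow_le hp hf _)).trans_eq ?_
      · have := mul_nonneg hs hp0
        push_cast; linarith
      · rw [ENNReal.rpow_zero, one_mul, sumConst]
  have hstep : ∀ k : ℕ, ∫⁻ X in layer (k : ℤ), wt X ^ α * ‖extensionGradient ψ f X‖ₑ ^ p ≤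
      layerConst n α * A ^ p * (powBound d p * besovTerm s p f k) := by
    intro k
    refine (lintegral_layer_rpow_le hn hp0 α (by omega) (c := A * 2 ^ (((k : ℤ) : ℝ)))
      (ENNReal.mul_ne_top hAt (two_rpow_ne_top _)) (measurable_neighborOsc f (k : ℤ)) ?_).trans ?_
    · filter_upwards [ae_vsup_ne (d := d) (n := n) (r := 2 ^ (-(k : ℤ))) (by positivity)]
        with X hX' hX
      refine (enorm_extensionGradient_le f X).trans ((mul_le_mul' le_rfl
        (enorm_fderiv_whitneyExtension_le_neighborOsc hψ f hC (by omega) hX hX')).trans_eq ?_)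
      rw [hA]; ring
    · rw [hpow]
      exact mul_le_mul' le_rfl (lintegral_oscillation_rpow_le hp f k)
  refine (energy_le_tsum hn hp hz).trans ?_
  rw [tsum_eq_zero_add' ENNReal.summable]
  have e : ∀ j : ℕ, (((j + 1 : ℕ) : ℤ) - 1) = (j : ℤ) := fun j => by push_cast; ring
  simp only [e, Nat.cast_zero, zero_sub]
  refine (add_le_add h0 (ENNReal.tsum_le_tsum hstep)).trans ?_
  rw [ENNReal.tsum_mul_left, ENNReal.tsum_mul_left, ← mul_add, gradientConst, mul_assoc _ (_ + _)]
  refine mul_le_mul' le_rfl ?_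
  rw [add_mul, mul_add, mul_add]
  exact add_le_add le_self_add le_add_self

lemma eLpNorm_whitneyExtension_le (hn : 1 ≤ n) (hp : 1 ≤ p) (hψ : IsWhitneyBumpFamily d n ψ)
    (hf : LocallyIntegrable f volume) :
    eLpNorm (whitneyExtension ψ f) (ENNReal.ofReal p) (weightedMeasure d n α) ≤
      extensionConst d n p α ^ (1 / p) * besovNorm s p p volume f := by
  have hp0 : 0 < p := by linarith
  have h := energy_whitneyExtension_le (α := α) hn hp hψ hf
  rw [← eLpNorm_rpow_eq_energy hn hp, ← eLpNorm_rpow_eq_lintegral hp] at h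
  have h1 := ENNReal.rpow_le_rpow h (by positivity : 0 ≤ 1 / p)
  rw [ENNReal.mul_rpow_of_nonneg _ _ (by positivity), ← ENNReal.rpow_mul, ← ENNReal.rpow_mul,
    mul_one_div_cancel hp0.ne', ENNReal.rpow_one, ENNReal.rpow_one] at h1
  rw [besovNorm_eq hp]
  exact h1.trans (mul_le_mul' le_rfl le_self_add)

lemma eLpNorm_extensionGradient_le (hn : 1 ≤ n) (hp : 1 ≤ p) (hs : 0 ≤ s)
    (hα : α + n = p * (1 - s)) (hψ : IsWhitneyBumpFamily d n ψ) {C : ℝ≥0}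
    (hC : ∀ Q : UnitDyadicCube d, ∀ P ∈ whitneyCubes n Q.1, ∀ x y,
      |ψ P x - ψ P y| ≤ C / P.edge * dist x y) (hf : LocallyIntegrable f volume) :
    eLpNorm (extensionGradient ψ f) (ENNReal.ofReal p) (weightedMeasure d n α) ≤
      gradientConst d n p α C ^ (1 / p) * besovNorm s p p volume f := by
  have hp0 : 0 < p := by linarith
  have hp1 : 0 ≤ 1 / p := by positivity
  have h := energy_extensionGradient_le hn hp hs hα hψ hC hf
  rw [← eLpNorm_rpow_eq_energy hn hp, ← eLpNorm_rpow_eq_lintegral hp] at h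
  have h1 := ENNReal.rpow_le_rpow h hp1
  rw [ENNReal.mul_rpow_of_nonneg _ _ hp1, ← ENNReal.rpow_mul,
    mul_one_div_cancel hp0.ne', ENNReal.rpow_one] at h1
  refine h1.trans (mul_le_mul' le_rfl ?_)
  refine (ENNReal.rpow_add_le_add_rpow _ _ hp1 ?_).trans_eq ?_
  · rw [div_le_one hp0]; exact hp
  · rw [besovNorm_eq hp, ← ENNReal.rpow_mul, mul_one_div_cancel hp0.ne', ENNReal.rpow_one]

lemma tsum_besovTerm_ne_top (hp : 1 ≤ p) (hf : f ∈ besovSpace s p p volume) :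
    ∑' k, besovTerm s p f k ≠ ⊤ := by
  have h := hf.2
  rw [besovNorm_eq hp] at h
  have h1 := (ENNReal.add_lt_top.1 h).2
  exact ((ENNReal.rpow_lt_top_iff_of_pos (by positivity)).1 h1).ne

lemma locallyIntegrable_of_eLpNorm (hn : 1 ≤ n) (hp : 1 ≤ p) (hs : 0 < s)
    (hα : α + n = p * (1 - s)) {E : Type*} [NormedAddCommGroup E] {F : Ambient d n → E}
    (hF : AEStronglyMeasurable F volume)
    (h : eLpNorm F (ENNReal.ofReal p) (weightedMeasure d n α) ≠ ⊤) :
    LocallyIntegrable F volume := by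
  refine locallyIntegrable_of_energy hn hp hs hα hF ?_
  rw [← eLpNorm_rpow_eq_energy hn hp]
  exact ENNReal.rpow_ne_top_of_nonneg (by linarith) h

end

section Convergence

open DyadicCube

variable {d n : ℕ} {ψ : DyadicCube (Fin d ⊕ Fin n) → Ambient d n → ℝ} {p s : ℝ} {f : Base d → ℂ}

/-- The constant in the distance between the extension and the function near the subspace. -/
def approxConst (n : ℕ) (s : ℝ) (B : ℝ≥0∞) : ℝ≥0∞ :=
  layerConst n 0 * (5 ^ n * B + B * geomSum s) * geomSum (n + s)

lemma approxConst_ne_top (hs : 0 < s) {B : ℝ≥0∞} (hB : B ≠ ⊤) : approxConst n s B ≠ ⊤ :=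
  ENNReal.mul_ne_top (ENNReal.mul_ne_top (layerConst_ne_top 0)
    (ENNReal.add_ne_top.2 ⟨ENNReal.mul_ne_top (by simp) hB,
      ENNReal.mul_ne_top hB (geomSum_ne_top hs)⟩)) (geomSum_ne_top (by positivity))

/-- The Whitney extension of `f` approaches `f` at the subspace. -/
lemma lintegral_slab_whitneyExtension_sub_le (hn : 1 ≤ n) (hp : 1 ≤ p)
    (hψ : IsWhitneyBumpFamily d n ψ) (hf : LocallyIntegrable f volume) {Q : DyadicCube (Fin d)}
    (hQ : Q.level = 0) (k : ℕ) :
    ∫⁻ X in (slab Q.toSet (2 ^ (-(k : ℤ))) : Set (Ambient d n)),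
      ‖whitneyExtension ψ f X - f (hor X)‖ₑ ≤
      approxConst n s ((powBound d p * ∑' i, besovTerm s p f i) ^ (1 / p)) *
        2 ^ (-(k : ℝ) * (n + s)) := by
  set B : ℝ≥0∞ := (powBound d p * ∑' i, besovTerm s p f i) ^ (1 / p) with hB
  -- On the layer of level `j` the extension is compared with the average over the cube of level
  -- `j`, and this average with `f`.
  set g : ℕ → Base d → ℝ≥0∞ := fun j x => 5 ^ n * neighborOsc f (containing (j : ℤ) x) +
    ‖cubeAverage f (containing (j : ℤ) x) - f x‖ₑ with hg
  have hm1 : ∀ j : ℕ, Measurable fun x : Base d => (5 : ℝ≥0∞) ^ n *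
      neighborOsc f (containing (j : ℤ) x) := fun j => (measurable_neighborOsc f j).const_mul _
  have hm2 : ∀ j : ℕ, Measurable fun x : Base d => cubeAverage f (containing (j : ℤ) x) :=
    fun j => measurable_comp_containing (fun Q => cubeAverage f Q) j
  have hm3 : ∀ j : ℕ, AEMeasurable (fun x : Base d =>
      ‖cubeAverage f (containing (j : ℤ) x) - f x‖ₑ) volume := fun j =>
    ((hm2 j).aestronglyMeasurable.sub hf.aestronglyMeasurable).enorm
  have hlayer : ∀ j : ℕ, ∫⁻ X in hor ⁻¹' Q.toSet ∩ (layer (j : ℤ) : Set (Ambient d n)),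
      ‖whitneyExtension ψ f X - f (hor X)‖ₑ ≤
      layerConst n 0 * (5 ^ n * B + B * geomSum s) * 2 ^ (-(j : ℝ) * (n + s)) := by
    intro j
    calc ∫⁻ X in hor ⁻¹' Q.toSet ∩ (layer (j : ℤ) : Set (Ambient d n)),
          ‖whitneyExtension ψ f X - f (hor X)‖ₑ
        ≤ ∫⁻ X in hor ⁻¹' Q.toSet ∩ (layer (j : ℤ) : Set (Ambient d n)),
            wt X ^ (0 : ℝ) * g j (hor X) := by
          refine setLIntegral_mono_ae' ((measurable_hor Q.measurableSet_toSet).inter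
            (measurableSet_layer _)) ?_
          filter_upwards [ae_vsup_ne (d := d) (n := n) (r := 2 ^ (-(j : ℤ))) (by positivity)]
            with X hX' hX
          rw [ENNReal.rpow_zero, one_mul]
          have e : whitneyExtension ψ f X - f (hor X) =
              (whitneyExtension ψ f X - cubeAverage f (containing (j : ℤ) (hor X))) +
              (cubeAverage f (containing (j : ℤ) (hor X)) - f (hor X)) := by ring
          rw [e]
          exact (enorm_add_le _ _).trans (add_le_add
            (enorm_whitneyExtension_sub_le hψ f (by omega) hX.2 hX') le_rfl)
      _ ≤ layerConst n 0 * 2 ^ (-((j : ℤ) : ℝ) * (0 + n)) * ∫⁻ x in Q.toSet, g j x :=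
          lintegral_layer_le hn 0 (by omega) Q.measurableSet_toSet
            ((hm1 j).aemeasurable.add (hm3 j))
      _ ≤ layerConst n 0 * 2 ^ (-((j : ℤ) : ℝ) * (0 + n)) *
            (5 ^ n * (B * 2 ^ (-(j : ℝ) * s)) + B * geomSum s * 2 ^ (-(j : ℝ) * s)) := by
          refine mul_le_mul' le_rfl ?_
          simp only [hg]
          rw [lintegral_add_left (hm1 j), lintegral_const_mul' _ _ (by simp)]
          exact add_le_add (mul_le_mul' le_rfl (lintegral_oscillation_le hp hQ j))
            (lintegral_cubeAverage_sub_le hp hf hQ j)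
      _ = _ := by
          have e : (2 : ℝ≥0∞) ^ (-(j : ℝ) * (n + s)) =
              2 ^ (-((j : ℤ) : ℝ) * (0 + n)) * 2 ^ (-(j : ℝ) * s) := by
            rw [two_rpow_mul]; congr 1; push_cast; ring
          rw [e]; ring
  have hsub : ∀ᵐ X : Ambient d n, X ∈ slab Q.toSet (2 ^ (-(k : ℤ))) →
      X ∈ ⋃ i : ℕ, hor ⁻¹' Q.toSet ∩ (layer ((k + i : ℕ) : ℤ) : Set (Ambient d n)) := by
    filter_upwards [ae_ver_ne_zero (d := d) hn] with X hX hXs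
    obtain ⟨j, hj⟩ := exists_mem_layer hX
    have h1 : (k : ℤ) < j := lt_of_mem_layer hj ((vsup_le_norm_ver X).trans_lt hXs.2)
    refine mem_iUnion.2 ⟨(j - k).toNat, hXs.1, ?_⟩
    have : ((k + (j - k).toNat : ℕ) : ℤ) = j := by push_cast; omega
    rwa [this]
  calc ∫⁻ X in (slab Q.toSet (2 ^ (-(k : ℤ))) : Set (Ambient d n)),
        ‖whitneyExtension ψ f X - f (hor X)‖ₑ
      ≤ ∫⁻ X in ⋃ i : ℕ, hor ⁻¹' Q.toSet ∩ (layer ((k + i : ℕ) : ℤ) : Set (Ambient d n)),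
          ‖whitneyExtension ψ f X - f (hor X)‖ₑ := lintegral_mono_set' hsub
    _ ≤ ∑' i : ℕ, layerConst n 0 * (5 ^ n * B + B * geomSum s) *
          2 ^ (-((k : ℝ) + i) * (n + s)) := by
        refine (lintegral_iUnion_le _ _).trans (ENNReal.tsum_le_tsum fun i => ?_)
        refine (hlayer (k + i)).trans_eq ?_
        push_cast; rfl
    _ = _ := by
        rw [ENNReal.tsum_mul_left, tsum_two_rpow_add, approxConst]
        ring

end Convergence

/-! ### The weak gradient of the Whitney extension -/

section Cutoff

variable {d n : ℕ}

/-- The projection to `ℝ^n` as a continuous linear map. -/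
def verCLM (d n : ℕ) : Ambient d n →L[ℝ] EuclideanSpace ℝ (Fin n) :=
  LinearMap.toContinuousLinearMap
    { toFun := ver
      map_add' := fun _ _ => rfl
      map_smul' := fun _ _ => rfl }

@[simp] lemma verCLM_apply (X : Ambient d n) : verCLM d n X = ver X := rfl

/-- A function of the vertical variable that vanishes near the subspace; if `θ` is supported in the
unit ball, it is equal to `1` at distance at least `2^{-k}` from the subspace. -/
def cutoff (θ : ContDiffBump (0 : EuclideanSpace ℝ (Fin n))) (k : ℕ) (X : Ambient d n) : ℝ :=
  1 - θ ((2 : ℝ) ^ k • ver X)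

variable (θ : ContDiffBump (0 : EuclideanSpace ℝ (Fin n))) (k : ℕ)

lemma contDiff_cutoff : ContDiff ℝ ∞ (cutoff θ k : Ambient d n → ℝ) := by
  have h : ContDiff ℝ ∞ (fun X : Ambient d n => ((2 : ℝ) ^ k • verCLM d n) X) :=
    ((2 : ℝ) ^ k • verCLM d n).contDiff
  exact contDiff_const.sub (θ.contDiff.comp h)

lemma abs_cutoff_le (X : Ambient d n) : |cutoff θ k X| ≤ 1 := by
  have h1 := θ.nonneg (x := (2 : ℝ) ^ k • ver X)
  have h2 := θ.le_one (x := (2 : ℝ) ^ k • ver X)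
  rw [cutoff, abs_le]
  constructor <;> linarith

lemma ver_ne_zero_of_mem_tsupport_cutoff {X : Ambient d n} (hX : X ∈ tsupport (cutoff θ k)) :
    ver X ≠ 0 := by
  have hc : IsClosed {X : Ambient d n | θ.rIn ≤ ‖(2 : ℝ) ^ k • ver X‖} :=
    isClosed_le continuous_const (continuous_ver.const_smul ((2 : ℝ) ^ k)).norm
  have hs : Function.support (cutoff θ k : Ambient d n → ℝ) ⊆
      {X | θ.rIn ≤ ‖(2 : ℝ) ^ k • ver X‖} := by
    intro Y hY
    by_contra hlt
    refine hY ?_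
    have : (2 : ℝ) ^ k • ver Y ∈ Metric.closedBall 0 θ.rIn :=
      mem_closedBall_zero_iff.2 (not_le.1 hlt).le
    rw [cutoff, θ.one_of_mem_closedBall this, sub_self]
  have h := closure_minimal hs hc hX
  intro h0
  rw [mem_ofPred_eq, h0, smul_zero, norm_zero] at h
  exact absurd θ.rIn_pos (not_lt.2 h)

lemma fderiv_cutoff (X v : Ambient d n) : fderiv ℝ (cutoff θ k) X v =
    -((2 : ℝ) ^ k * fderiv ℝ θ ((2 : ℝ) ^ k • ver X) (ver v)) := by
  have h1 : HasFDerivAt (fun Y : Ambient d n => ((2 : ℝ) ^ k • verCLM d n) Y)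
      ((2 : ℝ) ^ k • verCLM d n) X := ((2 : ℝ) ^ k • verCLM d n).hasFDerivAt
  have h2 : HasFDerivAt θ (fderiv ℝ θ ((2 : ℝ) ^ k • ver X)) ((2 : ℝ) ^ k • verCLM d n X) :=
    ((θ.contDiff (n := 1)).differentiable (by norm_num) _).hasFDerivAt
  have h3 := (h2.comp X h1).const_sub 1
  have h4 : fderiv ℝ (cutoff θ k) X =
      -((fderiv ℝ θ ((2 : ℝ) ^ k • ver X)).comp ((2 : ℝ) ^ k • verCLM d n)) := h3.fderiv
  rw [h4]
  simp

lemma exists_bound_fderiv_cutoff : ∃ M : ℝ≥0, ∀ (k : ℕ) (X v : Ambient d n),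
    ‖fderiv ℝ (cutoff θ k) X v‖ₑ ≤ M * (2 ^ k * ‖ver v‖ₑ) := by
  have hc : Continuous (fderiv ℝ θ) := (θ.contDiff (n := 1)).continuous_fderiv (by norm_num)
  obtain ⟨M, hM⟩ := (θ.hasCompactSupport.fderiv ℝ).exists_bound_of_continuous hc
  have hM0 : 0 ≤ M := (norm_nonneg _).trans (hM 0)
  refine ⟨⟨M, hM0⟩, fun k X v => ?_⟩
  rw [fderiv_cutoff, enorm_neg, enorm_mul, mul_left_comm]
  refine mul_le_mul' ?_ ?_
  · rw [enorm_pow]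
    simp [← ofReal_norm]
  · rw [← ofReal_norm, ← ofReal_norm]
    refine (ENNReal.ofReal_le_ofReal (((fderiv ℝ θ _).le_opNorm _).trans
      (mul_le_mul_of_nonneg_right (hM _) (norm_nonneg _)))).trans_eq ?_
    rw [ENNReal.ofReal_mul hM0]
    congr 1
    exact ENNReal.ofReal_eq_coe_nnreal hM0

variable {θ} {k}

lemma fderiv_cutoff_eq_zero (hθ : θ.rOut < 1) {X : Ambient d n} (hX : 1 ≤ 2 ^ k * ‖ver X‖)
    (v : Ambient d n) : fderiv ℝ (cutoff θ k) X v = 0 := by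
  have h : (2 : ℝ) ^ k • ver X ∉ tsupport θ := by
    rw [θ.tsupport_eq, mem_closedBall_zero_iff, norm_smul, not_le]
    refine hθ.trans_le ?_
    simpa using hX
  have h2 : fderiv ℝ θ ((2 : ℝ) ^ k • ver X) = 0 := by
    by_contra h3
    exact h (support_fderiv_subset ℝ h3)
  rw [fderiv_cutoff, h2]
  simp

lemma cutoff_eq_one (hθ : θ.rOut < 1) {X : Ambient d n} (hX : 1 ≤ 2 ^ k * ‖ver X‖) :
    cutoff θ k X = 1 := by
  rw [cutoff, θ.zero_of_le_dist, sub_zero]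
  rw [dist_zero_right, norm_smul]
  refine hθ.le.trans ?_
  simpa using hX

end Cutoff

section WeakGradient

variable {d n : ℕ}

/-- Integration by parts against a test function: the other function has to be differentiable in
the given direction on the support of the test function only. -/
lemma integral_fderiv_smul_of_hasLineDerivAt {E : Type*} [NormedAddCommGroup E]
    [NormedSpace ℝ E] [MeasurableSpace E] [BorelSpace E] [FiniteDimensional ℝ E] {μ : Measure E}
    [μ.IsAddHaarMeasure] {F G : E → ℂ} {v : E} (hF : LocallyIntegrable F μ)
    (hG : LocallyIntegrable G μ) {φ : E → ℝ} (hφ : ContDiff ℝ ∞ φ) (hφc : HasCompactSupport φ)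
    (hder : ∀ x ∈ tsupport φ, HasLineDerivAt ℝ F (G x) x v) :
    ∫ x, fderiv ℝ φ x v • F x ∂μ = -∫ x, φ x • G x ∂μ := by
  have hd : Continuous fun x => fderiv ℝ φ x v :=
    (hφ.continuous_fderiv (by simp)).clm_apply continuous_const
  have hdc : HasCompactSupport fun x => fderiv ℝ φ x v := hφc.fderiv_apply ℝ v
  exact integral_bilinear_hasLineDerivAt_right_eq_neg_left_of_integrable
    (B := (ContinuousLinearMap.lsmul ℝ ℝ : ℝ →L[ℝ] ℂ →L[ℝ] ℂ).flip)
    (hG.integrable_smul_left_of_hasCompactSupport hφ.continuous hφc)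
    (hF.integrable_smul_left_of_hasCompactSupport hd hdc)
    (hF.integrable_smul_left_of_hasCompactSupport hφ.continuous hφc) hder
    (fun x _ => ((hφ.differentiable (by simp) x).hasFDerivAt).hasLineDerivAt v)

/-- A line derivative outside of the subspace is a weak derivative on the whole of `ℝ^{d+n}` if the
integrals of the function over neighborhoods of the subspace are small in comparison with the
width of the neighborhoods (or if the direction is parallel to the subspace). -/
lemma integral_fderiv_smul_of_tendsto (hn : 1 ≤ n) {F G : Ambient d n → ℂ} {v : Ambient d n}
    (hF : LocallyIntegrable F volume) (hG : LocallyIntegrable G volume)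
    (hder : ∀ X, ver X ≠ 0 → HasLineDerivAt ℝ F (G X) X v)
    (hsmall : ∀ K : Set (Ambient d n), IsCompact K → Tendsto (fun k : ℕ => ‖ver v‖ₑ *
      (2 ^ k * ∫⁻ X in K ∩ {X | ‖ver X‖ < 2 ^ (-(k : ℤ))}, ‖F X‖ₑ)) atTop (𝓝 0))
    {φ : Ambient d n → ℝ} (hφ : ContDiff ℝ ∞ φ) (hφc : HasCompactSupport φ) :
    ∫ X, fderiv ℝ φ X v • F X = -∫ X, φ X • G X := by
  obtain ⟨θ, hθ⟩ : ∃ θ : ContDiffBump (0 : EuclideanSpace ℝ (Fin n)), θ.rOut < 1 :=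
    ⟨⟨1 / 4, 1 / 2, by norm_num, by norm_num⟩, by norm_num⟩
  have hd : Continuous fun x => fderiv ℝ φ x v :=
    (hφ.continuous_fderiv (by simp)).clm_apply continuous_const
  have hdc : HasCompactSupport fun x => fderiv ℝ φ x v := hφc.fderiv_apply ℝ v
  have hiF := hF.integrable_smul_left_of_hasCompactSupport hd hdc
  have hiG := hG.integrable_smul_left_of_hasCompactSupport hφ.continuous hφc
  have hcd : ∀ k, Continuous fun X : Ambient d n => fderiv ℝ (cutoff θ k) X v := fun k =>
    ((contDiff_cutoff θ k).continuous_fderiv (by simp)).clm_apply continuous_const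
  have hiR : ∀ k, Integrable (fun X => (φ X * fderiv ℝ (cutoff θ k) X v) • F X) volume :=
    fun k => hF.integrable_smul_left_of_hasCompactSupport (hφ.continuous.mul (hcd k))
      hφc.mul_right
  have hc1 : ∀ᵐ X : Ambient d n, ∀ᶠ k : ℕ in atTop, cutoff θ k X = 1 := by
    filter_upwards [ae_ver_ne_zero (d := d) hn] with X hX
    have h1 : Tendsto (fun k : ℕ => (2 : ℝ) ^ k * ‖ver X‖) atTop atTop :=
      (tendsto_pow_atTop_atTop_of_one_lt one_lt_two).atTop_mul_const (norm_pos_iff.2 hX)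
    filter_upwards [h1.eventually_ge_atTop 1] with k hk
    exact cutoff_eq_one hθ hk
  -- Multiplication with the cutoff is harmless in the limit.
  have hlim : ∀ {H : Ambient d n → ℂ}, Integrable H volume →
      Tendsto (fun k : ℕ => ∫ X, cutoff θ k X • H X) atTop (𝓝 (∫ X, H X)) := by
    intro H hH
    refine tendsto_integral_of_dominated_convergence (fun X => ‖H X‖) (fun k => ?_) hH.norm
      (fun k => .of_forall fun X => ?_) ?_
    · exact (contDiff_cutoff θ k).continuous.aestronglyMeasurable.smul hH.aestronglyMeasurable
    · rw [norm_smul, Real.norm_eq_abs]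
      exact mul_le_of_le_one_left (norm_nonneg _) (abs_cutoff_le θ k X)
    · filter_upwards [hc1] with X hX
      refine tendsto_const_nhds.congr' ?_
      filter_upwards [hX] with k hk
      rw [hk, one_smul]
  -- integration by parts with the test function `cutoff θ k * φ`
  have hibp : ∀ k : ℕ, (∫ X, cutoff θ k X • fderiv ℝ φ X v • F X) +
      (∫ X, (φ X * fderiv ℝ (cutoff θ k) X v) • F X) = -∫ X, cutoff θ k X • φ X • G X := by
    intro k
    have h := integral_fderiv_smul_of_hasLineDerivAt hF hG (φ := fun X => cutoff θ k X * φ X)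
      (v := v) ((contDiff_cutoff θ k).mul hφ) hφc.mul_left fun X hX =>
        hder X (ver_ne_zero_of_mem_tsupport_cutoff θ k (closure_mono
          (Function.support_mul_subset_left _ _) hX))
    have hp : ∀ X, fderiv ℝ (fun X => cutoff θ k X * φ X) X v =
        cutoff θ k X * fderiv ℝ φ X v + φ X * fderiv ℝ (cutoff θ k) X v := fun X => by
      rw [fderiv_fun_mul ((contDiff_cutoff θ k).differentiable (by simp) X)
        (hφ.differentiable (by simp) X)]
      simp
    simp only [hp, add_smul, mul_smul] at h
    simp only [mul_smul]
    rw [← h, integral_add]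
    · simpa only [Pi.mul_apply, mul_smul] using hF.integrable_smul_left_of_hasCompactSupport
        ((contDiff_cutoff θ k).continuous.mul hd) hdc.mul_left
    · simpa only [mul_smul] using hiR k
  -- The derivative of the cutoff is of order `2 ^ k` and lives at distance less than `2 ^ (-k)`
  -- from the subspace, so the remainder is small by hypothesis.
  have hrem : Tendsto (fun k : ℕ => ∫ X, (φ X * fderiv ℝ (cutoff θ k) X v) • F X) atTop
      (𝓝 0) := by
    obtain ⟨M, hM⟩ := exists_bound_fderiv_cutoff (d := d) θ
    obtain ⟨N, hN⟩ := hφc.exists_bound_of_continuous hφ.continuous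
    rw [tendsto_zero_iff_enorm_tendsto_zero]
    have h0 := ENNReal.Tendsto.const_mul (a := ENNReal.ofReal N * M)
      (hsmall (tsupport φ) hφc) (Or.inr (by finiteness))
    rw [mul_zero] at h0
    refine tendsto_of_tendsto_of_tendsto_of_le_of_le tendsto_const_nhds h0 (fun _ => zero_le)
      fun k => ?_
    have hm : MeasurableSet (tsupport φ ∩ {X : Ambient d n | ‖ver X‖ < 2 ^ (-(k : ℤ))}) :=
      (isClosed_tsupport φ).measurableSet.inter
        (measurableSet_lt measurable_ver.norm measurable_const)
    calc ‖∫ X, (φ X * fderiv ℝ (cutoff θ k) X v) • F X‖ₑ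
        ≤ ∫⁻ X, ‖(φ X * fderiv ℝ (cutoff θ k) X v) • F X‖ₑ := enorm_integral_le_lintegral_enorm _
      _ ≤ ∫⁻ X, (tsupport φ ∩ {X : Ambient d n | ‖ver X‖ < 2 ^ (-(k : ℤ))}).indicator
            (fun X => ENNReal.ofReal N * M * (2 ^ k * ‖ver v‖ₑ) * ‖F X‖ₑ) X := by
          refine lintegral_mono fun X => ?_
          by_cases h1 : X ∈ tsupport φ
          · by_cases h2 : ‖ver X‖ < 2 ^ (-(k : ℤ))
            · have h3 : X ∈ tsupport φ ∩ {X : Ambient d n | ‖ver X‖ < 2 ^ (-(k : ℤ))} := ⟨h1, h2⟩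
              rw [indicator_of_mem h3, enorm_smul, enorm_mul, mul_assoc (ENNReal.ofReal N)]
              refine mul_le_mul' (mul_le_mul' ?_ (hM k X v)) le_rfl
              rw [← ofReal_norm]
              exact ENNReal.ofReal_le_ofReal (hN X)
            · rw [fderiv_cutoff_eq_zero hθ, mul_zero, zero_smul, enorm_zero]
              · exact zero_le
              · rw [not_lt, zpow_neg, zpow_natCast, inv_le_iff_one_le_mul₀' (by positivity)] at h2
                exact h2
          · rw [image_eq_zero_of_notMem_tsupport h1, zero_mul, zero_smul, enorm_zero]
            exact zero_le
      _ = _ := by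
          rw [lintegral_indicator hm, lintegral_const_mul' _ _ (by finiteness)]
          ring
  have h1 := (hlim hiF).add hrem
  have h2 := (hlim hiG).neg
  rw [add_zero] at h1
  exact tendsto_nhds_unique (h1.congr hibp) h2

end WeakGradient

section ExtensionGradient

open DyadicCube

variable {d n : ℕ} {ψ : DyadicCube (Fin d ⊕ Fin n) → Ambient d n → ℝ} {p s α : ℝ} {f : Base d → ℂ}

lemma locallyIntegrable_comp_hor (hf : LocallyIntegrable f volume) :
    LocallyIntegrable (fun X : Ambient d n => f (hor X)) volume := by
  have hm : AEStronglyMeasurable (fun X : Ambient d n => f (hor X)) volume :=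
    hf.aestronglyMeasurable.comp_quasiMeasurePreserving quasiMeasurePreserving_hor
  rw [locallyIntegrable_iff]
  intro K hK
  obtain ⟨R, hR⟩ := hK.isBounded.subset_ball 0
  refine ⟨hm.restrict, ?_⟩
  have hb : IntegrableOn f (Metric.ball 0 R) volume :=
    (hf.integrableOn_isCompact (isCompact_closedBall 0 R)).mono_set Metric.ball_subset_closedBall
  calc ∫⁻ X in K, ‖f (hor X)‖ₑ
      ≤ ∫⁻ X in (slab (Metric.ball 0 R) R : Set (Ambient d n)), ‖f (hor X)‖ₑ := by
        refine lintegral_mono_set fun X hX => ?_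
        have h1 := mem_ball_zero_iff.1 (hR hX)
        exact ⟨mem_ball_zero_iff.2 ((norm_hor_le X).trans_lt h1), (norm_ver_le X).trans_lt h1⟩
    _ < ⊤ := by
        rw [lintegral_slab Metric.isOpen_ball.measurableSet _ _ hm.enorm]
        simp only [hor_join, setLIntegral_const]
        rw [lintegral_mul_const' _ _ measure_ball_lt_top.ne]
        exact ENNReal.mul_lt_top hb.2 measure_ball_lt_top

/-- A bounded set is covered, up to restrictions on the height, by the slabs over finitely many
unit cubes. -/
lemma lintegral_inter_le_sum {K : Set (Ambient d n)} {N : ℕ} (hK : K ⊆ Metric.ball 0 (N : ℝ))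
    (r : ℝ) (h : Ambient d n → ℝ≥0∞) :
    ∫⁻ X in K ∩ {X | ‖ver X‖ < r}, h X ≤
      ∑ m ∈ Finset.Icc (fun _ : Fin d => -(N : ℤ) - 1) (fun _ => (N : ℤ)),
        ∫⁻ X in (slab (⟨0, m⟩ : DyadicCube (Fin d)).toSet r : Set (Ambient d n)), h X := by
  set M := Finset.Icc (fun _ : Fin d => -(N : ℤ) - 1) (fun _ => (N : ℤ))
  have hsub : K ∩ {X : Ambient d n | ‖ver X‖ < r} ⊆
      ⋃ m : M, slab (⟨0, m.1⟩ : DyadicCube (Fin d)).toSet r := by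
    rintro X ⟨hX, hr⟩
    have h1 := mem_toSet_containing 0 (hor X)
    have h2 : (containing 0 (hor X)).edge = 1 := by simp [edge, level_containing]
    have h3 : ∀ i, |hor X i| < N := fun i => by
      have h4 : ‖hor X i‖ ≤ ‖hor X‖ := PiLp.norm_apply_le _ _
      rw [Real.norm_eq_abs] at h4
      exact h4.trans_lt ((norm_hor_le X).trans_lt (mem_ball_zero_iff.1 (hK hX)))
    have hm : (containing 0 (hor X)).corner ∈ M := by
      refine Finset.mem_Icc.2 ⟨fun i => ?_, fun i => ?_⟩
      · have h5 := (h1 i).2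
        have h6 := (abs_lt.1 (h3 i)).1
        rw [h2, one_mul] at h5
        have : (-(N : ℤ) - 1 : ℝ) ≤ (containing 0 (hor X)).corner i := by
          push_cast; linarith
        exact_mod_cast this
      · have h5 := (h1 i).1
        have h6 := (abs_lt.1 (h3 i)).2
        rw [h2, one_mul] at h5
        have : ((containing 0 (hor X)).corner i : ℝ) ≤ N := by linarith
        exact_mod_cast this
    exact mem_iUnion.2 ⟨⟨_, hm⟩, h1, hr⟩
  refine (lintegral_mono_set hsub).trans ((lintegral_iUnion_le _ _).trans_eq ?_)
  rw [tsum_fintype, Finset.univ_eq_attach, Finset.sum_attach M fun m =>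
    ∫⁻ X in (slab (⟨0, m⟩ : DyadicCube (Fin d)).toSet r : Set (Ambient d n)), h X]

lemma tendsto_two_rpow_neg_mul (hs : 0 < s) {C : ℝ≥0∞} (hC : C ≠ ⊤) :
    Tendsto (fun k : ℕ => C * (2 : ℝ≥0∞) ^ (-(k : ℝ) * s)) atTop (𝓝 0) := by
  have h1 : (2 : ℝ≥0∞) ^ (-s) < 1 :=
    ENNReal.rpow_lt_one_of_one_lt_of_neg (by norm_num) (by linarith)
  have h2 := ENNReal.Tendsto.const_mul (ENNReal.tendsto_pow_atTop_nhds_zero_of_lt_one h1)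
    (Or.inr hC)
  rw [mul_zero] at h2
  refine h2.congr fun k => ?_
  rw [← ENNReal.rpow_natCast, ← ENNReal.rpow_mul]
  congr 2; ring

lemma tendsto_lintegral_whitneyExtension_sub (hn : 1 ≤ n) (hp : 1 ≤ p) (hs : 0 < s)
    (hψ : IsWhitneyBumpFamily d n ψ) (hf : f ∈ besovSpace s p p volume) {K : Set (Ambient d n)}
    (hK : IsCompact K) {a : ℝ≥0∞} (ha : a ≠ ⊤) :
    Tendsto (fun k : ℕ => a * (2 ^ k * ∫⁻ X in K ∩ {X | ‖ver X‖ < 2 ^ (-(k : ℤ))},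
      ‖whitneyExtension ψ f X - f (hor X)‖ₑ)) atTop (𝓝 0) := by
  obtain ⟨R, hR⟩ := hK.isBounded.subset_ball 0
  obtain ⟨N, hN⟩ := exists_nat_ge R
  have hKN := hR.trans (Metric.ball_subset_ball hN)
  set B : ℝ≥0∞ := approxConst n s ((powBound d p * ∑' i, besovTerm s p f i) ^ (1 / p)) with hB
  have hBt : B ≠ ⊤ := approxConst_ne_top hs (ENNReal.rpow_ne_top_of_nonneg (by positivity)
    (ENNReal.mul_ne_top (powBound_ne_top hp) (tsum_besovTerm_ne_top hp hf)))
  set M := Finset.Icc (fun _ : Fin d => -(N : ℤ) - 1) (fun _ => (N : ℤ))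
  refine tendsto_of_tendsto_of_tendsto_of_le_of_le tendsto_const_nhds
    (tendsto_two_rpow_neg_mul hs (C := a * (M.card * B)) (by finiteness)) (fun _ => zero_le)
    fun k => ?_
  have h1 : ∫⁻ X in K ∩ {X : Ambient d n | ‖ver X‖ < 2 ^ (-(k : ℤ))},
      ‖whitneyExtension ψ f X - f (hor X)‖ₑ ≤ M.card * (B * 2 ^ (-(k : ℝ) * (n + s))) := by
    refine (lintegral_inter_le_sum hKN _ _).trans ((Finset.sum_le_card_nsmul _ _ _ fun m _ =>
      lintegral_slab_whitneyExtension_sub_le (s := s) hn hp hψ hf.1 rfl k).trans_eq ?_)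
    rw [nsmul_eq_mul]
  have h2 : (2 : ℝ≥0∞) ^ k * 2 ^ (-(k : ℝ) * (n + s)) ≤ 2 ^ (-(k : ℝ) * s) := by
    rw [← ENNReal.rpow_natCast, two_rpow_mul]
    refine two_rpow_le ?_
    have hn' : (1 : ℝ) ≤ n := by exact_mod_cast hn
    nlinarith [Nat.cast_nonneg (α := ℝ) k]
  calc a * (2 ^ k * ∫⁻ X in K ∩ {X : Ambient d n | ‖ver X‖ < 2 ^ (-(k : ℤ))},
        ‖whitneyExtension ψ f X - f (hor X)‖ₑ)
      ≤ a * (2 ^ k * (M.card * (B * 2 ^ (-(k : ℝ) * (n + s))))) :=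
        mul_le_mul' le_rfl (mul_le_mul' le_rfl h1)
    _ = a * (M.card * B) * (2 ^ k * 2 ^ (-(k : ℝ) * (n + s))) := by ring
    _ ≤ _ := mul_le_mul' le_rfl h2

/-- The pointwise gradient of the Whitney extension is its distributional gradient: for the
directions of `ℝ^d` the subspace can be cut out, and for the other directions this becomes possible
after subtraction of `f`, which is constant in these directions. -/
lemma isWeakGradient_whitneyExtension (hn : 1 ≤ n) (hp : 1 ≤ p) (hs : 0 < s)
    (hψ : IsWhitneyBumpFamily d n ψ) (hf : f ∈ besovSpace s p p volume)
    (hF : LocallyIntegrable (whitneyExtension ψ f) volume)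
    (hG : LocallyIntegrable (extensionGradient ψ f) volume) :
    IsWeakGradient (whitneyExtension ψ f) (extensionGradient ψ f) := by
  refine ⟨hG, fun i φ hφ hφc => ?_⟩
  have hGi : LocallyIntegrable (fun X => extensionGradient ψ f X i) volume := by
    rw [locallyIntegrable_iff] at hG ⊢
    intro K hK
    exact (EuclideanSpace.proj (𝕜 := ℂ) i).integrable_comp (hG K hK)
  have hder : ∀ X : Ambient d n, ver X ≠ 0 → HasLineDerivAt ℝ (whitneyExtension ψ f)
      (extensionGradient ψ f X i) X (EuclideanSpace.single i 1) := fun X hX =>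
    ((contDiffAt_whitneyExtension hψ f hX).differentiableAt (by simp)).hasFDerivAt.hasLineDerivAt _
  cases i with
  | inl i =>
    refine integral_fderiv_smul_of_tendsto hn hF hGi hder (fun K _ => ?_) hφ hφc
    have hv : ver (EuclideanSpace.single (Sum.inl i) 1 : Ambient d n) = 0 := by
      ext j; simp [ver]
    simp [hv]
  | inr j =>
    have hfi := locallyIntegrable_comp_hor (n := n) hf.1
    have hder0 : ∀ X : Ambient d n, HasLineDerivAt ℝ (fun X : Ambient d n => f (hor X)) 0 X
        (EuclideanSpace.single (Sum.inr j) 1) := by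
      intro X
      have h : ∀ t : ℝ, hor (X + t • (EuclideanSpace.single (Sum.inr j) 1 : Ambient d n)) =
          hor X := fun t => by
        ext i; simp [hor]
      simp only [HasLineDerivAt, h]
      exact hasDerivAt_const _ _
    have h1 := integral_fderiv_smul_of_hasLineDerivAt (μ := volume) (G := fun _ => (0 : ℂ)) hfi
      (locallyIntegrable_const 0) hφ hφc fun X _ => hder0 X
    have h2 := integral_fderiv_smul_of_tendsto hn (hF.sub hfi) hGi
      (v := EuclideanSpace.single (Sum.inr j) 1)
      (fun X hX => by
        have h := HasDerivAt.sub (hder X hX) (hder0 X)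
        rw [sub_zero] at h
        exact h) (fun K hK =>
        tendsto_lintegral_whitneyExtension_sub hn hp hs hψ hf hK enorm_ne_top) hφ hφc
    have hd : Continuous fun x => fderiv ℝ φ x (EuclideanSpace.single (Sum.inr j) 1) :=
      (hφ.continuous_fderiv (by simp)).clm_apply continuous_const
    have hdc : HasCompactSupport fun x => fderiv ℝ φ x (EuclideanSpace.single (Sum.inr j) 1) :=
      hφc.fderiv_apply ℝ _
    rw [← h2]
    simp only [smul_zero, integral_zero, neg_zero] at h1
    simp only [Pi.sub_apply, smul_sub]
    rw [integral_sub (hF.integrable_smul_left_of_hasCompactSupport hd hdc)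
      (hfi.integrable_smul_left_of_hasCompactSupport hd hdc), h1, sub_zero]

lemma exists_nnreal_lipschitz (hψ : IsWhitneyBumpFamily d n ψ) : ∃ C : ℝ≥0,
    ∀ Q : UnitDyadicCube d, ∀ P ∈ whitneyCubes n Q.1, ∀ x y,
      |ψ P x - ψ P y| ≤ C / P.edge * dist x y := by
  obtain ⟨C, hC⟩ := hψ.lipschitz
  refine ⟨C.toNNReal, fun Q P hP x y => (hC Q P hP x y).trans ?_⟩
  refine mul_le_mul_of_nonneg_right ?_ dist_nonneg
  exact div_le_div_of_nonneg_right (Real.le_coe_toNNReal C) P.edge_pos.le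

/-- The Whitney extension of a function of the Besov space has a distributional gradient, and both
satisfy the norm estimates. -/
lemma whitneyExtension_sobolev (hn : 1 ≤ n) (hp : 1 ≤ p) (hs : 0 < s)
    (hα0 : 0 < α + n) (hα : α + n = p * (1 - s)) (hψ : IsWhitneyBumpFamily d n ψ) {C : ℝ≥0}
    (hC : ∀ Q : UnitDyadicCube d, ∀ P ∈ whitneyCubes n Q.1, ∀ x y,
      |ψ P x - ψ P y| ≤ C / P.edge * dist x y) (hf : f ∈ besovSpace s p p volume) :
    LocallyIntegrable (whitneyExtension ψ f) volume ∧
      IsWeakGradient (whitneyExtension ψ f) (extensionGradient ψ f) ∧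
      sobolevNorm p (weightedMeasure d n α) (whitneyExtension ψ f) ≤
        (extensionConst d n p α ^ (1 / p) + gradientConst d n p α C ^ (1 / p)) *
          besovNorm s p p volume f := by
  have hp1 : 0 ≤ 1 / p := by positivity
  have h1 := eLpNorm_whitneyExtension_le (α := α) (s := s) hn hp hψ hf.1
  have h2 := eLpNorm_extensionGradient_le hn hp hs.le hα hψ hC hf.1
  have hF := locallyIntegrable_of_eLpNorm hn hp hs hα
    (aestronglyMeasurable_whitneyExtension hn hψ f) (ne_top_of_le_ne_top (ENNReal.mul_ne_top
      (ENNReal.rpow_ne_top_of_nonneg hp1 (extensionConst_ne_top hp hα0)) hf.2.ne) h1)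
  have hG := locallyIntegrable_of_eLpNorm hn hp hs hα
    (aestronglyMeasurable_extensionGradient (ψ := ψ) f) (ne_top_of_le_ne_top (ENNReal.mul_ne_top
      (ENNReal.rpow_ne_top_of_nonneg hp1 (gradientConst_ne_top hp C)) hf.2.ne) h2)
  have hw := isWeakGradient_whitneyExtension hn hp hs hψ hf hF hG
  refine ⟨hF, hw, (iInf₂_le _ hw).trans ?_⟩
  rw [add_mul]
  exact add_le_add h1 h2

end ExtensionGradient

/-! ### The trace of the Whitney extension -/

section TraceExtension

open DyadicCube

variable {d n : ℕ} {ψ : DyadicCube (Fin d ⊕ Fin n) → Ambient d n → ℝ} {p s α : ℝ} {f : Base d → ℂ}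

/-- Both `f` and the limit of the box averages of its Whitney extension are close to the extension
on thin slabs. -/
lemma limit_boxAverage_whitneyExtension (hn : 1 ≤ n) (hp : 1 ≤ p) (hs : 0 < s)
    (hα : α + n = p * (1 - s)) (hψ : IsWhitneyBumpFamily d n ψ)
    (hf : f ∈ besovSpace s p p volume) (hF : LocallyIntegrable (whitneyExtension ψ f) volume)
    {G : Ambient d n → EuclideanSpace ℂ (Fin d ⊕ Fin n)}
    (hG : IsWeakGradient (whitneyExtension ψ f) G) (hE : energy p α G ≠ ⊤) {T : Base d → ℂ}
    (hTm : Measurable T)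
    (hT : ∀ᵐ x, Tendsto (fun k : ℤ => boxAverage (whitneyExtension ψ f) k x) atTop (𝓝 (T x))) :
    T =ᵐ[volume] f := by
  refine ae_of_forall_ae_toSet 0 fun m => ?_
  set Q : DyadicCube (Fin d) := ⟨0, m⟩ with hQ
  set I := ∫⁻ x in Q.toSet, ‖T x - f x‖ₑ with hI
  set A := slabConst d n s * singIntegral s G Q.toSet (1 / 2) with hA
  set B := approxConst n s ((powBound d p * ∑' i, besovTerm s p f i) ^ (1 / p)) with hB
  have hAt : A ≠ ⊤ := ENNReal.mul_ne_top (slabConst_ne_top hs) (singIntegral_ne_top hn hp hs hα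
    hG.1.aestronglyMeasurable hE Q.measurableSet_toSet Q.volume_toSet_ne_top (by norm_num)
    (by norm_num))
  have hBt : B ≠ ⊤ := approxConst_ne_top hs (ENNReal.rpow_ne_top_of_nonneg (by positivity)
    (ENNReal.mul_ne_top (powBound_ne_top hp) (tsum_besovTerm_ne_top hp hf)))
  have hTfm : AEStronglyMeasurable (fun x => T x - f x) volume :=
    hTm.aestronglyMeasurable.sub hf.1.aestronglyMeasurable
  -- The integral of `|T ∘ hor - f ∘ hor|` over a slab is `I` times the volume of the fibres, which
  -- decays more slowly than the distances of the extension to both functions.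
  have hbound : ∀ k : ℕ, halfBallVol n * I ≤ (A + B) * 2 ^ (-(k : ℝ) * (s / 2)) := by
    intro k
    have hk : (2 : ℝ) ^ (-(k : ℤ)) ≤ 1 := zpow_le_one_of_nonpos₀ one_le_two (by omega)
    have h1 : ∫⁻ X in (slab Q.toSet (2 ^ (-(k : ℤ)) / 2) : Set (Ambient d n)),
        ‖T (hor X) - f (hor X)‖ₑ = 2 ^ (-(k : ℝ) * n) * (halfBallVol n * I) := by
      have hm : AEMeasurable (fun X : Ambient d n => ‖T (hor X) - f (hor X)‖ₑ) volume :=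
        (hTfm.comp_quasiMeasurePreserving quasiMeasurePreserving_hor).enorm
      have hv := volume_ball_edge (n := n) (⟨k, 0⟩ : DyadicCube (Fin d))
      simp only [edge] at hv
      rw [lintegral_slab Q.measurableSet_toSet _ _ hm]
      simp only [hor_join, setLIntegral_const]
      rw [lintegral_mul_const' _ _ measure_ball_lt_top.ne, hv]
      push_cast
      ring
    have hFm := (aestronglyMeasurable_whitneyExtension hn hψ f)
    have h2 : ∫⁻ X in (slab Q.toSet (2 ^ (-(k : ℤ)) / 2) : Set (Ambient d n)),
        ‖T (hor X) - f (hor X)‖ₑ ≤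
        A * 2 ^ (-(k : ℝ) * (n + s / 2)) + B * 2 ^ (-(k : ℝ) * (n + s)) := by
      have hm : AEMeasurable (fun X : Ambient d n => ‖whitneyExtension ψ f X - T (hor X)‖ₑ)
          (volume.restrict (slab Q.toSet (2 ^ (-(k : ℤ)) / 2))) :=
        (hFm.sub (hTm.comp measurable_hor).aestronglyMeasurable).enorm.restrict
      calc ∫⁻ X in (slab Q.toSet (2 ^ (-(k : ℤ)) / 2) : Set (Ambient d n)),
            ‖T (hor X) - f (hor X)‖ₑ
          ≤ ∫⁻ X in (slab Q.toSet (2 ^ (-(k : ℤ)) / 2) : Set (Ambient d n)),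
              (‖whitneyExtension ψ f X - T (hor X)‖ₑ +
                ‖whitneyExtension ψ f X - f (hor X)‖ₑ) := by
            refine lintegral_mono fun X => ?_
            have e : T (hor X) - f (hor X) = (whitneyExtension ψ f X - f (hor X)) -
                (whitneyExtension ψ f X - T (hor X)) := by ring
            rw [e, add_comm]
            exact enorm_sub_le
        _ ≤ _ := by
            rw [lintegral_add_left' hm]
            refine add_le_add ?_ ((lintegral_mono_set (slab_mono le_rfl ?_)).trans
              (lintegral_slab_whitneyExtension_sub_le hn hp hψ hf.1 rfl k))
            · refine (lintegral_slab_sub_limit_le hn hs hF hG hT hTm (by simp [hQ])).trans ?_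
              rw [hA, mul_right_comm]
              refine mul_le_mul' (mul_le_mul' le_rfl (singIntegral_mono le_rfl ?_)) ?_
              · linarith
              · exact le_of_eq (by push_cast; rfl)
            · have : (0 : ℝ) < 2 ^ (-(k : ℤ)) := by positivity
              linarith
    have h3 : A * (2 : ℝ≥0∞) ^ (-(k : ℝ) * (n + s / 2)) + B * 2 ^ (-(k : ℝ) * (n + s)) ≤
        2 ^ (-(k : ℝ) * n) * ((A + B) * 2 ^ (-(k : ℝ) * (s / 2))) := by
      have e : (2 : ℝ≥0∞) ^ (-(k : ℝ) * (n + s / 2)) =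
          2 ^ (-(k : ℝ) * n) * 2 ^ (-(k : ℝ) * (s / 2)) := by
        rw [two_rpow_mul]; congr 1; ring
      have h4 : (2 : ℝ≥0∞) ^ (-(k : ℝ) * (n + s)) ≤ 2 ^ (-(k : ℝ) * (n + s / 2)) := by
        refine two_rpow_le ?_
        nlinarith [Nat.cast_nonneg (α := ℝ) k]
      refine (add_le_add le_rfl (mul_le_mul' le_rfl h4)).trans_eq ?_
      rw [e]; ring
    have h5 := (h1.symm.trans_le h2).trans h3
    exact (ENNReal.mul_le_mul_iff_right (two_rpow_ne_zero _) (two_rpow_ne_top _)).1 h5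
  have hzero : halfBallVol n * I = 0 := by
    refine le_antisymm ?_ zero_le
    exact ge_of_tendsto' (tendsto_two_rpow_neg_mul (s := s / 2) (by linarith)
      (C := A + B) (by finiteness)) hbound
  have hI0 : I = 0 := (mul_eq_zero.1 hzero).resolve_left halfBallVol_ne_zero
  filter_upwards [(lintegral_eq_zero_iff' hTfm.enorm.restrict).1 hI0] with x hx
  exact sub_eq_zero.1 (enorm_eq_zero.1 hx)

end TraceExtension

/-! ### The Whitney trace-extension pair -/

section Pair

variable {d n : ℕ} {ψ : DyadicCube (Fin d ⊕ Fin n) → Ambient d n → ℝ} {p s α : ℝ}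

lemma isWhitneyTraceExtensionPair (hn : 1 ≤ n) (hp : 1 ≤ p) (hs : 0 < s) (hs1 : s < 1)
    (hα : α + n = p * (1 - s)) (hψ : IsWhitneyBumpFamily d n ψ) :
    IsWhitneyTraceExtensionPair ψ (weightedMeasure d n α)
      (besovSpace s p p volume) (besovNorm s p p volume)
      (sobolevSpace p (weightedMeasure d n α)) (sobolevNorm p (weightedMeasure d n α)) := by
  have hp0 : 0 < p := by linarith
  have hα0 : 0 < α + n := by
    rw [hα]
    exact mul_pos hp0 (by linarith)
  have hα1 : -(n : ℝ) < α := by linarith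
  obtain ⟨C, hC⟩ := exists_nnreal_lipschitz hψ
  have hCe : extensionConst d n p α ^ (1 / p) + gradientConst d n p α C ^ (1 / p) ≠ ⊤ :=
    ENNReal.add_ne_top.2
      ⟨ENNReal.rpow_ne_top_of_nonneg (by positivity) (extensionConst_ne_top hp hα0),
        ENNReal.rpow_ne_top_of_nonneg (by positivity) (gradientConst_ne_top hp C)⟩
  have hCt : traceConst d n p s + 1 ≠ ⊤ := by simp [traceConst_ne_top hn hp hs]
  have hmem : ∀ f ∈ besovSpace s p p volume,
      whitneyExtension ψ f ∈ sobolevSpace p (weightedMeasure d n α) := fun f hf => by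
    obtain ⟨hF, -, hb⟩ := whitneyExtension_sobolev hn hp hs hα0 hα hψ hC hf
    exact ⟨hF, hb.trans_lt (ENNReal.mul_lt_top hCe.lt_top hf.2)⟩
  have hloc : ∀ f ∈ sobolevSpace p (weightedMeasure d n α),
      LocallyIntegrable (traceFun (weightedMeasure d n α) f) volume := fun f hf => by
    obtain ⟨T, -, hTi, -, -, hTe, -⟩ := exists_trace hn hp hs hs1.le hα1 hα hf
    exact hTi.congr hTe.symm
  have hbd : ∀ f ∈ sobolevSpace p (weightedMeasure d n α),
      besovNorm s p p volume (traceFun (weightedMeasure d n α) f) ≤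
        (traceConst d n p s + 1) * sobolevNorm p (weightedMeasure d n α) f := fun f hf => by
    obtain ⟨T, -, -, -, -, hTe, hTb⟩ := exists_trace hn hp hs hs1.le hα1 hα hf
    rwa [besovNorm_congr_ae hTe]
  refine ⟨hmem, ⟨(extensionConst d n p α ^ (1 / p) +
      gradientConst d n p α C ^ (1 / p)).toNNReal, fun f hf => ?_⟩, fun f hf => ?_, hloc,
    fun f hf => ⟨hloc f hf, (hbd f hf).trans_lt (ENNReal.mul_lt_top hCt.lt_top hf.2)⟩,
    ⟨(traceConst d n p s + 1).toNNReal, fun f hf => ?_⟩, fun f hf => ?_⟩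
  · rw [ENNReal.coe_toNNReal hCe]
    exact (whitneyExtension_sobolev hn hp hs hα0 hα hψ hC hf).2.2
  · obtain ⟨T, -, -, -, hTt, -, -⟩ := exists_trace hn hp hs hs1.le hα1 hα hf
    filter_upwards [hTt] with x hx
    exact ⟨T x, hx⟩
  · rw [ENNReal.coe_toNNReal hCt]
    exact hbd f hf
  · obtain ⟨hF, hG, -⟩ := whitneyExtension_sobolev hn hp hs hα0 hα hψ hC hf
    obtain ⟨T, hTm, -, hTl, -, hTe, -⟩ := exists_trace hn hp hs hs1.le hα1 hα (hmem f hf)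
    have hE : energy p α (extensionGradient ψ f) ≠ ⊤ := by
      rw [← eLpNorm_rpow_eq_energy hn hp]
      exact ENNReal.rpow_ne_top_of_nonneg hp0.le (ne_top_of_le_ne_top (ENNReal.mul_ne_top
        (ENNReal.rpow_ne_top_of_nonneg (by positivity) (gradientConst_ne_top hp C)) hf.2.ne)
        (eLpNorm_extensionGradient_le hn hp hs.le hα hψ hC hf.1))
    exact hTe.trans (limit_boxAverage_whitneyExtension hn hp hs hα hψ hf hF hG hE hTm hTl)

end Pair

end

theorem mainTheorem6 (d n : ℕ) (hd : 1 ≤ d) (hn : 1 ≤ n) (p α : ℝ) (hp : 1 ≤ p)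
    (hα : -(n : ℝ) < α) (hαp : α < p - n)
    (ψ : DyadicCube (Fin d ⊕ Fin n) → Ambient d n → ℝ) (hψ : IsWhitneyBumpFamily d n ψ) :
    IsWhitneyTraceExtensionPair ψ (weightedMeasure d n α)
      (besovSpace (1 - (α + n) / p) p p volume) (besovNorm (1 - (α + n) / p) p p volume)
      (sobolevSpace p (weightedMeasure d n α)) (sobolevNorm p (weightedMeasure d n α)) := by
  have hp0 : 0 < p := by linarith
  have h1 : (α + n) / p < 1 := by
    rw [div_lt_one hp0]
    linarith
  have h2 : 0 < (α + n) / p := div_pos (by linarith) hp0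
  refine isWhitneyTraceExtensionPair hn hp (by linarith) (by linarith) ?_ hψ
  field_simp
  ring
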